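/- Let $G=(V,E)$ be a connected graph with $n=|V|\ge 2$ vertices, $m=|E|$ edges and maximum degree $\Delta\le 3$, carrying a pairwise binary Markov random field with non-negative factors $\psi_v,\psi_{u,v}$ and a fixed point of belief propagation, with messages $m_{u\to v}(x_v)\propto\sum_{x_u}\psi_{u,v}(x_u,x_v)\psi_u(x_u)\prod_{w\in N(u)\setminus v}m_{w\to u}(x_u)$, vertex beliefs $\tau_v(x_v)\propto\psi_v(x_v)\prod_{u\in N(v)}m_{u\to v}(x_v)$ and edge beliefs $\tau_{u,v}(x_u,x_v)\propto\psi_{u,v}(x_u,x_v)\,\psi_u(x_u)\prod_{w\in N(u)\setminus v}m_{w\to u}(x_u)\;\psi_v(x_v)\prod_{w\in N(v)\setminus u}m_{w\to v}(x_v)$. Assume $0<\tau_v(1)<1$ for all $v$. A 2-regular loop is an edge set $F\subseteq E$ (possibly empty) in which every vertex has degree $d_F(v)\in\{0,2\}$; let $\mathcal L$ be the set of these, and $$w(F)=\prod_{(u,v)\in F}\Big(\tfrac{\tau_{u,v}(1,1)}{\tau_u(1)\tau_v(1)}-1\Big)\prod_{v:\,d_F(v)>0}\Big(\tau_v(1)+(-1)^{d_F(v)}\big(\tfrac{\tau_v(1)}{1-\tau_v(1)}\big)^{d_F(v)-1}\tau_v(1)\Big),\qquad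 Z_{\text{2-Loop}}=\sum_{F\in\mathcal L}w(F).$$ For $e=(u,v)\in E$ put $w(e)=\Big|\frac{\tau_{u,v}(1,1)-\tau_u(1)\tau_v(1)}{\sqrt{\tau_u(1)\tau_v(1)(1-\tau_u(1))(1-\tau_v(1))}}\Big|$, and let $w_{\min}=\min_{e\in E}w(e)$ and $\zeta=\sum_{F\in\mathcal L,\,w(F)<0}|w(F)|\big/\sum_{F\in\mathcal L}|w(F)|$. Assume $w_{\min}>0$ and $\zeta<1/2$ (so that $Z_{\text{2-Loop}}>0$). Worm chain at $\beta\in[0,1]$. Its states are the edge sets $F$ with zero or two odd-degree vertices, with weight $w_\beta(F)=\prod_{e\in F}w(e)^\beta$. If $F\in\mathcal L$ pick $v$ uniformly from $V$, otherwise pick $v$ uniformly from the two odd-degree vertices of $F$; pick a uniform neighbour $u$ of $v$ in $G$; replace $F$ by $F'=F\oplus\{uv\}$ with probability $\tfrac12\min\big(1,\tfrac{w_\beta(F')}{w_\beta(F)}\big)$ if $F\in\mathcal L$ or $F'\in\mathcal L$, and with probability $\tfrac12\min\big(1,\tfrac{d(v)}{d(u)}\tfrac{w_\beta(F')}{w_\beta(F)}\big)$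 otherwise; else keep $F$. Sampler (Algorithm 1) with inputs $N,T$: at most $N$ times, run the chain for $T$ steps from $\emptyset$, and output the first final state that lies in $\mathcal L$; if there is none, output $\emptyset$. Estimator (Algorithm 2) with $\beta_i=i/n$: for $i=0,\dots,n-1$ let $H_i=\frac1{s_1}\sum_{j=1}^{s_1}|w(F_j)|^{\beta_{i+1}-\beta_i}$ over independent samples $F_j$ of the sampler at $\beta_i$ with inputs $N_1,T_1$; let $\kappa$ be the fraction of samples with $w(F_j)<0$ among $s_2$ independent samples at $\beta=1$ with inputs $N_2,T_2$; output $\widehat Z_{\text{2-Loop}}=(1-2\kappa)\,2^{m-n+1}\prod_iH_i$. Let $0<\varepsilon\le1$ and $\nu>0$. If $$\begin{aligned} s_1&\ge18144\,n^2\varepsilon^{-2}w_{\min}^{-1}\lceil\log(6n\nu^{-1})\rceil,\qquad N_1\ge1.2\,n\log(144\,n\,\varepsilon^{-1}w_{\min}^{-1}),\\ T_1&\ge(m-n+1)\log2+4\Delta mn^4\log(48\,n\,\varepsilon^{-1}w_{\min}^{-1}),\\ s_2&\ge18144\,\max\big(\zeta,\tfrac{\varepsilon(1-2\zeta)}6\big)(1-2\zeta)^{-2}\varepsilon^{-2}\lceil\log(3\nu^{-1})\rceil,\qquad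 N_2\ge1.2\,n\log(144\,\varepsilon^{-1}(1-2\zeta)^{-1}),\\ T_2&\ge(m-n+1)\log2+4\Delta mn^4\log(48\,\varepsilon^{-1}(1-2\zeta)^{-1}), \end{aligned}$$ then $$P\left[\frac{|\widehat Z_{\text{2-Loop}}-Z_{\text{2-Loop}}|}{Z_{\text{2-Loop}}}\le\varepsilon\right]\ge1-\nu .$$ Moreover there is one polynomial in five variables, independent of the graph, the model, $\varepsilon$ and $\nu$, such that for $\nu\le1$ and for the smallest admissible non-negative integers $s_1,N_1,T_1,s_2,N_2,T_2$ every run of the estimator takes at most as many elementary operations (real arithmetic with unit cost, uniform choices and coin tosses) as the value of this polynomial at $n$, $1/\varepsilon$, $\log(1/\nu)$, $1/w_{\min}$, $1/(1-2\zeta)$. Hence the complexity is polynomial in $n$, $1/\varepsilon$ and $\log(1/\nu)$ whenever $w_{\min}^{-1}$ and $(1-2\zeta)^{-1}$ are polynomially bounded in $n$. -/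

import Mathlib

open Finset

noncomputable section

/-! ## Randomized programs with a step count

The machine is a real-arithmetic machine with coin tosses: an arithmetic operation or comparison of
reals (including `√` and powers), a test or update of one table entry, a uniform choice from a listed
finite set, and a biased coin toss each cost a bounded number of elementary operations. -/

/-- A randomized program with result in `α`: the joint law of (result, number of elementary
operations performed). -/
def Timed (α : Type*) := PMF (α × ℕ)

namespace Timed

/-- Return `a` after spending `k` elementary operations. -/
def charge {α : Type*} (k : ℕ) (a : α) : Timed α := PMF.pure (a, k)

/-- Return `a` at no cost. -/
def ret {α : Type*} (a : α) : Timed α := charge 0 a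

/-- Sequential composition with fresh randomness; the costs add up. -/
def bind {α β : Type*} (p : Timed α) (f : α → Timed β) : Timed β :=
  PMF.bind p fun x => PMF.map (fun y => (y.1, x.2 + y.2)) (f x.1)

/-- Uniform choice from a finite set, one operation. (The default value on the empty set is never
used by the algorithms below on connected graphs with at least two vertices.) -/
def choose {α : Type*} [Nonempty α] (s : Finset α) : Timed α :=
  if h : s.Nonempty then PMF.map (fun a => (a, 1)) (PMF.uniformOfFinset s h)
  else charge 1 (Classical.arbitrary α)

/-- A coin with success probability `p` (clipped to `[0, 1]`), one operation. -/
def coin (p : ℝ) : Timed Bool :=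
  PMF.map (fun b => (b, 1)) (PMF.ofFintype
    (fun b : Bool => if b then min (ENNReal.ofReal p) 1 else 1 - min (ENNReal.ofReal p) 1) (by
      rw [Fintype.sum_bool]
      simp))

/-- Select the elements of `s` satisfying `q`, at cost `c` per tested element. -/
def filter {α : Type*} (c : ℕ) (s : Finset α) (q : α → Prop) [DecidablePred q] :
    Timed (Finset α) :=
  charge (c * s.card) (s.filter q)

/-- Multiply the numbers `f i`, `i ∈ s`, at cost `c` per factor. -/
def prod {α : Type*} (c : ℕ) (s : Finset α) (f : α → ℝ) : Timed ℝ :=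
  charge (c * s.card) (∏ i ∈ s, f i)

/-- Run `step` `t` times, starting from a given state. -/
def iterate {α : Type*} (step : α → Timed α) : ℕ → α → Timed α
  | 0, a => ret a
  | t + 1, a => (step a).bind (iterate step t)

/-- Sum of the results of `s` independent runs. -/
def sumRuns (X : Timed ℝ) : ℕ → Timed ℝ
  | 0 => ret 0
  | s + 1 => (sumRuns X s).bind fun S => X.bind fun x => charge 1 (S + x)

/-- Average of the results of `s` independent runs. -/
def meanRuns (X : Timed ℝ) (s : ℕ) : Timed ℝ :=
  (sumRuns X s).bind fun S => charge 1 (S / s)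

/-- The probability that the result of the program lies in `S`. -/
def prob {α : Type*} (p : Timed α) (S : Set α) : ℝ :=
  (PMF.toOuterMeasure p {x | x.1 ∈ S}).toReal

/-- Every possible run of the program takes at most `k` elementary operations. -/
def CostLE {α : Type*} (p : Timed α) (k : ℝ) : Prop :=
  ∀ x ∈ PMF.support p, ((x.2 : ℕ) : ℝ) ≤ k

end Timed

/-! ## Subgraphs, given by their edge sets -/

/-- The degree of `v` in the subgraph with edge set `F`. -/
def degIn {V : Type*} [DecidableEq V] (F : Finset (Sym2 V)) (v : V) : ℕ :=
  (F.filter fun e => v ∈ e).card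

/-- Every vertex of the subgraph has degree two in it (vertices of degree `0` do not belong to the
subgraph). -/
def IsTwoRegular {V : Type*} [Fintype V] [DecidableEq V] (F : Finset (Sym2 V)) : Prop :=
  ∀ v, degIn F v = 0 ∨ degIn F v = 2

instance {V : Type*} [Fintype V] [DecidableEq V] :
    DecidablePred (IsTwoRegular : Finset (Sym2 V) → Prop) :=
  fun F => inferInstanceAs (Decidable (∀ v, degIn F v = 0 ∨ degIn F v = 2))

/-- The 2-regular loops of `G`, including the empty one. -/
def twoLoops {V : Type*} [Fintype V] [DecidableEq V] (G : SimpleGraph V) [DecidableRel G.Adj] :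
    Finset (Finset (Sym2 V)) :=
  G.edgeFinset.powerset.filter IsTwoRegular

/-! ## Pairwise binary models with a fixed point of belief propagation -/

/-- A pairwise binary Markov random field on `G` (with values `false = 0`, `true = 1`) together with
a fixed point of belief propagation. `psiE u v x y` is the factor of the edge `uv` at `x_u = x`,
`x_v = y`, and `msg u v` is the message from `u` to `v`; only the values at edges of `G` matter. -/
structure BPModel {V : Type*} [Fintype V] [DecidableEq V]
    (G : SimpleGraph V) [DecidableRel G.Adj] where
  psiV : V → Bool → ℝ
  psiE : V → V → Bool → Bool → ℝ
  msg : V → V → Bool → ℝ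
  psiV_nonneg : ∀ v x, 0 ≤ psiV v x
  psiE_nonneg : ∀ u v x y, 0 ≤ psiE u v x y
  psiE_symm : ∀ u v x y, psiE u v x y = psiE v u y x
  msg_nonneg : ∀ u v x, 0 ≤ msg u v x
  fixed_point : ∀ u v, G.Adj u v → ∃ c > 0, ∀ y, msg u v y =
    c * ∑ x, psiE u v x y * psiV u x * ∏ w ∈ (G.neighborFinset u).erase v, msg w u x

namespace BPModel

variable {V : Type*} [Fintype V] [DecidableEq V] {G : SimpleGraph V} [DecidableRel G.Adj]

/-- Unnormalized vertex belief. -/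
def belV (B : BPModel G) (v : V) (x : Bool) : ℝ :=
  B.psiV v x * ∏ u ∈ G.neighborFinset v, B.msg u v x

/-- The estimated marginal `τ_v(x)`. -/
def tauV (B : BPModel G) (v : V) (x : Bool) : ℝ :=
  B.belV v x / ∑ x', B.belV v x'

/-- Unnormalized edge belief. -/
def belE (B : BPModel G) (u v : V) (x y : Bool) : ℝ :=
  B.psiE u v x y * ((B.psiV u x * ∏ w ∈ (G.neighborFinset u).erase v, B.msg w u x) *
    (B.psiV v y * ∏ w ∈ (G.neighborFinset v).erase u, B.msg w v y))

/-- The estimated pair marginal `τ_{u,v}(x, y)`. -/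
def tauE (B : BPModel G) (u v : V) (x y : Bool) : ℝ :=
  B.belE u v x y / ∑ x', ∑ y', B.belE u v x' y'

lemma belE_symm (B : BPModel G) (u v : V) (x y : Bool) : B.belE u v x y = B.belE v u y x := by
  unfold belE
  rw [B.psiE_symm u v x y]
  ring

lemma tauE_symm (B : BPModel G) (u v : V) (x y : Bool) : B.tauE u v x y = B.tauE v u y x := by
  unfold tauE
  rw [B.belE_symm u v x y, Finset.sum_comm]
  simp only [B.belE_symm u v]

/-- The factor `τ_{u,v}(1,1) / (τ_u(1) τ_v(1)) - 1` of an edge in the loop weight. -/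
def edgeFactor (B : BPModel G) : Sym2 V → ℝ :=
  Sym2.lift ⟨fun u v => B.tauE u v true true / (B.tauV u true * B.tauV v true) - 1, fun u v => by
    dsimp only
    rw [B.tauE_symm u v, mul_comm (B.tauV u true)]⟩

/-- The factor of a vertex of degree `d` in the loop weight. -/
def vertexFactor (B : BPModel G) (d : ℕ) (v : V) : ℝ :=
  B.tauV v true + (-1) ^ d * (B.tauV v true / (1 - B.tauV v true)) ^ (d - 1) * B.tauV v true

/-- The weight `w(F)` of a generalized loop in the loop series. -/
def loopWeight (B : BPModel G) (F : Finset (Sym2 V)) : ℝ :=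
  (∏ e ∈ F, B.edgeFactor e) *
    ∏ v ∈ univ.filter (fun v => 0 < degIn F v), B.vertexFactor (degIn F v) v

/-- The edge weight `w(e)`, the absolute correlation coefficient of the two ends. -/
def edgeWeight (B : BPModel G) : Sym2 V → ℝ :=
  Sym2.lift ⟨fun u v =>
    |(B.tauE u v true true - B.tauV u true * B.tauV v true) /
      √(B.tauV u true * B.tauV v true * (1 - B.tauV u true) * (1 - B.tauV v true))|, fun u v => by
    dsimp only
    rw [B.tauE_symm u v, mul_comm (B.tauV u true) (B.tauV v true), mul_right_comm
      (B.tauV v true * B.tauV u true)]⟩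

/-- The smallest edge weight. -/
def wmin (B : BPModel G) : ℝ := ⨅ e : G.edgeSet, B.edgeWeight e

/-- The 2-regular loop series `Z_{2-Loop}`. -/
def Z (B : BPModel G) : ℝ := ∑ F ∈ twoLoops G, B.loopWeight F

/-- The sum of the absolute values of the terms of the 2-regular loop series. -/
def Zabs (B : BPModel G) : ℝ := ∑ F ∈ twoLoops G, |B.loopWeight F|

/-- The probability of a 2-regular loop under the law proportional to `|w(F)|`. -/
def piLoop (B : BPModel G) (F : Finset (Sym2 V)) : ℝ := |B.loopWeight F| / B.Zabs

/-- The probability `ζ` of a loop of negative weight. -/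
def zeta (B : BPModel G) : ℝ :=
  ∑ F ∈ (twoLoops G).filter (fun F => B.loopWeight F < 0), B.piLoop F

/-! ## The algorithms -/

/-- Test whether a subgraph is 2-regular, scanning its edges once for every vertex. -/
def testTwoRegular (F : Finset (Sym2 V)) : Timed Bool :=
  Timed.charge (Fintype.card V * (F.card + 1)) (decide (IsTwoRegular F))

/-- One step of the Worm algorithm for the edge weights `w(e) ^ β`. From a 2-regular loop a vertex
`v` is drawn uniformly from all vertices, otherwise from the two odd-degree vertices; then a uniform
neighbour `u` of `v` is drawn, and the edge `uv` is flipped with the lazy Metropolis probability. -/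
def wormStep [Nonempty V] (B : BPModel G) (β : ℝ) (F : Finset (Sym2 V)) :
    Timed (Finset (Sym2 V)) :=
  (testTwoRegular F).bind fun even =>
  (Timed.filter (F.card + 1) univ (fun v : V => Odd (degIn F v))).bind fun odd =>
  (Timed.choose (if even then univ else odd)).bind fun v =>
  (Timed.filter 1 univ (fun u => G.Adj v u)).bind fun Nv =>
  (Timed.choose Nv).bind fun u =>
  (Timed.filter 1 univ (fun x => G.Adj u x)).bind fun Nu =>
  (Timed.charge (F.card + 1) (symmDiff F {s(v, u)})).bind fun F' =>
  (testTwoRegular F').bind fun even' =>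
  (Timed.prod 2 F (fun e => B.edgeWeight e ^ β)).bind fun wF =>
  (Timed.prod 2 F' (fun e => B.edgeWeight e ^ β)).bind fun wF' =>
  (Timed.coin (if even || even' then min 1 (wF' / wF) / 2
    else min 1 ((Nv.card : ℝ) / Nu.card * (wF' / wF)) / 2)).bind fun accept =>
  Timed.charge 10 (if accept then F' else F)

/-- Sampling of 2-regular loops: up to `N` times, run `T` steps of the Worm algorithm from `∅`, and
output the first state reached that is a 2-regular loop; output `∅` if there is none. -/
def sampleLoop [Nonempty V] (B : BPModel G) (β : ℝ) (T : ℕ) : ℕ → Timed (Finset (Sym2 V))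
  | 0 => Timed.ret ∅
  | N + 1 =>
    (Timed.iterate (B.wormStep β) T ∅).bind fun F =>
    (testTwoRegular F).bind fun even =>
    if even then Timed.ret F else sampleLoop B β T N

/-- Evaluation of `w(F)` from the stored marginals. -/
def evalWeight (B : BPModel G) (F : Finset (Sym2 V)) : Timed ℝ :=
  (Timed.prod 5 F B.edgeFactor).bind fun x =>
  (Timed.filter (F.card + 1) univ (fun v : V => 0 < degIn F v)).bind fun VF =>
  (Timed.prod (F.card + 10) VF (fun v => B.vertexFactor (degIn F v) v)).bind fun y =>
  Timed.charge 1 (x * y)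

/-- One annealing stage: the average of `|w(F_j)| ^ (β' - β)` over `s` samples at `β`. -/
def stage [Nonempty V] (B : BPModel G) (β β' : ℝ) (s N T : ℕ) : Timed ℝ :=
  Timed.meanRuns ((B.sampleLoop β T N).bind fun F => (B.evalWeight F).bind fun x =>
    Timed.charge 3 (|x| ^ (β' - β))) s

/-- The product of the first `k` stages `H_0 ⋯ H_{k-1}` for the cooling schedule `β`. -/
def anneal [Nonempty V] (B : BPModel G) (β : ℕ → ℝ) (s N T : ℕ) : ℕ → Timed ℝ
  | 0 => Timed.ret 1
  | k + 1 => (anneal B β s N T k).bind fun P =>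
      (B.stage (β k) (β (k + 1)) s N T).bind fun H => Timed.charge 1 (P * H)

/-- The fraction `κ` of samples of negative weight among `s` samples. -/
def negFraction [Nonempty V] (B : BPModel G) (s N T : ℕ) : Timed ℝ :=
  Timed.meanRuns ((B.sampleLoop 1 T N).bind fun F => (B.evalWeight F).bind fun x =>
    Timed.charge 1 (if x < 0 then 1 else 0)) s

/-- The estimator `(1 - 2κ) 2^{m-n+1} ∏ H_i` of the 2-regular loop series. -/
def estimate [Nonempty V] (B : BPModel G) (β : ℕ → ℝ) (s₁ N₁ T₁ s₂ N₂ T₂ : ℕ) : Timed ℝ :=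
  (B.anneal β s₁ N₁ T₁ (Fintype.card V)).bind fun H =>
  (B.negFraction s₂ N₂ T₂).bind fun κ =>
  Timed.charge (G.edgeFinset.card + 5)
    ((1 - 2 * κ) * (2 : ℝ) ^ ((G.edgeFinset.card : ℤ) - Fintype.card V + 1) * H)

end BPModel

/-! ## The parameters of the estimator, with `n` vertices, `m` edges and maximum degree `Δ` -/

/-- Number of samples in each annealing stage. -/
def s1Bound (n : ℕ) (ε ν w : ℝ) : ℝ :=
  18144 * n ^ 2 * (ε ^ 2)⁻¹ * w⁻¹ * ⌈Real.log (6 * n * ν⁻¹)⌉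

/-- Number of trials for one sample in the annealing stages. -/
def N1Bound (n : ℕ) (ε w : ℝ) : ℝ :=
  1.2 * n * Real.log (144 * n * ε⁻¹ * w⁻¹)

/-- Number of steps of the Worm algorithm for one trial in the annealing stages. -/
def T1Bound (n m Δ : ℕ) (ε w : ℝ) : ℝ :=
  ((m : ℝ) - n + 1) * Real.log 2 + 4 * Δ * m * n ^ 4 * Real.log (48 * n * ε⁻¹ * w⁻¹)

/-- Number of samples for the sign. -/
def s2Bound (ε ν ζ : ℝ) : ℝ :=
  18144 * max ζ (ε * (1 - 2 * ζ) / 6) * ((1 - 2 * ζ) ^ 2)⁻¹ * (ε ^ 2)⁻¹ * ⌈Real.log (3 * ν⁻¹)⌉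

/-- Number of trials for one sample for the sign. -/
def N2Bound (n : ℕ) (ε ζ : ℝ) : ℝ :=
  1.2 * n * Real.log (144 * ε⁻¹ * (1 - 2 * ζ)⁻¹)

/-- Number of steps of the Worm algorithm for one trial for the sign. -/
def T2Bound (n m Δ : ℕ) (ε ζ : ℝ) : ℝ :=
  ((m : ℝ) - n + 1) * Real.log 2 + 4 * Δ * m * n ^ 4 * Real.log (48 * ε⁻¹ * (1 - 2 * ζ)⁻¹)

end

open scoped ENNReal symmDiff

set_option linter.unusedSectionVars false

noncomputable section

/-! Reduction to a ferromagnetic-type sum. Since degrees are at most three, a 2-regular loop is the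
same as an even subgraph (`twoLoops_eq`). At degree two the vertex factor is `τ/(1-τ)`; sharing its
square root between the two incident edges turns `|w(F)|` into the product of the edge weights
(`abs_loopWeight`). These are correlation coefficients of true couplings, because a fixed point of
belief propagation is locally consistent, so they lie in `[wmin, 1]` (`edgeWeight_le_one`). The
signs enter only through `Z = (1 - 2ζ) Zabs` (`Z_eq`).

Annealing. `Zbeta 0` counts the even subgraphs, `2^(m-n+1)` by the dimension of the cycle space, and
`Zbeta 1 = Zabs`. The ratio of consecutive values at `β = i/n` is the mean of `|w|^(1/n)`, which
lies in `[wmin, 1]` because a loop has at most `n` edges. Chernoff's bound for each ratio and for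
`ζ`, together with a union bound, gives `estimate_accuracy`.

Mixing. The worm chain is reversible for the weight `ends F * ∏ w(e)^β`, where `ends` counts the
possible starting vertices of a move. A worm `I` is joined to an even `F` by removing the edges of
`H = I ∆ F` one at a time along worms. Along the path the product of the weights of the current
state `A` and of `A ∆ H` is constant, so the congestion through a transition is a sum of weights
over parity classes. The high-temperature expansion shows that no parity class outweighs the even
one (`oddSum_le`), hence a Poincaré inequality with constant `4Δmn²` (`wormChain_poincare`). With a
lazy chain this gives `L²` decay from `∅`. In equilibrium a state is even with probability at least
`1/n`, so rejection needs about `n` trials up to a logarithm (`avg_sampleLoop`).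

The running time is added up along the program, and every logarithm of a parameter other than `ν` is
bounded by its argument to obtain one polynomial. -/

/-! ## Laws and expectations of randomized programs -/

namespace Timed

variable {α β : Type*}

/-- The law of the result of a program. -/
def law (p : Timed α) : PMF α := PMF.map Prod.fst p

lemma law_charge (k : ℕ) (a : α) : (charge k a).law = PMF.pure a := by
  simp [law, charge, PMF.pure_map]

lemma law_ret (a : α) : (ret a).law = PMF.pure a := law_charge 0 a

lemma law_bind (p : Timed α) (f : α → Timed β) :
    (p.bind f).law = p.law.bind fun a => (f a).law := by
  have key (p : PMF (α × ℕ)) (f : α → PMF (β × ℕ)) :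
      PMF.map Prod.fst (p.bind fun x => PMF.map (fun y => (y.1, x.2 + y.2)) (f x.1)) =
        (PMF.map Prod.fst p).bind fun a => PMF.map Prod.fst (f a) := by
    simp only [PMF.map_bind, PMF.bind_map, PMF.map_comp, Function.comp_def]
  exact key p f

lemma choose_of_nonempty [Nonempty α] {s : Finset α} (h : s.Nonempty) :
    choose s = PMF.map (fun a => (a, 1)) (PMF.uniformOfFinset s h) :=
  dif_pos h

lemma choose_of_not_nonempty [Nonempty α] {s : Finset α} (h : ¬s.Nonempty) :
    choose s = charge 1 (Classical.arbitrary α) :=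
  dif_neg h

lemma law_choose [Nonempty α] {s : Finset α} (h : s.Nonempty) :
    (choose s).law = PMF.uniformOfFinset s h := by
  have key : PMF.map Prod.fst (PMF.map (fun a => (a, 1)) (PMF.uniformOfFinset s h)) =
      PMF.uniformOfFinset s h := by
    rw [PMF.map_comp]
    exact PMF.map_id _
  rw [law, choose_of_nonempty h]
  exact key

lemma law_filter (c : ℕ) (s : Finset α) (q : α → Prop) [DecidablePred q] :
    (filter c s q).law = PMF.pure (s.filter q) := law_charge _ _

lemma law_prod (c : ℕ) (s : Finset α) (f : α → ℝ) :
    (prod c s f).law = PMF.pure (∏ i ∈ s, f i) := law_charge _ _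

lemma prob_eq (p : Timed α) (S : Set α) : p.prob S = (p.law.toOuterMeasure S).toReal := by
  exact congrArg ENNReal.toReal (PMF.toOuterMeasure_map_apply Prod.fst p S).symm

end Timed

/-! ### Expectations: real-valued on finite types, `[0, ∞]`-valued on arbitrary types. -/

namespace PMF

variable {α β : Type*}

/-- Expectation of a real function on a finite type. -/
def avg [Fintype α] (p : PMF α) (g : α → ℝ) : ℝ := ∑ a, (p a).toReal * g a

lemma sum_toReal [Fintype α] (p : PMF α) : ∑ a, (p a).toReal = 1 := by
  rw [← ENNReal.toReal_sum fun a _ => p.apply_ne_top a, ← tsum_fintype (L := .unconditional _), p.tsum_coe, ENNReal.toReal_one]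

lemma avg_const [Fintype α] (p : PMF α) (c : ℝ) : p.avg (fun _ => c) = c := by
  rw [avg, ← Finset.sum_mul, sum_toReal, one_mul]

lemma avg_sub [Fintype α] (p : PMF α) (g h : α → ℝ) :
    p.avg (fun a => g a - h a) = p.avg g - p.avg h := by
  simp [avg, mul_sub]

lemma avg_add [Fintype α] (p : PMF α) (g h : α → ℝ) :
    p.avg (fun a => g a + h a) = p.avg g + p.avg h := by
  simp [avg, mul_add, Finset.sum_add_distrib]

lemma avg_mul_left [Fintype α] (p : PMF α) (c : ℝ) (g : α → ℝ) :
    p.avg (fun a => c * g a) = c * p.avg g := by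
  simp only [avg, Finset.mul_sum]
  exact Finset.sum_congr rfl fun a _ => by ring

lemma avg_mono [Fintype α] (p : PMF α) {g h : α → ℝ} (H : ∀ a, p a ≠ 0 → g a ≤ h a) :
    p.avg g ≤ p.avg h := by
  refine Finset.sum_le_sum fun a _ => ?_
  by_cases ha : p a = 0
  · simp [ha]
  · exact mul_le_mul_of_nonneg_left (H a ha) ENNReal.toReal_nonneg

lemma avg_pure [Fintype α] (a : α) (g : α → ℝ) : (PMF.pure a).avg g = g a := by
  classical
  simp [avg, PMF.pure_apply, apply_ite ENNReal.toReal, ite_mul]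

lemma avg_bind [Fintype α] [Fintype β] (p : PMF α) (f : α → PMF β) (g : β → ℝ) :
    (p.bind f).avg g = p.avg fun a => (f a).avg g := by
  simp only [avg, PMF.bind_apply, tsum_fintype, Finset.mul_sum]
  rw [Finset.sum_comm]
  refine Finset.sum_congr rfl fun b _ => ?_
  rw [ENNReal.toReal_sum fun a _ => ENNReal.mul_ne_top (p.apply_ne_top a) ((f a).apply_ne_top b),
    Finset.sum_mul]
  exact Finset.sum_congr rfl fun a _ => by rw [ENNReal.toReal_mul, mul_assoc]

lemma avg_uniformOfFinset [Fintype α] (s : Finset α) (h : s.Nonempty) (g : α → ℝ) :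
    (PMF.uniformOfFinset s h).avg g = ∑ a ∈ s, (s.card : ℝ)⁻¹ * g a := by
  classical
  simp only [avg, PMF.uniformOfFinset_apply, apply_ite ENNReal.toReal, ite_mul,
    ENNReal.toReal_zero, zero_mul, Finset.sum_ite_mem, Finset.univ_inter, ENNReal.toReal_inv,
    ENNReal.toReal_natCast]

/-- Converts averages computed by transition operators into statements about the support of a law.
-/
lemma apply_eq_zero_of_avg [Fintype α] (p : PMF α) {g : α → ℝ} (hg : ∀ a, 0 ≤ g a)
    (h : p.avg g = 0) {a : α} (ha : g a ≠ 0) : p a = 0 := by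
  have := (Finset.sum_eq_zero_iff_of_nonneg fun a _ =>
    mul_nonneg ENNReal.toReal_nonneg (hg a)).1 h a (Finset.mem_univ a)
  rcases mul_eq_zero.1 this with h0 | h0
  · exact ((ENNReal.toReal_eq_zero_iff _).1 h0).resolve_right (p.apply_ne_top a)
  · exact absurd h0 ha

/-- Expectation of a function with values in `[0, ∞]`. -/
def mean (p : PMF α) (h : α → ℝ≥0∞) : ℝ≥0∞ := ∑' a, p a * h a

lemma mean_pure (a : α) (h : α → ℝ≥0∞) : (PMF.pure a).mean h = h a := by
  classical
  rw [mean, tsum_eq_single a]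
  · simp
  · intro b hb
    simp [PMF.pure_apply, hb]

lemma mean_bind (p : PMF α) (f : α → PMF β) (h : β → ℝ≥0∞) :
    (p.bind f).mean h = p.mean fun a => (f a).mean h := by
  simp only [mean, PMF.bind_apply, ← ENNReal.tsum_mul_right, ← ENNReal.tsum_mul_left]
  rw [ENNReal.tsum_comm]
  simp only [mul_assoc]

lemma mean_const (p : PMF α) (c : ℝ≥0∞) : p.mean (fun _ => c) = c := by
  rw [mean, ENNReal.tsum_mul_right, p.tsum_coe, one_mul]

lemma mean_mul_right (p : PMF α) (h : α → ℝ≥0∞) (c : ℝ≥0∞) :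
    p.mean (fun a => h a * c) = p.mean h * c := by
  simp only [mean, ← ENNReal.tsum_mul_right, mul_assoc]

lemma mean_add (p : PMF α) (g h : α → ℝ≥0∞) :
    p.mean (fun a => g a + h a) = p.mean g + p.mean h := by
  simp only [mean, mul_add]
  exact ENNReal.tsum_add

lemma mean_mono (p : PMF α) {g h : α → ℝ≥0∞} (H : ∀ a, p a ≠ 0 → g a ≤ h a) :
    p.mean g ≤ p.mean h := by
  refine ENNReal.tsum_le_tsum fun a => ?_
  by_cases ha : p a = 0
  · simp [ha]
  · exact mul_le_mul_right (H a ha) _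

lemma mean_ofReal [Fintype α] (p : PMF α) {g : α → ℝ} (hg : ∀ a, 0 ≤ g a) :
    p.mean (fun a => ENNReal.ofReal (g a)) = ENNReal.ofReal (p.avg g) := by
  rw [mean, tsum_fintype, avg, ENNReal.ofReal_sum_of_nonneg
    fun a _ => mul_nonneg ENNReal.toReal_nonneg (hg a)]
  refine Finset.sum_congr rfl fun a _ => ?_
  rw [ENNReal.ofReal_mul ENNReal.toReal_nonneg, ENNReal.ofReal_toReal (p.apply_ne_top a)]

lemma toOuterMeasure_eq_mean (p : PMF α) (S : Set α) :
    p.toOuterMeasure S = p.mean (S.indicator 1) := by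
  rw [PMF.toOuterMeasure_apply, mean]
  refine tsum_congr fun a => ?_
  by_cases h : a ∈ S <;> simp [h]

lemma toOuterMeasure_le_mean (p : PMF α) (S : Set α) (h : α → ℝ≥0∞) (H : ∀ a ∈ S, 1 ≤ h a) :
    p.toOuterMeasure S ≤ p.mean h := by
  rw [toOuterMeasure_eq_mean]
  refine mean_mono p fun a _ => ?_
  by_cases ha : a ∈ S
  · simpa [ha] using H a ha
  · simp [ha]

/-- The union bound for two successive stages: either the first stage fails, or it succeeds and the
second one fails. -/
lemma toOuterMeasure_bind_le (p : PMF α) (f : α → PMF β) (S : Set α) (R : Set β) (a b : ℝ≥0∞)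
    (h1 : p.toOuterMeasure S ≤ a) (h2 : ∀ x, x ∉ S → (f x).toOuterMeasure R ≤ b) :
    (p.bind f).toOuterMeasure R ≤ a + b := by
  rw [toOuterMeasure_eq_mean, mean_bind]
  calc p.mean (fun x => (f x).mean (R.indicator 1))
      ≤ p.mean (fun x => S.indicator 1 x + b) := by
        refine mean_mono p fun x _ => ?_
        rw [← toOuterMeasure_eq_mean]
        by_cases hx : x ∈ S
        · calc (f x).toOuterMeasure R ≤ 1 := by
                rw [toOuterMeasure_eq_mean]
                refine (mean_mono _ fun y _ => ?_).trans (mean_const (f x) 1).le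
                exact Set.indicator_le_self' (fun _ _ => zero_le) y
            _ ≤ _ := by simp [hx]
        · simpa [hx] using h2 x hx
    _ = p.toOuterMeasure S + b := by
        rw [toOuterMeasure_eq_mean, mean_add, mean_const]
    _ ≤ a + b := by gcongr

end PMF

namespace Timed

variable {α : Type*}

lemma avg_coin {p : ℝ} (h0 : 0 ≤ p) (h1 : p ≤ 1) (g : Bool → ℝ) :
    (coin p).law.avg g = p * g true + (1 - p) * g false := by
  have h : min (ENNReal.ofReal p) 1 = ENNReal.ofReal p :=
    min_eq_left (by simpa using ENNReal.ofReal_le_ofReal h1)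
  have h2 : (1 - ENNReal.ofReal p).toReal = 1 - p := by
    rw [ENNReal.toReal_sub_of_le (by simpa using ENNReal.ofReal_le_ofReal h1) (by simp),
      ENNReal.toReal_ofReal h0, ENNReal.toReal_one]
  have key (q : PMF Bool) : PMF.map Prod.fst (PMF.map (fun b => (b, 1)) q) = q := by
    rw [PMF.map_comp]
    exact PMF.map_id _
  unfold law coin
  rw [key]
  simp [PMF.avg, h, h2, ENNReal.toReal_ofReal h0]

lemma avg_iterate [Fintype α] (step : α → Timed α) (t : ℕ) (a : α) (g : α → ℝ) :
    (iterate step t a).law.avg g =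
      (fun h b => (step b).law.avg h)^[t] g a := by
  induction t generalizing a with
  | zero => simp [iterate, law_ret, PMF.avg_pure]
  | succ t ih =>
    rw [iterate, law_bind, PMF.avg_bind, Function.iterate_succ_apply']
    simp only [ih]

/-! ## A Chernoff bound -/

/-- Each run uses fresh randomness, so exponential moments multiply. -/
lemma mean_exp_sumRuns (X : Timed ℝ) (lam : ℝ) (s : ℕ) :
    (sumRuns X s).law.mean (fun z => ENNReal.ofReal (Real.exp (lam * z))) =
      X.law.mean (fun z => ENNReal.ofReal (Real.exp (lam * z))) ^ s := by
  induction s with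
  | zero => simp [sumRuns, law_ret, PMF.mean_pure]
  | succ s ih =>
    rw [sumRuns, law_bind, PMF.mean_bind, pow_succ, ← ih, ← PMF.mean_mul_right]
    congr 1
    funext S
    rw [law_bind, PMF.mean_bind, mul_comm, ← PMF.mean_mul_right]
    congr 1
    funext x
    rw [law_charge, PMF.mean_pure, mul_add, add_comm, Real.exp_add,
      ENNReal.ofReal_mul (Real.exp_pos _).le]

/-- Convexity bounds `exp (lam * g)` by the chord over `[0, 1]`; then `exp lam ≤ 1 + lam + lam²` for
`|lam| ≤ 1` and `1 + x ≤ exp x`. -/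
lemma mean_exp_le [Fintype α] (p : PMF α) (X : Timed ℝ) (g : α → ℝ)
    (hX : X.law = p.bind fun a => PMF.pure (g a)) (h01 : ∀ a, p a ≠ 0 → 0 ≤ g a ∧ g a ≤ 1)
    (lam : ℝ) (hlam : |lam| ≤ 1) :
    X.law.mean (fun z => ENNReal.ofReal (Real.exp (lam * z))) ≤
      ENNReal.ofReal (Real.exp (p.avg g * (lam + lam ^ 2))) := by
  rw [hX, PMF.mean_bind]
  simp only [PMF.mean_pure]
  rw [PMF.mean_ofReal p fun a => (Real.exp_pos _).le]
  refine ENNReal.ofReal_le_ofReal ?_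
  have hm : 0 ≤ p.avg g := by
    rw [← PMF.avg_const p 0]
    exact PMF.avg_mono p fun a ha => (h01 a ha).1
  have he : Real.exp lam ≤ 1 + (lam + lam ^ 2) := by
    have := Real.abs_exp_sub_one_sub_id_le hlam
    linarith [(abs_le.1 this).2]
  calc p.avg (fun a => Real.exp (lam * g a))
      ≤ p.avg (fun a => 1 + (lam + lam ^ 2) * g a) := by
        refine PMF.avg_mono p fun a ha => ?_
        obtain ⟨h0, h1⟩ := h01 a ha
        have hc := convexOn_exp.2 (Set.mem_univ 0) (Set.mem_univ lam)
          (sub_nonneg.2 h1) h0 (by ring)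
        simp only [smul_eq_mul, mul_zero, zero_add, Real.exp_zero, mul_one] at hc
        rw [mul_comm]
        nlinarith
    _ = 1 + p.avg g * (lam + lam ^ 2) := by
        rw [PMF.avg_add, PMF.avg_const, PMF.avg_mul_left, mul_comm]
    _ ≤ _ := by linarith [Real.add_one_le_exp (p.avg g * (lam + lam ^ 2))]

/-- Chernoff's bound for the average of independent samples with values in `[0, 1]`. -/
lemma chernoff [Fintype α] (p : PMF α) (X : Timed ℝ) (g : α → ℝ)
    (hX : X.law = p.bind fun a => PMF.pure (g a)) (h01 : ∀ a, p a ≠ 0 → 0 ≤ g a ∧ g a ≤ 1)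
    (s : ℕ) (M t : ℝ) (hM : p.avg g ≤ M) (hM0 : 0 < M) (ht : 0 ≤ t) (htM : t ≤ 2 * M) :
    (meanRuns X s).law.toOuterMeasure {z | t < |z - p.avg g|} ≤
      ENNReal.ofReal (2 * Real.exp (-(s * t ^ 2 / (4 * M)))) := by
  -- Without samples the claimed bound is `2`, so nothing has to be shown; afterwards division by
  -- `s` is safe.
  rcases Nat.eq_zero_or_pos s with rfl | hs
  · calc _ ≤ (1 : ℝ≥0∞) := by
          refine (PMF.toOuterMeasure_le_mean _ _ (fun _ => 1) fun _ _ => le_rfl).trans ?_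
          rw [PMF.mean_const]
      _ ≤ _ := by simp
  have hs' : (0 : ℝ) < s := by exact_mod_cast hs
  set μ := p.avg g with hμ
  -- The minimizer of `M * l ^ 2 - l * t`, with value `-t² / (4M)`; `htM` is what keeps it at most
  -- `1`.
  set l := t / (2 * M) with hl
  have hl0 : 0 ≤ l := by positivity
  have hl1 : l ≤ 1 := by rw [hl, div_le_one (by positivity)]; exact htM
  have key : ∀ c : ℝ, |c| = l →
      (sumRuns X s).law.mean (fun z => ENNReal.ofReal (Real.exp (c * z))) *
        ENNReal.ofReal (Real.exp (-(c * (s * μ)) - l * (s * t))) ≤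
      ENNReal.ofReal (Real.exp (-(s * t ^ 2 / (4 * M)))) := by
    intro c hc
    have hc2 : c ^ 2 = l ^ 2 := by rw [← sq_abs, hc]
    rw [mean_exp_sumRuns]
    calc _ ≤ ENNReal.ofReal (Real.exp (μ * (c + c ^ 2))) ^ s *
          ENNReal.ofReal (Real.exp (-(c * (s * μ)) - l * (s * t))) := by
          gcongr
          exact mean_exp_le p X g hX h01 c (by rw [hc]; exact hl1)
      _ = ENNReal.ofReal (Real.exp (s * (μ * l ^ 2 - l * t))) := by
          rw [← ENNReal.ofReal_pow (Real.exp_pos _).le, ← Real.exp_nat_mul,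
            ← ENNReal.ofReal_mul (Real.exp_pos _).le, ← Real.exp_add, hc2]
          congr 2
          ring
      _ ≤ _ := by
          refine ENNReal.ofReal_le_ofReal (Real.exp_le_exp.2 ?_)
          have h1 : μ * l ^ 2 ≤ M * l ^ 2 := by gcongr
          have h2 : M * l ^ 2 - l * t = -(t ^ 2 / (4 * M)) := by
            rw [hl]; field_simp; ring
          have h3 : -(s * t ^ 2 / (4 * M)) = s * -(t ^ 2 / (4 * M)) := by ring
          rw [h3, ← h2]
          gcongr
  rw [meanRuns, law_bind]
  simp only [law_charge]
  rw [PMF.toOuterMeasure_eq_mean, PMF.mean_bind]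
  simp only [PMF.mean_pure]
  -- The indicator of a deviation is dominated by the exponentials with parameters `l` and `-l`, one
  -- for each tail.
  calc _ ≤ (sumRuns X s).law.mean (fun z =>
        ENNReal.ofReal (Real.exp (l * z)) *
          ENNReal.ofReal (Real.exp (-(l * (s * μ)) - l * (s * t))) +
        ENNReal.ofReal (Real.exp (-l * z)) *
          ENNReal.ofReal (Real.exp (-(-l * (s * μ)) - l * (s * t)))) := by
        refine PMF.mean_mono _ fun z _ => ?_
        by_cases hz : z / s ∈ {z : ℝ | t < |z - μ|}
        · rw [Set.indicator_of_mem hz, Pi.one_apply, ← ENNReal.ofReal_mul (Real.exp_pos _).le,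
            ← ENNReal.ofReal_mul (Real.exp_pos _).le, ← Real.exp_add, ← Real.exp_add]
          rcases lt_abs.1 (Set.mem_ofPred.1 hz) with h | h
          · refine le_trans ?_ le_self_add
            rw [← ENNReal.ofReal_one]
            refine ENNReal.ofReal_le_ofReal (Real.one_le_exp ?_)
            have : t + μ < z / s := by linarith
            rw [lt_div_iff₀ hs'] at this
            nlinarith
          · refine le_trans ?_ le_add_self
            rw [← ENNReal.ofReal_one]
            refine ENNReal.ofReal_le_ofReal (Real.one_le_exp ?_)
            have : z / s < μ - t := by linarith
            rw [div_lt_iff₀ hs'] at this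
            nlinarith
        · rw [Set.indicator_of_notMem hz]
          exact zero_le
    _ = _ := by
        exact PMF.mean_add _ _ _
    _ ≤ _ := by
        rw [PMF.mean_mul_right, PMF.mean_mul_right, two_mul,
          ENNReal.ofReal_add (Real.exp_pos _).le (Real.exp_pos _).le]
        exact add_le_add (key l (abs_of_nonneg hl0)) (key (-l) (by rw [abs_neg, abs_of_nonneg hl0]))

/-! ## Costs -/

variable {β : Type*}

lemma CostLE.mono {p : Timed α} {k l : ℝ} (h : p.CostLE k) (hkl : k ≤ l) : p.CostLE l :=
  fun x hx => (h x hx).trans hkl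

lemma costLE_charge (k : ℕ) (a : α) : (charge k a).CostLE k := by
  intro x hx
  have hx : x ∈ (PMF.pure (a, k)).support := hx
  rw [PMF.support_pure, Set.mem_singleton_iff] at hx
  simp [hx]

lemma costLE_ret (a : α) : (ret a).CostLE 0 :=
  (costLE_charge 0 a).mono (by simp)

lemma CostLE.bind {p : Timed α} {f : α → Timed β} {k l : ℝ} (hp : p.CostLE k)
    (hf : ∀ a, (f a).CostLE l) : (p.bind f).CostLE (k + l) := by
  intro x hx
  obtain ⟨y, hy, hx⟩ := (PMF.mem_support_bind_iff _ _ _).1 hx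
  obtain ⟨z, hz, rfl⟩ := (PMF.mem_support_map_iff _ _ _).1 hx
  push_cast
  exact add_le_add (hp y hy) (hf _ z hz)

lemma costLE_choose [Nonempty α] (s : Finset α) : (choose s).CostLE 1 := by
  by_cases h : s.Nonempty
  · rw [choose_of_nonempty h]
    intro x hx
    obtain ⟨z, hz, rfl⟩ := (PMF.mem_support_map_iff _ _ _).1 hx
    simp
  · rw [choose_of_not_nonempty h]
    exact (costLE_charge 1 _).mono (by simp)

lemma costLE_coin (p : ℝ) : (coin p).CostLE 1 := by
  intro x hx
  obtain ⟨z, hz, rfl⟩ := (PMF.mem_support_map_iff _ _ _).1 hx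
  simp

lemma costLE_iterate {step : α → Timed α} {l : ℝ} (h : ∀ a, (step a).CostLE l) (t : ℕ) (a : α) :
    (iterate step t a).CostLE (t * l) := by
  induction t generalizing a with
  | zero => exact (costLE_ret a).mono (by simp)
  | succ t ih =>
    refine (CostLE.bind (h a) ih).mono (le_of_eq ?_)
    push_cast
    ring

lemma costLE_meanRuns {X : Timed ℝ} {l : ℝ} (h : X.CostLE l) (s : ℕ) :
    (meanRuns X s).CostLE (s * (l + 1) + 1) := by
  have hs : (sumRuns X s).CostLE (s * (l + 1)) := by
    induction s with
    | zero => exact (costLE_ret (0 : ℝ)).mono (by simp)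
    | succ s ih =>
      refine (ih.bind fun S => h.bind fun x => costLE_charge 1 _).mono (le_of_eq ?_)
      push_cast
      ring
  refine (hs.bind fun S => costLE_charge 1 _).mono (le_of_eq ?_)
  push_cast
  ring

end Timed

/-! ## Odd-degree vertices and sums over edge sets with prescribed parities -/

section Parity

variable {V : Type*} [Fintype V] [DecidableEq V]

/-- The vertices of odd degree in the subgraph with edge set `F`. -/
def oddVerts (F : Finset (Sym2 V)) : Finset V := univ.filter fun v => Odd (degIn F v)

lemma mem_oddVerts {F : Finset (Sym2 V)} {v : V} : v ∈ oddVerts F ↔ Odd (degIn F v) := by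
  simp [oddVerts]

lemma oddVerts_empty : oddVerts (∅ : Finset (Sym2 V)) = ∅ := by
  ext v
  simp [mem_oddVerts, degIn]

lemma symmDiff_eq_union_sdiff {α : Type*} [DecidableEq α] (A B : Finset α) :
    A ∆ B = (A \ B) ∪ (B \ A) := rfl

lemma odd_card_symmDiff {α : Type*} [DecidableEq α] (A B : Finset α) :
    Odd (A ∆ B).card ↔ ¬(Odd A.card ↔ Odd B.card) := by
  have h1 : (A ∆ B).card = (A \ B).card + (B \ A).card := by
    rw [symmDiff_eq_union_sdiff, card_union_of_disjoint disjoint_sdiff_sdiff]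
  have h2 := card_sdiff_add_card_inter A B
  have h3 := card_sdiff_add_card_inter B A
  rw [inter_comm] at h3
  rw [h1, ← h2, ← h3]
  simp only [Nat.odd_iff]
  omega

/-- With edge sets and vertex sets as vector spaces over `ℤ/2`, `oddVerts` is the boundary map and
hence additive. Every parity argument below rests on this. -/
lemma oddVerts_symmDiff (F H : Finset (Sym2 V)) :
    oddVerts (F ∆ H) = oddVerts F ∆ oddVerts H := by
  ext v
  have : (F ∆ H).filter (fun e => v ∈ e) =
      F.filter (fun e => v ∈ e) ∆ H.filter (fun e => v ∈ e) := by
    ext e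
    simp only [mem_filter, mem_symmDiff]
    tauto
  simp only [mem_oddVerts, mem_symmDiff, degIn, this, odd_card_symmDiff]
  tauto

lemma oddVerts_singleton (u v : V) : oddVerts {s(u, v)} = {u, v} := by
  ext w
  have : Odd (degIn {s(u, v)} w) ↔ w ∈ s(u, v) := by
    unfold degIn
    rw [filter_singleton]
    split_ifs <;> simp [*]
  simp [mem_oddVerts, this]

lemma symmDiff_singleton_eq_erase {α : Type*} [DecidableEq α] {F : Finset α} {e : α} (h : e ∈ F) :
    F ∆ {e} = F.erase e := by
  ext a
  simp only [mem_symmDiff, mem_singleton, mem_erase]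
  grind

lemma symmDiff_singleton_eq_insert {α : Type*} [DecidableEq α] {F : Finset α} {e : α}
    (h : e ∉ F) : F ∆ {e} = insert e F := by
  ext a
  simp only [mem_symmDiff, mem_singleton, mem_insert]
  grind

lemma symmDiff_subset {α : Type*} [DecidableEq α] {A B C : Finset α} (hA : A ⊆ C) (hB : B ⊆ C) :
    A ∆ B ⊆ C := by
  intro a ha
  rcases mem_symmDiff.1 ha with h | h
  exacts [hA h.1, hB h.1]

/-- The product of the weights `x e` of the edges of `F`. -/
def edgeProd (x : Sym2 V → ℝ) (F : Finset (Sym2 V)) : ℝ := ∏ e ∈ F, x e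

variable (G : SimpleGraph V) [DecidableRel G.Adj]

/-- The subgraphs whose set of odd-degree vertices is `S`. -/
def withOdd (S : Finset V) : Finset (Finset (Sym2 V)) :=
  G.edgeFinset.powerset.filter fun F => oddVerts F = S

/-- The total weight of the subgraphs whose set of odd-degree vertices is `S`. -/
def oddSum (x : Sym2 V → ℝ) (S : Finset V) : ℝ := ∑ F ∈ withOdd G S, edgeProd x F

variable {G}

lemma mem_withOdd {S : Finset V} {F : Finset (Sym2 V)} :
    F ∈ withOdd G S ↔ F ⊆ G.edgeFinset ∧ oddVerts F = S := by
  simp [withOdd]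

/-- The spin `±1` of a Boolean. -/
def spin (b : Bool) : ℝ := if b then -1 else 1

lemma spin_mul_self (b : Bool) : spin b * spin b = 1 := by cases b <;> simp [spin]

/-- The product of the two spins at the ends of an edge. -/
def edgeSpin (σ : V → Bool) : Sym2 V → ℝ :=
  Sym2.lift ⟨fun u v => spin (σ u) * spin (σ v), fun _ _ => mul_comm _ _⟩

lemma edgeSpin_mk (σ : V → Bool) (u v : V) : edgeSpin σ s(u, v) = spin (σ u) * spin (σ v) := rfl

/-- Orthogonality of the characters of `{±1}^V`: a vertex of `S` contributes the factor `1 - 1`. -/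
lemma sum_prod_spin (S : Finset V) :
    ∑ σ : V → Bool, ∏ v ∈ S, spin (σ v) = if S = ∅ then 2 ^ Fintype.card V else 0 := by
  have h : ∀ σ : V → Bool, ∏ v ∈ S, spin (σ v) = ∏ v, if v ∈ S then spin (σ v) else 1 := by
    intro σ
    rw [prod_ite_mem, univ_inter]
  simp only [h]
  rw [← Fintype.prod_sum (fun v b => if v ∈ S then spin b else 1)]
  split_ifs with hS
  · simp [hS]
  · obtain ⟨v, hv⟩ := nonempty_iff_ne_empty.2 hS
    refine prod_eq_zero (mem_univ v) ?_
    simp [hv, spin]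

lemma prod_spin_symmDiff (σ : V → Bool) (S T : Finset V) :
    ∏ v ∈ S ∆ T, spin (σ v) = (∏ v ∈ S, spin (σ v)) * ∏ v ∈ T, spin (σ v) := by
  rw [symmDiff_eq_union_sdiff, prod_union disjoint_sdiff_sdiff, ← prod_inter_mul_prod_sdiff S T,
    ← prod_inter_mul_prod_sdiff T S, inter_comm T S]
  have : (∏ v ∈ S ∩ T, spin (σ v)) * ∏ v ∈ S ∩ T, spin (σ v) = 1 := by
    rw [← prod_mul_distrib]
    exact prod_eq_one fun v _ => spin_mul_self _
  linear_combination -(∏ v ∈ S \ T, spin (σ v)) * (∏ v ∈ T \ S, spin (σ v)) * this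

/-- The spin of `v` occurs once for every edge of `F` at `v`, and even powers of a spin are `1`. -/
lemma prod_edgeSpin (σ : V → Bool) {F : Finset (Sym2 V)} (hF : F ⊆ G.edgeFinset) :
    ∏ e ∈ F, edgeSpin σ e = ∏ v ∈ oddVerts F, spin (σ v) := by
  induction F using Finset.induction_on with
  | empty => simp [oddVerts_empty]
  | insert e F he ih =>
    rw [prod_insert he, ih ((subset_insert _ _).trans hF), ← symmDiff_singleton_eq_insert he,
      oddVerts_symmDiff, prod_spin_symmDiff, mul_comm]
    congr 1
    have hE := hF (mem_insert_self e F)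
    induction e using Sym2.ind with
    | _ u v =>
      have huv : u ≠ v := (by simpa using hE : G.Adj u v).ne
      rw [oddVerts_singleton, prod_pair huv, edgeSpin_mk]

/-- The high-temperature expansion. -/
lemma two_pow_mul_oddSum (x : Sym2 V → ℝ) (S : Finset V) :
    2 ^ Fintype.card V * oddSum G x S =
      ∑ σ : V → Bool, (∏ v ∈ S, spin (σ v)) * ∏ e ∈ G.edgeFinset, (1 + x e * edgeSpin σ e) := by
  simp only [prod_one_add, mul_sum]
  rw [sum_comm]
  simp only [oddSum, withOdd, sum_filter, mul_sum]
  refine sum_congr rfl fun F hF => ?_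
  rw [mem_powerset] at hF
  -- The summand is a multiple of the character indexed by `S ∆ oddVerts F`, so summing over `σ`
  -- keeps only the `F` with `oddVerts F = S`.
  have : ∀ σ : V → Bool, (∏ v ∈ S, spin (σ v)) * ∏ e ∈ F, x e * edgeSpin σ e =
      edgeProd x F * ∏ v ∈ S ∆ oddVerts F, spin (σ v) := by
    intro σ
    rw [prod_mul_distrib, prod_edgeSpin σ hF, prod_spin_symmDiff, edgeProd]
    ring
  simp only [this, ← mul_sum, sum_prod_spin, ← Finset.bot_eq_empty, symmDiff_eq_bot]
  by_cases h : oddVerts F = S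
  · simp [h, mul_comm]
  · simp [h, Ne.symm h]

/-- In the high-temperature expansion the weights `1 + x e * edgeSpin σ e` are nonnegative because
`x e ≤ 1`, and inserting a product of spins can only lower the sum: a correlation of the Ising model
is at most one. This controls the congestion of the canonical paths. -/
lemma oddSum_le (x : Sym2 V → ℝ) (hx : ∀ e ∈ G.edgeFinset, 0 ≤ x e ∧ x e ≤ 1) (S : Finset V) :
    oddSum G x S ≤ oddSum G x ∅ := by
  have h : (0 : ℝ) < 2 ^ Fintype.card V := by positivity
  refine le_of_mul_le_mul_left ?_ h
  rw [two_pow_mul_oddSum, two_pow_mul_oddSum]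
  refine sum_le_sum fun σ _ => ?_
  have h1 : 0 ≤ ∏ e ∈ G.edgeFinset, (1 + x e * edgeSpin σ e) := by
    refine prod_nonneg fun e he => ?_
    obtain ⟨h0, h1⟩ := hx e he
    have : edgeSpin σ e = 1 ∨ edgeSpin σ e = -1 := by
      induction e using Sym2.ind with
      | _ u v => rw [edgeSpin_mk]; cases σ u <;> cases σ v <;> simp [spin]
    rcases this with h | h <;> rw [h] <;> linarith
  refine mul_le_mul_of_nonneg_right ?_ h1
  rw [prod_empty]
  have : |∏ v ∈ S, spin (σ v)| = 1 := by
    rw [abs_prod]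
    exact prod_eq_one fun v _ => by cases σ v <;> simp [spin]
  exact (le_abs_self _).trans this.le

/-- The cycle space of a connected graph has dimension `m - n + 1`. -/
lemma card_withOdd_empty (hG : G.Connected) :
    ((withOdd G ∅).card : ℝ) =
      2 ^ ((G.edgeFinset.card : ℤ) - Fintype.card V + 1) := by
  have h := two_pow_mul_oddSum (G := G) (fun _ => 1) ∅
  have h1 : oddSum G (fun _ => 1) ∅ = (withOdd G ∅).card := by
    simp [oddSum, edgeProd]
  -- At `x = 1` any edge with unequal spins contributes the factor `0`. By connectedness only the
  -- two constant configurations survive, each with the value `2^m`.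
  have h2 : ∀ σ : V → Bool, (∏ v ∈ (∅ : Finset V), spin (σ v)) *
      ∏ e ∈ G.edgeFinset, (1 + 1 * edgeSpin σ e) =
      ∑ b : Bool, if σ = fun _ => b then 2 ^ G.edgeFinset.card else (0 : ℝ) := by
    intro σ
    rw [prod_empty, one_mul]
    obtain ⟨v₀⟩ := hG.nonempty
    by_cases hσ : ∃ b, σ = fun _ => b
    · obtain ⟨b, rfl⟩ := hσ
      have : ∀ e, edgeSpin (fun _ : V => b) e = 1 := by
        intro e
        induction e using Sym2.ind with
        | _ u v => rw [edgeSpin_mk, spin_mul_self]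
      have hb : ∀ b', ((fun _ : V => b) = fun _ => b') ↔ b' = b := fun b' =>
        ⟨fun h => (congrFun h v₀).symm, fun h => by rw [h]⟩
      simp only [this, hb]
      rw [sum_ite_eq' univ b, if_pos (mem_univ b)]
      norm_num
    · push Not at hσ
      rw [sum_eq_zero fun b _ => if_neg (hσ b)]
      by_contra hne
      rw [← ne_eq, prod_ne_zero_iff] at hne
      have hadj : ∀ u v, G.Adj u v → σ u = σ v := by
        intro u v huv
        have := hne s(u, v) (by simpa using huv)
        rw [edgeSpin_mk] at this
        revert this
        cases σ u <;> cases σ v <;> simp [spin]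
      have hw : ∀ u v, G.Walk u v → σ u = σ v := by
        intro u v p
        induction p with
        | nil => rfl
        | cons h p ih => exact (hadj _ _ h).trans ih
      refine hσ (σ v₀) (funext fun v => ?_)
      exact hw v v₀ (hG.preconnected v v₀).some
  rw [h1] at h
  simp only [h2] at h
  rw [sum_comm] at h
  simp only [sum_ite_eq', mem_univ, if_true, sum_const, card_univ, Fintype.card_bool,
    nsmul_eq_mul] at h
  rw [zpow_add₀ two_ne_zero, zpow_sub₀ two_ne_zero, zpow_natCast, zpow_natCast, zpow_one,
    eq_comm, div_mul_eq_mul_div, div_eq_iff (by positivity), mul_comm _ ((2 : ℝ) ^ Fintype.card V), h]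
  push_cast
  ring

end Parity

/-! ## Lazy reversible chains with involutive moves -/

/-- A lazy Markov chain that picks a move `i` with probability `rate F i` and applies the involution
`flip i`, reversible with respect to the (unnormalized) weight `wt`; `step` is its transition
operator on functions. -/
structure FlipChain (S ι : Type*) [Fintype S] where
  moves : Finset ι
  flip : ι → S → S
  flip_flip : ∀ i ∈ moves, ∀ F, flip i (flip i F) = F
  rate : S → ι → ℝ
  wt : S → ℝ
  wt_nonneg : ∀ F, 0 ≤ wt F
  rate_nonneg : ∀ F, wt F ≠ 0 → ∀ i ∈ moves, 0 ≤ rate F i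
  rate_sum : ∀ F, wt F ≠ 0 → ∑ i ∈ moves, rate F i ≤ 1 / 2
  balance : ∀ F, ∀ i ∈ moves, wt F * rate F i = wt (flip i F) * rate (flip i F) i
  step : (S → ℝ) → S → ℝ
  step_eq : ∀ g F, wt F ≠ 0 →
    step g F = g F + ∑ i ∈ moves, rate F i * (g (flip i F) - g F)
  step_sub_const : ∀ g c, step (fun F => g F - c) = fun F => step g F - c

namespace FlipChain

variable {S ι : Type*} [Fintype S] (C : FlipChain S ι)

/-- The Dirichlet form. -/
def dirichlet (g : S → ℝ) : ℝ :=
  (∑ F, ∑ i ∈ C.moves, C.wt F * C.rate F i * (g (C.flip i F) - g F) ^ 2) / 2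

/-- For each move the flows over `F` and `flip i F` agree, and the substitution `F ↦ flip i F` makes
the differences cancel. -/
lemma sum_balance (g : S → ℝ) :
    ∑ F, ∑ i ∈ C.moves, C.wt F * C.rate F i * (g (C.flip i F) - g F) = 0 := by
  rw [sum_comm]
  refine sum_eq_zero fun i hi => ?_
  have hinv : Function.Involutive (C.flip i) := C.flip_flip i hi
  simp only [mul_sub, sum_sub_distrib, sub_eq_zero]
  rw [← Equiv.sum_comp hinv.toPerm]
  refine sum_congr rfl fun F _ => ?_
  simp only [Function.Involutive.coe_toPerm]
  rw [hinv F, ← C.balance F i hi]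

lemma sum_wt_step (g : S → ℝ) : ∑ F, C.wt F * C.step g F = ∑ F, C.wt F * g F := by
  rw [← sub_eq_zero, ← sum_sub_distrib, ← C.sum_balance g]
  refine sum_congr rfl fun F _ => ?_
  by_cases hF : C.wt F = 0
  · simp [hF]
  · rw [C.step_eq g F hF, mul_add, add_sub_cancel_left, mul_sum]
    exact sum_congr rfl fun i _ => by ring

/-- Write the step as `g + A` and let `D` be the local energy. Then `(g + A)² = g² + (D + 2gA) - D +
A²`; the bracket has total zero by `sum_balance` applied to `g²`, and laziness (total rate at most
`1/2`) gives `A² ≤ D/2` by Cauchy–Schwarz. No spectral theory is needed. -/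
lemma sum_wt_step_sq_le (g : S → ℝ) :
    ∑ F, C.wt F * C.step g F ^ 2 ≤ ∑ F, C.wt F * g F ^ 2 - C.dirichlet g := by
  have h := C.sum_balance (fun F => g F ^ 2)
  have key : ∀ F, C.wt F * C.step g F ^ 2 ≤ C.wt F * g F ^ 2 +
      ∑ i ∈ C.moves, C.wt F * C.rate F i * (g (C.flip i F) ^ 2 - g F ^ 2) -
      (∑ i ∈ C.moves, C.wt F * C.rate F i * (g (C.flip i F) - g F) ^ 2) / 2 := by
    intro F
    by_cases hF : C.wt F = 0
    · simp [hF]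
    have hr := C.rate_nonneg F hF
    have hs := C.rate_sum F hF
    simp only [mul_assoc, ← mul_sum]
    rw [C.step_eq g F hF, mul_div_assoc, ← mul_add, ← mul_sub]
    refine mul_le_mul_of_nonneg_left ?_ (C.wt_nonneg F)
    set A := ∑ i ∈ C.moves, C.rate F i * (g (C.flip i F) - g F) with hA
    set D := ∑ i ∈ C.moves, C.rate F i * (g (C.flip i F) - g F) ^ 2 with hD
    have h1 : ∑ i ∈ C.moves, C.rate F i * (g (C.flip i F) ^ 2 - g F ^ 2) = D + 2 * g F * A := by
      rw [hA, hD, mul_sum, ← sum_add_distrib]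
      exact sum_congr rfl fun i _ => by ring
    have hD0 : 0 ≤ D := sum_nonneg fun i hi => mul_nonneg (hr i hi) (sq_nonneg _)
    have h2 : A ^ 2 ≤ D / 2 := by
      calc A ^ 2 ≤ (∑ i ∈ C.moves, C.rate F i) * D := by
            refine sum_sq_le_sum_mul_sum_of_sq_le_mul _ (fun i hi => hr i hi)
              (fun i hi => mul_nonneg (hr i hi) (sq_nonneg _)) fun i _ => le_of_eq (by ring)
        _ ≤ 1 / 2 * D := by gcongr
        _ = D / 2 := by ring
    rw [h1]
    linarith [h2]
  refine (sum_le_sum fun F _ => key F).trans (le_of_eq ?_)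
  rw [sum_sub_distrib, sum_add_distrib, h, dirichlet, add_zero, sum_div]

/-- A Poincaré inequality implies geometric convergence to equilibrium. -/
lemma sq_iterate_sub_le {γ : ℝ} (hγ : γ ≤ 1)
    (hP : ∀ f, ∑ F, C.wt F * f F = 0 → γ * ∑ F, C.wt F * f F ^ 2 ≤ C.dirichlet f)
    (g : S → ℝ) (T : ℕ) (F₀ : S) (hZ : 0 < ∑ F, C.wt F) :
    C.wt F₀ * (C.step^[T] g F₀ - (∑ F, C.wt F * g F) / ∑ F, C.wt F) ^ 2 ≤
      (1 - γ) ^ T * ∑ F, C.wt F * g F ^ 2 := by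
  have iter : ∀ (f : S → ℝ), ∑ F, C.wt F * f F = 0 → ∀ T, ∑ F, C.wt F * C.step^[T] f F = 0 ∧
      ∑ F, C.wt F * C.step^[T] f F ^ 2 ≤ (1 - γ) ^ T * ∑ F, C.wt F * f F ^ 2 := by
    intro f hf T
    induction T with
    | zero => simp [hf]
    | succ T ih =>
      simp only [Function.iterate_succ_apply']
      refine ⟨by rw [C.sum_wt_step, ih.1], ?_⟩
      calc _ ≤ _ := C.sum_wt_step_sq_le _
        _ ≤ (1 - γ) * ∑ F, C.wt F * C.step^[T] f F ^ 2 := by linarith [hP _ ih.1]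
        _ ≤ (1 - γ) * ((1 - γ) ^ T * ∑ F, C.wt F * f F ^ 2) :=
          mul_le_mul_of_nonneg_left ih.2 (by linarith)
        _ = _ := by ring
  set c := (∑ F, C.wt F * g F) / ∑ F, C.wt F with hc
  have hc' : c * ∑ F, C.wt F = ∑ F, C.wt F * g F := div_mul_cancel₀ _ hZ.ne'
  have hshift : ∀ T, C.step^[T] (fun F => g F - c) = fun F => C.step^[T] g F - c := by
    intro T
    induction T with
    | zero => rfl
    | succ T ih => rw [Function.iterate_succ_apply', ih, C.step_sub_const,
        Function.iterate_succ_apply']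
  have h0 : ∑ F, C.wt F * (g F - c) = 0 := by
    simp only [mul_sub, sum_sub_distrib, ← sum_mul]
    linarith
  have h1 := (iter _ h0 T).2
  rw [hshift] at h1
  -- The pointwise error at the starting state is one nonnegative term of the weighted `L²` norm.
  calc _ ≤ ∑ F, C.wt F * (C.step^[T] g F - c) ^ 2 :=
        single_le_sum (f := fun F => C.wt F * (C.step^[T] g F - c) ^ 2)
          (fun F _ => mul_nonneg (C.wt_nonneg F) (sq_nonneg _)) (mem_univ F₀)
    _ ≤ _ := h1
    _ ≤ _ := by
      refine mul_le_mul_of_nonneg_left ?_ (pow_nonneg (by linarith) T)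
      have : ∑ F, C.wt F * (g F - c) ^ 2 = ∑ F, C.wt F * g F ^ 2 - c ^ 2 * ∑ F, C.wt F := by
        have : ∀ F, C.wt F * (g F - c) ^ 2 =
            C.wt F * g F ^ 2 - 2 * c * (C.wt F * g F) + c ^ 2 * C.wt F := fun F => by ring
        simp only [this, sum_add_distrib, sum_sub_distrib, ← mul_sum]
        rw [← hc']
        ring
      rw [this]
      have := mul_nonneg (sq_nonneg c) hZ.le
      linarith

end FlipChain

/-! ## A Poincaré inequality for worms by canonical paths -/

section Worms

variable {V : Type*} [Fintype V] [DecidableEq V] (G : SimpleGraph V) [DecidableRel G.Adj]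

/-- The subgraphs with no or two vertices of odd degree. -/
def worms : Finset (Finset (Sym2 V)) :=
  G.edgeFinset.powerset.filter fun F => (oddVerts F).card = 0 ∨ (oddVerts F).card = 2

variable {G}

lemma mem_worms {F : Finset (Sym2 V)} : F ∈ worms G ↔
    F ⊆ G.edgeFinset ∧ ((oddVerts F).card = 0 ∨ (oddVerts F).card = 2) := by
  simp [worms]

lemma empty_mem_worms : ∅ ∈ worms G := by simp [mem_worms, oddVerts_empty]

lemma ne_of_mem_edgeFinset {u v : V} (h : s(u, v) ∈ G.edgeFinset) : u ≠ v :=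
  (by simpa using h : G.Adj u v).ne

/-- In an even subgraph any edge may be removed, opening two odd vertices. In an open worm an edge
at an odd vertex is removed: it moves that end along the edge, or closes the worm when it joins both
ends. -/
lemma exists_erase_mem_worms {H : Finset (Sym2 V)} (hH : H ∈ worms G) (hne : H.Nonempty) :
    ∃ e ∈ H, H ∆ {e} ∈ worms G := by
  rw [mem_worms] at hH
  obtain ⟨hE, h0 | h2⟩ := hH
  · obtain ⟨e, he⟩ := hne
    refine ⟨e, he, mem_worms.2 ⟨symmDiff_subset hE (by simpa using hE he), Or.inr ?_⟩⟩
    induction e using Sym2.ind with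
    | _ u v =>
      rw [oddVerts_symmDiff, oddVerts_singleton, card_eq_zero.1 h0]
      have : (∅ : Finset V) ∆ {u, v} = {u, v} := bot_symmDiff _
      rw [this, card_pair (ne_of_mem_edgeFinset (hE he))]
  · obtain ⟨a, b, hab, hodd⟩ := card_eq_two.1 h2
    have ha : Odd (degIn H a) := mem_oddVerts.1 (by simp [hodd])
    obtain ⟨e, he⟩ := card_pos.1 ha.pos
    obtain ⟨heH, hae⟩ := mem_filter.1 he
    obtain ⟨u, rfl⟩ := Sym2.mem_iff_exists.1 hae
    have hau := ne_of_mem_edgeFinset (hE heH)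
    refine ⟨_, heH, mem_worms.2 ⟨symmDiff_subset hE (by simpa using hE heH), ?_⟩⟩
    rw [oddVerts_symmDiff, oddVerts_singleton, hodd]
    by_cases hub : u = b
    · left
      rw [hub]
      exact card_eq_zero.2 (symmDiff_self _)
    · right
      have : ({a, b} : Finset V) ∆ {a, u} = {b, u} := by
        ext x
        simp only [mem_symmDiff, mem_insert, mem_singleton]
        grind
      rw [this, card_pair (Ne.symm hub)]

/-- A canonical order of removing the edges of a worm `H`: at the time of removing `e`, the edges
in `K e` have been removed already. -/
lemma exists_path (H : Finset (Sym2 V)) (hH : H ∈ worms G) :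
    ∃ K : Sym2 V → Finset (Sym2 V), (∀ e ∈ H, K e ⊆ H ∧ H ∆ K e ∈ worms G ∧
      H ∆ K e ∆ {e} ∈ worms G) ∧
      ∀ (f : Finset (Sym2 V) → ℝ) (I : Finset (Sym2 V)),
        f I - f (I ∆ H) = ∑ e ∈ H, (f (I ∆ K e) - f (I ∆ K e ∆ {e})) := by
  induction hn : H.card generalizing H with
  | zero =>
    rw [card_eq_zero] at hn
    subst hn
    refine ⟨fun _ => ∅, by simp, fun f I => ?_⟩
    have : I ∆ (∅ : Finset (Sym2 V)) = I := symmDiff_bot I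
    simp [this]
  | succ k ih =>
    obtain ⟨e₀, he₀, hw⟩ := exists_erase_mem_worms hH (card_pos.1 (by omega))
    have her := symmDiff_singleton_eq_erase he₀
    have hbot : ∀ I : Finset (Sym2 V), I ∆ (∅ : Finset (Sym2 V)) = I := fun I => symmDiff_bot I
    obtain ⟨K, hK1, hK2⟩ := ih (H ∆ {e₀}) hw (by rw [her, card_erase_of_mem he₀, hn]; rfl)
    -- The edge `e₀` is removed first, so it belongs to the removed set at every later edge.
    refine ⟨fun e => if e = e₀ then ∅ else {e₀} ∆ K e, fun e he => ?_, fun f I => ?_⟩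
    · by_cases h : e = e₀
      · subst h
        simp only [if_true, hbot]
        exact ⟨empty_subset _, hH, hw⟩
      · simp only [if_neg h]
        obtain ⟨h1, h2, h3⟩ := hK1 e (by rw [her]; exact mem_erase.2 ⟨h, he⟩)
        rw [← symmDiff_assoc H]
        refine ⟨symmDiff_subset (by simpa using he₀) (h1.trans ?_), h2, h3⟩
        rw [her]
        exact erase_subset _ _
    · rw [← add_sum_erase H _ he₀, ← her]
      beta_reduce
      rw [if_pos rfl, hbot]
      have : ∀ e ∈ H ∆ {e₀}, (f (I ∆ (if e = e₀ then ∅ else {e₀} ∆ K e)) -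
          f (I ∆ (if e = e₀ then ∅ else {e₀} ∆ K e) ∆ {e})) =
          f ((I ∆ {e₀}) ∆ K e) - f ((I ∆ {e₀}) ∆ K e ∆ {e}) := by
        intro e he
        rw [her, mem_erase] at he
        rw [if_neg he.1, ← symmDiff_assoc I]
      rw [sum_congr rfl this, ← hK2 f (I ∆ {e₀})]
      have : I ∆ {e₀} ∆ (H ∆ {e₀}) = I ∆ H := by
        rw [symmDiff_comm H, symmDiff_assoc, ← symmDiff_assoc {e₀} {e₀} H, symmDiff_self,
          bot_symmDiff]
      rw [this]
      ring

/-- An edge of `H` lies in exactly one of `I` and `I ∆ H`, and toggling `K ⊆ H` merely exchanges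
which one; edges outside `H` are unaffected. This is the complementary encoding of canonical paths.
-/
lemma edgeProd_mul_symmDiff (x : Sym2 V → ℝ) (I H K : Finset (Sym2 V)) (hK : K ⊆ H) :
    edgeProd x I * edgeProd x (I ∆ H) = edgeProd x (I ∆ K) * edgeProd x (I ∆ K ∆ H) := by
  unfold edgeProd
  have h : ∀ F : Finset (Sym2 V), ∏ e ∈ F, x e = ∏ e, if e ∈ F then x e else 1 := by
    intro F
    rw [prod_ite_mem, univ_inter]
  simp only [h, ← prod_mul_distrib]
  refine prod_congr rfl fun e _ => ?_
  have := @hK e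
  simp only [mem_symmDiff]
  by_cases h1 : e ∈ I <;> by_cases h2 : e ∈ H <;> by_cases h3 : e ∈ K <;> simp_all

variable (x : Sym2 V → ℝ)

/-- Weights are at most one, so the lighter of the two sets is the one containing `e`. -/
lemma edgeProd_min (hx : ∀ e ∈ G.edgeFinset, 0 < x e ∧ x e ≤ 1) {A : Finset (Sym2 V)}
    (hA : A ⊆ G.edgeFinset) {e : Sym2 V} (he : e ∈ G.edgeFinset) :
    edgeProd x (insert e A) = min (edgeProd x A) (edgeProd x (A ∆ {e})) := by
  have key : ∀ B : Finset (Sym2 V), B ⊆ G.edgeFinset → e ∉ B →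
      edgeProd x (insert e B) ≤ edgeProd x B := by
    intro B hB heB
    unfold edgeProd
    rw [prod_insert heB]
    exact mul_le_of_le_one_left (prod_nonneg fun a ha => (hx a (hB ha)).1.le) (hx e he).2
  by_cases h : e ∈ A
  · rw [insert_eq_of_mem h, symmDiff_singleton_eq_erase h, min_eq_left]
    have := key (A.erase e) ((erase_subset _ _).trans hA) (notMem_erase _ _)
    rwa [insert_erase h] at this
  · rw [symmDiff_singleton_eq_insert h, min_eq_right (key A hA h)]

/-- The number of vertices at which the worm chain may move from `F`. -/
def ends (F : Finset (Sym2 V)) : ℝ := if oddVerts F = ∅ then Fintype.card V else 2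

/-- Translation by `B` is an involution carrying the parity class of `S` onto that of `oddVerts B ∆
S`. -/
lemma sum_withOdd_symmDiff {B : Finset (Sym2 V)} (hB : B ⊆ G.edgeFinset) (S : Finset V)
    (φ : Finset (Sym2 V) → ℝ) :
    ∑ H ∈ withOdd G S, φ (B ∆ H) = ∑ F ∈ withOdd G (oddVerts B ∆ S), φ F := by
  refine sum_nbij' (fun H => B ∆ H) (fun F => B ∆ F) ?_ ?_ ?_ ?_ ?_
  · intro H hH
    rw [mem_withOdd] at hH ⊢
    exact ⟨symmDiff_subset hB hH.1, by rw [oddVerts_symmDiff, hH.2]⟩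
  · intro H hH
    rw [mem_withOdd] at hH ⊢
    exact ⟨symmDiff_subset hB hH.1, by rw [oddVerts_symmDiff, hH.2, symmDiff_symmDiff_cancel_left]⟩
  · exact fun H _ => symmDiff_symmDiff_cancel_left B H
  · exact fun H _ => symmDiff_symmDiff_cancel_left B H
  · exact fun H _ => rfl

lemma sum_worms (φ : Finset (Sym2 V) → ℝ) :
    ∑ H ∈ worms G, φ H = ∑ H ∈ withOdd G ∅, φ H +
      ∑ S ∈ (univ : Finset V).powersetCard 2, ∑ H ∈ withOdd G S, φ H := by
  have h1 : worms G = withOdd G ∅ ∪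
      G.edgeFinset.powerset.filter fun F => (oddVerts F).card = 2 := by
    ext F
    simp only [mem_worms, mem_withOdd, mem_union, mem_filter, mem_powerset, card_eq_zero]
    tauto
  rw [h1, sum_union]
  · congr 1
    have hmaps : ∀ F ∈ G.edgeFinset.powerset.filter (fun F => (oddVerts F).card = 2),
        oddVerts F ∈ (univ : Finset V).powersetCard 2 := by
      intro F hF
      rw [mem_powersetCard]
      exact ⟨subset_univ _, (mem_filter.1 hF).2⟩
    rw [← sum_fiberwise_of_maps_to hmaps]
    refine sum_congr rfl fun S hS => sum_congr ?_ fun _ _ => rfl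
    ext F
    rw [mem_powersetCard] at hS
    simp only [mem_filter, mem_powerset, mem_withOdd]
    constructor
    · tauto
    · rintro ⟨h1, rfl⟩
      exact ⟨⟨h1, hS.2⟩, rfl⟩
  · rw [disjoint_left]
    intro F hF hF'
    rw [mem_withOdd] at hF
    have := (mem_filter.1 hF').2
    simp [hF.2] at this

lemma ends_of_mem_withOdd {S : Finset V} {H : Finset (Sym2 V)} (h : H ∈ withOdd G S) :
    ends H = if S = ∅ then (Fintype.card V : ℝ) else 2 := by
  rw [ends, (mem_withOdd.1 h).2]

/-- Each translated parity class weighs at most `oddSum G x ∅`. The even class counts `n` times and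
each of the `n(n-1)/2` two-point classes twice, which adds up to exactly `n²`. -/
lemma sum_ends_le (hx : ∀ e ∈ G.edgeFinset, 0 < x e ∧ x e ≤ 1) {B : Finset (Sym2 V)}
    (hB : B ⊆ G.edgeFinset) :
    ∑ H ∈ worms G, ends H * edgeProd x (B ∆ H) ≤ (Fintype.card V : ℝ) ^ 2 * oddSum G x ∅ := by
  have hx' : ∀ e ∈ G.edgeFinset, 0 ≤ x e ∧ x e ≤ 1 := fun e he => ⟨(hx e he).1.le, (hx e he).2⟩
  have key : ∀ S, ∑ H ∈ withOdd G S, edgeProd x (B ∆ H) ≤ oddSum G x ∅ := by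
    intro S
    rw [sum_withOdd_symmDiff hB S (edgeProd x)]
    exact oddSum_le x hx' _
  rw [sum_worms]
  have h1 : ∑ H ∈ withOdd G ∅, ends H * edgeProd x (B ∆ H) ≤ Fintype.card V * oddSum G x ∅ := by
    rw [sum_congr rfl fun H hH => by rw [ends_of_mem_withOdd hH, if_pos rfl], ← mul_sum]
    exact mul_le_mul_of_nonneg_left (key ∅) (Nat.cast_nonneg _)
  have h2 : ∀ S ∈ (univ : Finset V).powersetCard 2,
      ∑ H ∈ withOdd G S, ends H * edgeProd x (B ∆ H) ≤ 2 * oddSum G x ∅ := by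
    intro S hS
    have hS' : S ≠ ∅ := by
      rintro rfl
      simp [mem_powersetCard] at hS
    rw [sum_congr rfl fun H hH => by rw [ends_of_mem_withOdd hH, if_neg hS'], ← mul_sum]
    exact mul_le_mul_of_nonneg_left (key S) (by norm_num)
  have h3 := sum_le_card_nsmul _ _ _ h2
  rw [card_powersetCard, card_univ, nsmul_eq_mul, Nat.cast_choose_two] at h3
  calc _ ≤ _ := add_le_add h1 h3
    _ = _ := by ring

lemma oddSum_empty_pos (hx : ∀ e ∈ G.edgeFinset, 0 < x e ∧ x e ≤ 1) : 0 < oddSum G x ∅ := by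
  refine sum_pos (fun F hF => prod_pos fun e he => (hx e ((mem_withOdd.1 hF).1 he)).1) ⟨∅, ?_⟩
  simp [mem_withOdd, oddVerts_empty]

/-- The substitution `H = I ∆ F`; since `F` is even, `H` is a worm with the same ends as `I`. -/
lemma sum_worms_evens (ψ : Finset (Sym2 V) → Finset (Sym2 V) → ℝ) :
    ∑ I ∈ worms G, ∑ F ∈ withOdd G ∅, ψ I F =
      ∑ H ∈ worms G, ∑ I ∈ withOdd G (oddVerts H), ψ I (I ∆ H) := by
  rw [← sum_comm' (s := worms G) (t := fun I => withOdd G (oddVerts I))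
    (f := fun I H => ψ I (I ∆ H))]
  · refine sum_congr rfl fun I hI => ?_
    rw [sum_withOdd_symmDiff (mem_worms.1 hI).1 (oddVerts I) (ψ I), symmDiff_self]
    rfl
  · intro I H
    simp only [mem_worms, mem_withOdd]
    constructor
    · rintro ⟨⟨h1, h2⟩, h3, h4⟩
      exact ⟨⟨h1, h4.symm⟩, h3, by rwa [h4]⟩
    · rintro ⟨⟨h1, h2⟩, h3, h4⟩
      exact ⟨⟨h1, by rwa [h2]⟩, h3, h2.symm⟩

/-- The energy of `f` along the transitions of the worm chain. -/
def wormEnergy (G : SimpleGraph V) [DecidableRel G.Adj] (x : Sym2 V → ℝ)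
    (f : Finset (Sym2 V) → ℝ) : ℝ :=
  ∑ e ∈ G.edgeFinset, ∑ A ∈ (worms G).filter (fun A => A ∆ {e} ∈ worms G),
    min (edgeProd x A) (edgeProd x (A ∆ {e})) * (f A - f (A ∆ {e})) ^ 2

/-- Cauchy–Schwarz along the canonical path of at most `m` edges, followed by the encoding identity.
For fixed `H` and `e` the starting point is recovered from the current state `A = I ∆ K e`, so no
transition is counted twice. -/
lemma worm_path_bound (hx : ∀ e ∈ G.edgeFinset, 0 < x e ∧ x e ≤ 1) (f : Finset (Sym2 V) → ℝ)
    {H : Finset (Sym2 V)} (hH : H ∈ worms G) :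
    ∑ I ∈ withOdd G (oddVerts H), edgeProd x I * edgeProd x (I ∆ H) * (f I - f (I ∆ H)) ^ 2 ≤
      G.edgeFinset.card * ∑ e ∈ G.edgeFinset,
        ∑ A ∈ (worms G).filter (fun A => A ∆ {e} ∈ worms G),
          min (edgeProd x A) (edgeProd x (A ∆ {e})) * (f A - f (A ∆ {e})) ^ 2 *
            edgeProd x (insert e A ∆ H) := by
  have pos : ∀ {F : Finset (Sym2 V)}, F ⊆ G.edgeFinset → 0 < edgeProd x F :=
    fun hF => prod_pos fun e he => (hx e (hF he)).1
  obtain ⟨K, hK1, hK2⟩ := exists_path H hH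
  have hHE := (mem_worms.1 hH).1
  have hstep : ∀ I ∈ withOdd G (oddVerts H),
      edgeProd x I * edgeProd x (I ∆ H) * (f I - f (I ∆ H)) ^ 2 ≤
      G.edgeFinset.card * ∑ e ∈ H, edgeProd x (I ∆ K e) * edgeProd x (I ∆ K e ∆ H) *
        (f (I ∆ K e) - f (I ∆ K e ∆ {e})) ^ 2 := by
    intro I hI
    have hIE := (mem_withOdd.1 hI).1
    have h0 : 0 ≤ edgeProd x I * edgeProd x (I ∆ H) :=
      (mul_pos (pos hIE) (pos (symmDiff_subset hIE hHE))).le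
    calc _ ≤ edgeProd x I * edgeProd x (I ∆ H) *
          (H.card * ∑ e ∈ H, (f (I ∆ K e) - f (I ∆ K e ∆ {e})) ^ 2) := by
          rw [hK2 f I]
          exact mul_le_mul_of_nonneg_left sq_sum_le_card_mul_sum_sq h0
      _ ≤ edgeProd x I * edgeProd x (I ∆ H) *
          (G.edgeFinset.card * ∑ e ∈ H, (f (I ∆ K e) - f (I ∆ K e ∆ {e})) ^ 2) := by
          have := card_le_card hHE
          gcongr
      _ = _ := by
          rw [mul_left_comm, mul_sum]
          congr 1
          refine sum_congr rfl fun e he => ?_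
          rw [edgeProd_mul_symmDiff x I H (K e) (hK1 e he).1]
  refine (sum_le_sum hstep).trans ?_
  rw [← mul_sum, sum_comm]
  refine mul_le_mul_of_nonneg_left ?_ (Nat.cast_nonneg _)
  have hterm : ∀ e ∈ G.edgeFinset, ∀ A ∈ (worms G).filter (fun A => A ∆ {e} ∈ worms G),
      0 ≤ min (edgeProd x A) (edgeProd x (A ∆ {e})) * (f A - f (A ∆ {e})) ^ 2 *
            edgeProd x (insert e A ∆ H) := by
    intro e he A hA
    rw [mem_filter, mem_worms] at hA
    refine mul_nonneg (mul_nonneg ?_ (sq_nonneg _)) ?_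
    · exact le_min (pos hA.1.1).le (pos (symmDiff_subset hA.1.1 (by simpa using he))).le
    · exact (pos (symmDiff_subset (insert_subset he hA.1.1) hHE)).le
  refine le_trans (sum_le_sum fun e he => ?_) (sum_le_sum_of_subset_of_nonneg hHE
    fun e he _ => sum_nonneg (hterm e he))
  obtain ⟨h1, h2, h3⟩ := hK1 e he
  have hKE := h1.trans hHE
  have heE := hHE he
  have := sum_withOdd_symmDiff (G := G) hKE (oddVerts H) fun A =>
    edgeProd x A * edgeProd x (A ∆ H) * (f A - f (A ∆ {e})) ^ 2
  simp only [symmDiff_comm (K e)] at this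
  rw [this]
  -- `I` has the odd vertices of `H`, so `A = I ∆ K e` has those of `H ∆ K e`: being a worm
  -- transfers from the path of `H` itself to its translates.
  have hset : withOdd G (oddVerts (K e) ∆ oddVerts H) ⊆
      (worms G).filter (fun A => A ∆ {e} ∈ worms G) := by
    intro A hA
    rw [mem_withOdd, ← oddVerts_symmDiff, symmDiff_comm] at hA
    rw [mem_filter, mem_worms, mem_worms, oddVerts_symmDiff, hA.2, ← oddVerts_symmDiff]
    exact ⟨⟨hA.1, (mem_worms.1 h2).2⟩, symmDiff_subset hA.1 (by simpa using heE),
      (mem_worms.1 h3).2⟩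
  refine le_trans (sum_le_sum fun A hA => le_of_eq ?_)
    (sum_le_sum_of_subset_of_nonneg hset fun A hA _ => hterm e heE A hA)
  have hAE := (mem_withOdd.1 hA).1
  rw [← edgeProd_min x hx hAE heE]
  -- The encoding is normalized to `insert e A`, whose weight is the minimum. If `e ∉ A` this costs
  -- one more application of the exchange identity, with `K = {e}`.
  by_cases heA : e ∈ A
  · rw [insert_eq_of_mem heA]
    ring
  · rw [edgeProd_mul_symmDiff x A H {e} (by simpa using he), symmDiff_singleton_eq_insert heA]
    ring

/-- The path bounds are summed over all differences `H`, and the order of summation is exchanged so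
that the sum over `H` becomes the congestion of `sum_ends_le`. The factor `ends I` passes to `H`
because both have the same odd vertices. Comparing worms with even subgraphs only is enough for the
variance bound in `wormChain_poincare`. -/
lemma worm_poincare (hx : ∀ e ∈ G.edgeFinset, 0 < x e ∧ x e ≤ 1) (f : Finset (Sym2 V) → ℝ) :
    ∑ I ∈ worms G, ∑ F ∈ withOdd G ∅, ends I * edgeProd x I * edgeProd x F * (f I - f F) ^ 2 ≤
      G.edgeFinset.card * (Fintype.card V : ℝ) ^ 2 * oddSum G x ∅ * wormEnergy G x f := by
  rw [sum_worms_evens]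
  have hends : ∀ H : Finset (Sym2 V), 0 ≤ ends H := fun H => by
    unfold ends
    split_ifs <;> positivity
  calc _ = ∑ H ∈ worms G, ends H * ∑ I ∈ withOdd G (oddVerts H),
        edgeProd x I * edgeProd x (I ∆ H) * (f I - f (I ∆ H)) ^ 2 := by
        refine sum_congr rfl fun H _ => ?_
        rw [mul_sum]
        refine sum_congr rfl fun I hI => ?_
        rw [ends, ends, (mem_withOdd.1 hI).2]
        ring
    _ ≤ ∑ H ∈ worms G, ends H * (G.edgeFinset.card * ∑ e ∈ G.edgeFinset,
        ∑ A ∈ (worms G).filter (fun A => A ∆ {e} ∈ worms G),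
          min (edgeProd x A) (edgeProd x (A ∆ {e})) * (f A - f (A ∆ {e})) ^ 2 *
            edgeProd x (insert e A ∆ H)) :=
        sum_le_sum fun H hH => mul_le_mul_of_nonneg_left (worm_path_bound x hx f hH) (hends H)
    _ = G.edgeFinset.card * ∑ e ∈ G.edgeFinset,
        ∑ A ∈ (worms G).filter (fun A => A ∆ {e} ∈ worms G),
          min (edgeProd x A) (edgeProd x (A ∆ {e})) * (f A - f (A ∆ {e})) ^ 2 *
            ∑ H ∈ worms G, ends H * edgeProd x (insert e A ∆ H) := by
        simp only [mul_sum]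
        rw [sum_comm]
        refine sum_congr rfl fun e _ => ?_
        rw [sum_comm]
        refine sum_congr rfl fun A _ => sum_congr rfl fun H _ => ?_
        ring
    _ ≤ G.edgeFinset.card * ∑ e ∈ G.edgeFinset,
        ∑ A ∈ (worms G).filter (fun A => A ∆ {e} ∈ worms G),
          min (edgeProd x A) (edgeProd x (A ∆ {e})) * (f A - f (A ∆ {e})) ^ 2 *
            ((Fintype.card V : ℝ) ^ 2 * oddSum G x ∅) := by
        refine mul_le_mul_of_nonneg_left (sum_le_sum fun e he => sum_le_sum fun A hA => ?_)
          (Nat.cast_nonneg _)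
        have hAE := (mem_worms.1 (mem_filter.1 hA).1).1
        have hpos : ∀ F ⊆ G.edgeFinset, 0 ≤ edgeProd x F :=
          fun F hF => prod_nonneg fun e he => (hx e (hF he)).1.le
        refine mul_le_mul_of_nonneg_left (sum_ends_le x hx (insert_subset he hAE)) ?_
        exact mul_nonneg (le_min (hpos _ hAE) (hpos _ (symmDiff_subset hAE (by simpa using he))))
          (sq_nonneg _)
    _ = _ := by
        rw [wormEnergy]
        simp only [← sum_mul]
        ring

end Worms

/-! ## The rates of the worm chain -/

section WormRates

variable {V : Type*} [Fintype V] [DecidableEq V] {G : SimpleGraph V} [DecidableRel G.Adj]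

/-- The vertices from which the worm chain may move. -/
def wormSrc (F : Finset (Sym2 V)) : Finset V := if oddVerts F = ∅ then univ else oddVerts F

/-- The acceptance probability of the worm chain. -/
def wormAcc (G : SimpleGraph V) [DecidableRel G.Adj] (x : Sym2 V → ℝ) (F : Finset (Sym2 V))
    (v u : V) : ℝ :=
  if oddVerts F = ∅ ∨ oddVerts (F ∆ {s(v, u)}) = ∅ then
    min 1 (edgeProd x (F ∆ {s(v, u)}) / edgeProd x F) / 2
  else min 1 ((G.degree v : ℝ) / G.degree u * (edgeProd x (F ∆ {s(v, u)}) / edgeProd x F)) / 2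

/-- The probability of moving along `uv`, starting from `v`. -/
def wormRate (G : SimpleGraph V) [DecidableRel G.Adj] (x : Sym2 V → ℝ) (F : Finset (Sym2 V))
    (v u : V) : ℝ :=
  if v ∈ wormSrc F then (ends F)⁻¹ * ((G.degree v : ℝ)⁻¹ * wormAcc G x F v u) else 0

variable {x : Sym2 V → ℝ}

lemma ends_pos [Nonempty V] (F : Finset (Sym2 V)) : 0 < ends F := by
  unfold ends
  split_ifs
  · exact_mod_cast Fintype.card_pos
  · norm_num

lemma card_wormSrc {F : Finset (Sym2 V)} (hF : F ∈ worms G) : ((wormSrc F).card : ℝ) = ends F := by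
  unfold wormSrc ends
  split_ifs with h
  · simp
  · have := (mem_worms.1 hF).2.resolve_left (by simpa using h)
    rw [this]
    norm_num

lemma edgeProd_pos_of_subset (hx : ∀ e ∈ G.edgeFinset, 0 < x e) {F : Finset (Sym2 V)}
    (hF : F ⊆ G.edgeFinset) : 0 < edgeProd x F :=
  prod_pos fun e he => hx e (hF he)

lemma wormAcc_nonneg (hx : ∀ e ∈ G.edgeFinset, 0 < x e) {F : Finset (Sym2 V)}
    (hF : F ⊆ G.edgeFinset) {v u : V} (h : G.Adj v u) : 0 ≤ wormAcc G x F v u := by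
  have h1 := (edgeProd_pos_of_subset hx hF).le
  have h2 := (edgeProd_pos_of_subset hx (symmDiff_subset hF
    (singleton_subset_iff.2 (by simpa using h : s(v, u) ∈ G.edgeFinset)))).le
  unfold wormAcc
  split_ifs <;> positivity

lemma wormAcc_le (F : Finset (Sym2 V)) (v u : V) : wormAcc G x F v u ≤ 1 / 2 := by
  unfold wormAcc
  split_ifs <;> gcongr <;> exact min_le_left _ _

lemma mul_min_one_mul_div {a b : ℝ} (ha : 0 < a) (c : ℝ) :
    a * (min 1 (c * (b / a)) / 2) = min a (c * b) / 2 := by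
  rw [← mul_div_assoc, mul_min_of_nonneg _ _ ha.le, mul_one]
  congr 2
  field_simp

/-- The flow along `uv` from `v`. -/
def wormFlow (G : SimpleGraph V) [DecidableRel G.Adj] (x : Sym2 V → ℝ) (F : Finset (Sym2 V))
    (v u : V) : ℝ :=
  ends F * edgeProd x F * wormRate G x F v u

/-- The factor `ends F` of the stationary weight cancels the uniform choice of the starting vertex.
If only the target is even, then `v` and `u` are the odd vertices of `F`, so `v` is still an
admissible start. -/
lemma wormFlow_of_even [Nonempty V] (hx : ∀ e ∈ G.edgeFinset, 0 < x e) {F : Finset (Sym2 V)}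
    (hF : F ⊆ G.edgeFinset) {v u : V} (h : oddVerts F = ∅ ∨ oddVerts (F ∆ {s(v, u)}) = ∅) :
    wormFlow G x F v u =
      (G.degree v : ℝ)⁻¹ * (min (edgeProd x F) (edgeProd x (F ∆ {s(v, u)})) / 2) := by
  have hsrc : v ∈ wormSrc F := by
    unfold wormSrc
    split_ifs with h0
    · exact mem_univ v
    · have := h.resolve_left h0
      rw [oddVerts_symmDiff, oddVerts_singleton] at this
      rw [symmDiff_eq_bot.1 this]
      simp
  have h1 := mul_min_one_mul_div (b := edgeProd x (F ∆ {s(v, u)})) (edgeProd_pos_of_subset hx hF) 1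
  rw [one_mul, one_mul] at h1
  rw [wormFlow, wormRate, if_pos hsrc, wormAcc, if_pos h, ← h1]
  have := (ends_pos F).ne'
  field_simp

/-- The degree ratio in the acceptance probability produces a minimum that is symmetric under
exchanging `(F, v)` with `(F ∆ {s(v, u)}, u)`. -/
lemma wormFlow_of_odd [Nonempty V] (hx : ∀ e ∈ G.edgeFinset, 0 < x e) {F : Finset (Sym2 V)}
    (hF : F ⊆ G.edgeFinset) {v u : V} (hv : v ∈ oddVerts F)
    (h : ¬(oddVerts F = ∅ ∨ oddVerts (F ∆ {s(v, u)}) = ∅)) (hd : 0 < G.degree v) :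
    wormFlow G x F v u =
      min ((G.degree v : ℝ)⁻¹ * edgeProd x F)
        ((G.degree u : ℝ)⁻¹ * edgeProd x (F ∆ {s(v, u)})) / 2 := by
  have hsrc : v ∈ wormSrc F := by
    unfold wormSrc
    split_ifs with h0
    exacts [mem_univ v, hv]
  have hd' : (0 : ℝ) < G.degree v := by exact_mod_cast hd
  have h1 := mul_min_one_mul_div (b := edgeProd x (F ∆ {s(v, u)})) (edgeProd_pos_of_subset hx hF)
    ((G.degree v : ℝ) / G.degree u)
  have h2 : wormFlow G x F v u = (G.degree v : ℝ)⁻¹ * (edgeProd x F *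
      (min 1 ((G.degree v : ℝ) / G.degree u *
        (edgeProd x (F ∆ {s(v, u)}) / edgeProd x F)) / 2)) := by
    rw [wormFlow, wormRate, if_pos hsrc, wormAcc, if_neg h]
    have := (ends_pos F).ne'
    field_simp
  rw [h2, h1, ← mul_div_assoc, mul_min_of_nonneg _ _ (by positivity)]
  congr 2
  field_simp

lemma wormFlow_of_notMem {F : Finset (Sym2 V)} {v u : V} (h : oddVerts F ≠ ∅)
    (hv : v ∉ oddVerts F) : wormFlow G x F v u = 0 := by
  rw [wormFlow, wormRate, if_neg (by rw [wormSrc, if_neg h]; exact hv), mul_zero]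

/-- If both or neither of `v`, `u` were odd, the flip would change the number of odd vertices by
two. -/
lemma symmDiff_pair_of_worms {F : Finset (Sym2 V)} {v u : V} (hvu : v ≠ u) (hF : F ∈ worms G)
    (hF' : F ∆ {s(v, u)} ∈ worms G)
    (h : ¬(oddVerts F = ∅ ∨ oddVerts (F ∆ {s(v, u)}) = ∅)) :
    (v ∈ oddVerts F ∧ u ∉ oddVerts F) ∨ (u ∈ oddVerts F ∧ v ∉ oddVerts F) := by
  push Not at h
  have h1 := (mem_worms.1 hF).2.resolve_left (by simpa using h.1.ne_empty)
  have h2 := (mem_worms.1 hF').2.resolve_left (by simpa using h.2.ne_empty)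
  rw [oddVerts_symmDiff, oddVerts_singleton] at h2
  by_contra hcon
  by_cases hv : v ∈ oddVerts F
  · have hu : u ∈ oddVerts F := by tauto
    have : ({v, u} : Finset V) = oddVerts F :=
      eq_of_subset_of_card_le (by intro a; simp; rintro (rfl | rfl) <;> assumption)
        (by rw [h1, card_pair hvu])
    rw [this, symmDiff_self] at h2
    simp at h2
  · have hu : u ∉ oddVerts F := by tauto
    have hd : Disjoint (oddVerts F) {v, u} := by
      rw [disjoint_right]
      intro a
      simp
      rintro (rfl | rfl) <;> assumption
    rw [symmDiff_eq_union_sdiff, sdiff_eq_self_of_disjoint hd, sdiff_eq_self_of_disjoint hd.symm,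
      card_union_of_disjoint hd, h1, card_pair hvu] at h2
    omega

/-- Flipping an edge at an admissible starting vertex opens, moves or closes a worm, so a flip that
leaves the worms starts at no admissible vertex. -/
lemma wormFlow_eq_zero_of_not_worm {F : Finset (Sym2 V)} {v u : V} (huv : G.Adj v u)
    (hF : F ∈ worms G) (hF' : F ∆ {s(v, u)} ∉ worms G) :
    wormFlow G x F v u = 0 ∧ wormFlow G x F u v = 0 := by
  have hFE := (mem_worms.1 hF).1
  have hE' : F ∆ {s(v, u)} ⊆ G.edgeFinset := symmDiff_subset hFE (by simpa using huv)
  have h1 : oddVerts F ≠ ∅ := by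
    intro h0
    apply hF'
    refine mem_worms.2 ⟨hE', Or.inr ?_⟩
    rw [oddVerts_symmDiff, oddVerts_singleton, h0]
    have : (∅ : Finset V) ∆ {v, u} = {v, u} := bot_symmDiff _
    rw [this, card_pair huv.ne]
  have hcard := (mem_worms.1 hF).2.resolve_left (by simpa using h1)
  have key : ∀ a b : V, a ≠ b → ({v, u} : Finset V) = {a, b} → a ∉ oddVerts F := by
    intro a b hab hpair ha
    apply hF'
    refine mem_worms.2 ⟨hE', ?_⟩
    rw [oddVerts_symmDiff, oddVerts_singleton, hpair]
    by_cases hb : b ∈ oddVerts F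
    · left
      have : ({a, b} : Finset V) = oddVerts F :=
        eq_of_subset_of_card_le (by intro c; simp; rintro (rfl | rfl) <;> assumption)
          (by rw [hcard, card_pair hab])
      rw [this, symmDiff_self]
      rfl
    · right
      have : oddVerts F ∆ {a, b} = insert b ((oddVerts F).erase a) := by
        ext c
        simp only [mem_symmDiff, mem_insert, mem_singleton, mem_erase]
        grind
      rw [this, card_insert_of_notMem (by simp [hb]), card_erase_of_mem ha, hcard]
  exact ⟨wormFlow_of_notMem h1 (key v u huv.ne rfl),
    wormFlow_of_notMem h1 (key u v huv.ne.symm (pair_comm v u))⟩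

lemma wormFlow_swap_of_odd [Nonempty V] (hx : ∀ e ∈ G.edgeFinset, 0 < x e)
    (hd : ∀ v, 0 < G.degree v) {F : Finset (Sym2 V)} {v u : V} (huv : G.Adj v u)
    (hF : F ∈ worms G)
    (h : ¬(oddVerts F = ∅ ∨ oddVerts (F ∆ {s(v, u)}) = ∅)) (hv : v ∈ oddVerts F)
    (hu : u ∉ oddVerts F) :
    wormFlow G x F v u + wormFlow G x F u v =
      wormFlow G x (F ∆ {s(v, u)}) v u + wormFlow G x (F ∆ {s(v, u)}) u v := by
  have hFE := (mem_worms.1 hF).1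
  have hE' : F ∆ {s(v, u)} ⊆ G.edgeFinset := symmDiff_subset hFE (by simpa using huv)
  have hFF : F ∆ {s(v, u)} ∆ {s(v, u)} = F := symmDiff_symmDiff_cancel_right _ _
  have h' : ¬(oddVerts (F ∆ {s(v, u)}) = ∅ ∨ oddVerts (F ∆ {s(v, u)} ∆ {s(u, v)}) = ∅) := by
    rw [Sym2.eq_swap (a := u), hFF, or_comm]
    exact h
  have hu' : u ∈ oddVerts (F ∆ {s(v, u)}) := by
    rw [oddVerts_symmDiff, oddVerts_singleton, mem_symmDiff]
    simp [hu]
  have hv' : v ∉ oddVerts (F ∆ {s(v, u)}) := by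
    rw [oddVerts_symmDiff, oddVerts_singleton, mem_symmDiff]
    simp [hv]
  have h0 := not_or.1 h
  rw [wormFlow_of_notMem h0.1 hu, wormFlow_of_notMem h0.2 hv',
    wormFlow_of_odd hx hFE hv h (hd v), wormFlow_of_odd hx hE' hu' h' (hd u),
    Sym2.eq_swap (a := u), hFF, min_comm]
  ring

/-- Detailed balance is stated for both orientations together, because the reverse of a move of an
open end from `v` to `u` starts at `u`. -/
lemma wormFlow_symm [Nonempty V] (hx : ∀ e ∈ G.edgeFinset, 0 < x e)
    (hd : ∀ v, 0 < G.degree v) {F : Finset (Sym2 V)} {v u : V} (huv : G.Adj v u)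
    (hF : F ∈ worms G) (hF' : F ∆ {s(v, u)} ∈ worms G) :
    wormFlow G x F v u + wormFlow G x F u v =
      wormFlow G x (F ∆ {s(v, u)}) v u + wormFlow G x (F ∆ {s(v, u)}) u v := by
  have hFE := (mem_worms.1 hF).1
  have hE' := (mem_worms.1 hF').1
  have hFF : F ∆ {s(v, u)} ∆ {s(v, u)} = F := symmDiff_symmDiff_cancel_right _ _
  by_cases h : oddVerts F = ∅ ∨ oddVerts (F ∆ {s(v, u)}) = ∅
  · have h' := h.symm
    nth_rewrite 2 [← hFF] at h'
    rw [wormFlow_of_even hx hFE h, wormFlow_of_even hx hE' h',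
      wormFlow_of_even hx hFE (by rwa [Sym2.eq_swap]), wormFlow_of_even hx hE'
        (by rwa [Sym2.eq_swap (a := u)]), Sym2.eq_swap (a := u), hFF,
      min_comm (edgeProd x F)]
  · rcases symmDiff_pair_of_worms huv.ne hF hF' h with ⟨hv, hu⟩ | ⟨hu, hv⟩
    · exact wormFlow_swap_of_odd hx hd huv hF h hv hu
    · rw [Sym2.eq_swap] at h ⊢
      have := wormFlow_swap_of_odd hx hd huv.symm hF h hu hv
      linarith

/-- At least one orientation of the edge carries flow, and its vertex degrees are at most `Δ`. -/
lemma wormFlow_lower [Nonempty V] (hx : ∀ e ∈ G.edgeFinset, 0 < x e)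
    (hd : ∀ v, 0 < G.degree v) {F : Finset (Sym2 V)} {v u : V} (huv : G.Adj v u)
    (hF : F ∈ worms G) (hF' : F ∆ {s(v, u)} ∈ worms G) :
    (G.maxDegree : ℝ)⁻¹ * (min (edgeProd x F) (edgeProd x (F ∆ {s(v, u)})) / 2) ≤
      wormFlow G x F v u + wormFlow G x F u v := by
  have hFE := (mem_worms.1 hF).1
  have hE' := (mem_worms.1 hF').1
  have h1 := edgeProd_pos_of_subset hx hFE
  have h2 := edgeProd_pos_of_subset hx hE'
  have hdeg : ∀ w, (G.maxDegree : ℝ)⁻¹ ≤ (G.degree w : ℝ)⁻¹ := fun w => by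
    have h3 : (0 : ℝ) < G.degree w := by exact_mod_cast hd w
    have h4 : (G.degree w : ℝ) ≤ G.maxDegree := by exact_mod_cast G.degree_le_maxDegree w
    gcongr
  have key : ∀ a b : V, s(a, b) = s(v, u) →
      ¬(oddVerts F = ∅ ∨ oddVerts (F ∆ {s(a, b)}) = ∅) → a ∈ oddVerts F → b ∉ oddVerts F →
      (G.maxDegree : ℝ)⁻¹ * (min (edgeProd x F) (edgeProd x (F ∆ {s(v, u)})) / 2) ≤
      wormFlow G x F a b + wormFlow G x F b a := by
    intro a b hab h ha hb
    rw [wormFlow_of_odd hx hFE ha h (hd a), wormFlow_of_notMem (fun h0 => h (Or.inl h0)) hb,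
      add_zero, hab, ← mul_div_assoc]
    refine div_le_div_of_nonneg_right ?_ zero_le_two
    rw [mul_min_of_nonneg _ _ (by positivity)]
    exact min_le_min (mul_le_mul_of_nonneg_right (hdeg a) h1.le)
      (mul_le_mul_of_nonneg_right (hdeg b) h2.le)
  by_cases h : oddVerts F = ∅ ∨ oddVerts (F ∆ {s(v, u)}) = ∅
  · rw [wormFlow_of_even hx hFE h, wormFlow_of_even hx hFE (by rwa [Sym2.eq_swap]),
      Sym2.eq_swap (a := u)]
    have h3 : 0 ≤ min (edgeProd x F) (edgeProd x (F ∆ {s(v, u)})) / 2 := by positivity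
    have h4 := mul_le_mul_of_nonneg_right (hdeg v) h3
    have h5 : 0 ≤ (G.degree u : ℝ)⁻¹ *
      (min (edgeProd x F) (edgeProd x (F ∆ {s(v, u)})) / 2) := by positivity
    linarith
  · rcases symmDiff_pair_of_worms huv.ne hF hF' h with ⟨hv, hu⟩ | ⟨hu, hv⟩
    · exact key v u rfl h hv hu
    · rw [add_comm]
      exact key u v Sym2.eq_swap (by rwa [Sym2.eq_swap]) hu hv

lemma wormRate_nonneg (hx : ∀ e ∈ G.edgeFinset, 0 < x e) {F : Finset (Sym2 V)}
    (hF : F ⊆ G.edgeFinset) {v u : V} (h : G.Adj v u) : 0 ≤ wormRate G x F v u := by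
  unfold wormRate
  split_ifs
  · have h1 := wormAcc_nonneg hx hF h
    have h2 : 0 ≤ ends F := by unfold ends; split_ifs <;> positivity
    positivity
  · exact le_rfl

/-- The ordered pairs of adjacent vertices. -/
def adjPairs (G : SimpleGraph V) [DecidableRel G.Adj] : Finset (V × V) :=
  univ.filter fun p => G.Adj p.1 p.2

lemma sum_adjPairs (φ : V → V → ℝ) :
    ∑ p ∈ adjPairs G, φ p.1 p.2 = ∑ v, ∑ u ∈ G.neighborFinset v, φ v u := by
  rw [adjPairs, sum_filter, ← univ_product_univ, sum_product]
  refine sum_congr rfl fun v _ => ?_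
  rw [← sum_filter, G.neighborFinset_eq_filter]

lemma sum_adjPairs_swap (φ : V → V → ℝ) :
    ∑ p ∈ adjPairs G, φ p.1 p.2 = ∑ p ∈ adjPairs G, φ p.2 p.1 := by
  refine sum_nbij' Prod.swap Prod.swap ?_ ?_ ?_ ?_ ?_ <;> simp [adjPairs, G.adj_comm]

lemma sum_adjPairs_edge (φ : Sym2 V → ℝ) :
    ∑ p ∈ adjPairs G, φ s(p.1, p.2) = 2 * ∑ e ∈ G.edgeFinset, φ e := by
  have hmaps : ∀ p ∈ adjPairs G, s(p.1, p.2) ∈ G.edgeFinset := by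
    intro p hp
    simpa [adjPairs] using hp
  rw [← sum_fiberwise_of_maps_to hmaps, mul_sum]
  refine sum_congr rfl fun e he => ?_
  induction e using Sym2.ind with
  | _ a b =>
    have hab : G.Adj a b := by simpa using he
    have : (adjPairs G).filter (fun p => s(p.1, p.2) = s(a, b)) = {(a, b), (b, a)} := by
      ext ⟨p, q⟩
      simp only [adjPairs, mem_filter, mem_univ, true_and, Sym2.eq_iff, mem_insert, mem_singleton,
        Prod.mk.injEq]
      constructor
      · tauto
      · rintro (⟨rfl, rfl⟩ | ⟨rfl, rfl⟩)
        exacts [⟨hab, by simp⟩, ⟨hab.symm, by simp⟩]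
    rw [this, sum_pair (by simp [hab.ne]), Sym2.eq_swap (a := b)]
    ring

/-- The effect of a move depends on the unoriented edge only. The rates can therefore be averaged
over the orientations, as reversibility requires, without altering the transition operator. -/
lemma sum_wormRate (F : Finset (Sym2 V)) (φ : Sym2 V → ℝ) :
    ∑ p ∈ adjPairs G, (wormRate G x F p.1 p.2 + wormRate G x F p.2 p.1) / 2 * φ s(p.1, p.2) =
      ∑ v ∈ wormSrc F, (ends F)⁻¹ *
        ∑ u ∈ G.neighborFinset v, (G.degree v : ℝ)⁻¹ * (wormAcc G x F v u * φ s(v, u)) := by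
  have h1 : ∑ p ∈ adjPairs G, (wormRate G x F p.1 p.2 + wormRate G x F p.2 p.1) / 2 *
      φ s(p.1, p.2) = ∑ p ∈ adjPairs G, wormRate G x F p.1 p.2 * φ s(p.1, p.2) := by
    have h2 := sum_adjPairs_swap (G := G) fun v u => wormRate G x F v u * φ s(v, u)
    have h3 : ∀ p : V × V, (wormRate G x F p.1 p.2 + wormRate G x F p.2 p.1) / 2 * φ s(p.1, p.2) =
        (wormRate G x F p.1 p.2 * φ s(p.1, p.2) + wormRate G x F p.2 p.1 * φ s(p.2, p.1)) / 2 := by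
      intro p
      rw [Sym2.eq_swap (a := p.2)]
      ring
    simp only [h3]
    rw [← sum_div, sum_add_distrib, ← h2]
    ring
  rw [h1, sum_adjPairs fun v u => wormRate G x F v u * φ s(v, u), ← sum_subset (subset_univ (wormSrc F))]
  · refine sum_congr rfl fun v hv => ?_
    rw [mul_sum]
    refine sum_congr rfl fun u _ => ?_
    rw [wormRate, if_pos hv]
    ring
  · intro v _ hv
    refine sum_eq_zero fun u _ => ?_
    rw [wormRate, if_neg hv, zero_mul]

lemma sum_wormRate_le [Nonempty V] {F : Finset (Sym2 V)} (hF : F ∈ worms G)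
    (hd : ∀ v, 0 < G.degree v) :
    ∑ p ∈ adjPairs G, (wormRate G x F p.1 p.2 + wormRate G x F p.2 p.1) / 2 ≤ 1 / 2 := by
  have h := sum_wormRate (G := G) (x := x) F fun _ => 1
  simp only [mul_one] at h
  rw [h]
  have hv : ∀ v, ∑ u ∈ G.neighborFinset v, (G.degree v : ℝ)⁻¹ * wormAcc G x F v u ≤ 1 / 2 := by
    intro v
    have h0 : (0 : ℝ) < G.degree v := by exact_mod_cast hd v
    calc _ ≤ ∑ u ∈ G.neighborFinset v, (G.degree v : ℝ)⁻¹ * (1 / 2) :=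
          sum_le_sum fun u _ => mul_le_mul_of_nonneg_left (wormAcc_le F v u) (by positivity)
      _ = 1 / 2 := by
          rw [sum_const, G.card_neighborFinset_eq_degree, nsmul_eq_mul,
            mul_inv_cancel_left₀ h0.ne']
  have he := ends_pos F
  calc _ ≤ ∑ v ∈ wormSrc F, (ends F)⁻¹ * (1 / 2) :=
        sum_le_sum fun v _ => mul_le_mul_of_nonneg_left (hv v) (by positivity)
    _ = 1 / 2 := by rw [sum_const, nsmul_eq_mul, card_wormSrc hF, mul_inv_cancel_left₀ he.ne']

/-! ## The transition operator of the worm chain -/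

variable (B : BPModel G)

lemma degIn_le_degree {F : Finset (Sym2 V)} (hF : F ⊆ G.edgeFinset) (v : V) :
    degIn F v ≤ G.degree v := by
  rw [← G.card_incidenceFinset_eq_degree, G.incidenceFinset_eq_filter]
  exact card_le_card (filter_subset_filter _ hF)

/-- The only even numbers up to three are `0` and `2`. This is where the degree bound makes the
loops a cycle space. -/
lemma isTwoRegular_iff (h3 : G.maxDegree ≤ 3) {F : Finset (Sym2 V)} (hF : F ⊆ G.edgeFinset) :
    IsTwoRegular F ↔ oddVerts F = ∅ := by
  have key : ∀ v, (degIn F v = 0 ∨ degIn F v = 2) ↔ ¬Odd (degIn F v) := by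
    intro v
    have := (degIn_le_degree hF v).trans ((G.degree_le_maxDegree v).trans h3)
    interval_cases degIn F v <;> decide
  simp only [IsTwoRegular, key, oddVerts, filter_eq_empty_iff, mem_univ, true_implies]

lemma twoLoops_eq (h3 : G.maxDegree ≤ 3) : twoLoops G = withOdd G ∅ := by
  ext F
  rw [mem_withOdd, twoLoops, mem_filter, mem_powerset]
  exact and_congr_right fun h => isTwoRegular_iff h3 h

variable [Nonempty V]

lemma add_sum_inv_mul {α : Type*} {s : Finset α} {c : ℝ} (hs : (s.card : ℝ) = c) (hc : c ≠ 0)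
    (a : ℝ) (f : α → ℝ) : a + ∑ i ∈ s, c⁻¹ * f i = ∑ i ∈ s, c⁻¹ * (a + f i) := by
  simp only [mul_add, sum_add_distrib]
  rw [sum_const, nsmul_eq_mul, hs, mul_inv_cancel_left₀ hc]

/-- The link between the program and the abstract chain. On worms the set of starting vertices is
nonempty of size `ends F`, so the default branch of `choose` is never taken. -/
lemma avg_wormStep (h3 : G.maxDegree ≤ 3) (hd : ∀ v, 0 < G.degree v) (β : ℝ)
    (hx : ∀ e ∈ G.edgeFinset, 0 < B.edgeWeight e ^ β) {F : Finset (Sym2 V)} (hF : F ∈ worms G)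
    (g : Finset (Sym2 V) → ℝ) :
    (B.wormStep β F).law.avg g = g F + ∑ p ∈ adjPairs G,
      (wormRate G (fun e => B.edgeWeight e ^ β) F p.1 p.2 +
        wormRate G (fun e => B.edgeWeight e ^ β) F p.2 p.1) / 2 *
          (g (F ∆ {s(p.1, p.2)}) - g F) := by
  set x : Sym2 V → ℝ := fun e => B.edgeWeight e ^ β with hxdef
  have hFE := (mem_worms.1 hF).1
  have hsrc : (if decide (IsTwoRegular F) = true then univ else
      univ.filter fun v : V => Odd (degIn F v)) = wormSrc F := by
    simp only [decide_eq_true_eq, isTwoRegular_iff h3 hFE]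
    rfl
  have hne : (wormSrc F).Nonempty := by
    have h1 := card_wormSrc hF
    have h2 := ends_pos F
    rw [← h1] at h2
    exact card_pos.1 (by exact_mod_cast h2)
  have hNe : ∀ v, (G.neighborFinset v).Nonempty := fun v =>
    card_pos.1 (by rw [G.card_neighborFinset_eq_degree]; exact hd v)
  have hN : ∀ v, (univ.filter fun u => G.Adj v u) = G.neighborFinset v :=
    fun v => (G.neighborFinset_eq_filter).symm
  rw [sum_wormRate F fun e => g (F ∆ {e}) - g F, BPModel.wormStep]
  simp only [BPModel.testTwoRegular, Timed.law_bind, Timed.law_charge, Timed.law_filter, Timed.law_prod,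
    PMF.pure_bind, hsrc, hN]
  rw [PMF.avg_bind, Timed.law_choose hne, PMF.avg_uniformOfFinset, card_wormSrc hF]
  rw [add_sum_inv_mul (card_wormSrc hF) (ends_pos F).ne']
  refine sum_congr rfl fun v _ => ?_
  congr 1
  rw [PMF.avg_bind, Timed.law_choose (hNe v), PMF.avg_uniformOfFinset,
    G.card_neighborFinset_eq_degree]
  have hdv : (0 : ℝ) < G.degree v := by exact_mod_cast hd v
  rw [add_sum_inv_mul (by rw [G.card_neighborFinset_eq_degree]) hdv.ne']
  refine sum_congr rfl fun u hu => ?_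
  have huv : G.Adj v u := by simpa using hu
  have hE' : F ∆ {s(v, u)} ⊆ G.edgeFinset := symmDiff_subset hFE (by simpa using huv)
  congr 1
  have hacc : (if (decide (IsTwoRegular F) || decide (IsTwoRegular (F ∆ {s(v, u)}))) = true then
      min 1 ((∏ e ∈ F ∆ {s(v, u)}, B.edgeWeight e ^ β) / ∏ e ∈ F, B.edgeWeight e ^ β) / 2
      else min 1 ((G.degree v : ℝ) / G.degree u *
        ((∏ e ∈ F ∆ {s(v, u)}, B.edgeWeight e ^ β) / ∏ e ∈ F, B.edgeWeight e ^ β)) / 2) =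
      wormAcc G x F v u := by
    simp only [Bool.or_eq_true, decide_eq_true_eq, isTwoRegular_iff h3 hFE,
      isTwoRegular_iff h3 hE']
    rfl
  simp only [G.card_neighborFinset_eq_degree, hacc]
  rw [PMF.avg_bind, Timed.avg_coin (wormAcc_nonneg hx hFE huv) ((wormAcc_le F v u).trans (by norm_num))]
  simp only [PMF.avg_pure, if_true, Bool.false_eq_true, if_false]
  ring

end WormRates

/-! ## Mixing of the worm chain and accuracy of the sampler -/

namespace BPModel

variable {V : Type*} [Fintype V] [DecidableEq V] {G : SimpleGraph V} [DecidableRel G.Adj]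
  [Nonempty V] (B : BPModel G)

lemma sum_wormWeight (x : Sym2 V → ℝ) (φ : Finset (Sym2 V) → ℝ) :
    ∑ F, (if F ∈ worms G then ends F * edgeProd x F else 0) * φ F =
      ∑ F ∈ worms G, ends F * edgeProd x F * φ F := by
  simp only [ite_mul, zero_mul, sum_ite_mem, univ_inter]

/-- The worm chain as a lazy reversible chain. -/
def wormChain (h3 : G.maxDegree ≤ 3) (hd : ∀ v, 0 < G.degree v) (β : ℝ)
    (hx : ∀ e ∈ G.edgeFinset, 0 < B.edgeWeight e ^ β) : FlipChain (Finset (Sym2 V)) (V × V) where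
  moves := adjPairs G
  flip p F := F ∆ {s(p.1, p.2)}
  flip_flip p _ F := symmDiff_symmDiff_cancel_right _ _
  rate F p := (wormRate G (fun e => B.edgeWeight e ^ β) F p.1 p.2 +
    wormRate G (fun e => B.edgeWeight e ^ β) F p.2 p.1) / 2
  wt F := if F ∈ worms G then ends F * edgeProd (fun e => B.edgeWeight e ^ β) F else 0
  wt_nonneg F := by
    split_ifs with h
    · exact (mul_pos (ends_pos F) (edgeProd_pos_of_subset hx (mem_worms.1 h).1)).le
    · exact le_rfl
  rate_nonneg F hF p hp := by
    have hw : F ∈ worms G := by_contra fun h => hF (if_neg h)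
    have hE := (mem_worms.1 hw).1
    have hp' : G.Adj p.1 p.2 := (mem_filter.1 hp).2
    have h1 := wormRate_nonneg hx hE hp'
    have h2 := wormRate_nonneg hx hE hp'.symm
    positivity
  rate_sum F hF := sum_wormRate_le (by_contra fun h => hF (if_neg h)) hd
  balance F p hp := by
    obtain ⟨v, u⟩ := p
    have huv : G.Adj v u := (mem_filter.1 hp).2
    have hFF : F ∆ {s(v, u)} ∆ {s(v, u)} = F := symmDiff_symmDiff_cancel_right _ _
    dsimp only
    -- The weight is extended by zero off the worms, so a mixed pair balances exactly when the rate
    -- out of the worm vanishes.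
    by_cases h : F ∈ worms G <;> by_cases h' : F ∆ {s(v, u)} ∈ worms G
    · rw [if_pos h, if_pos h']
      have := wormFlow_symm hx hd huv h h'
      unfold wormFlow at this
      linarith
    · rw [if_pos h, if_neg h']
      have := wormFlow_eq_zero_of_not_worm (x := fun e => B.edgeWeight e ^ β) huv h h'
      unfold wormFlow at this
      linarith
    · rw [if_neg h, if_pos h']
      have := wormFlow_eq_zero_of_not_worm (x := fun e => B.edgeWeight e ^ β) huv h'
        (by rwa [hFF])
      unfold wormFlow at this
      linarith
    · rw [if_neg h, if_neg h', zero_mul, zero_mul]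
  step g F := (B.wormStep β F).law.avg g
  step_eq g F hF := avg_wormStep B h3 hd β hx (by_contra fun h => hF (if_neg h)) g
  step_sub_const g c := by
    funext F
    rw [PMF.avg_sub, PMF.avg_const]

variable {B} {β : ℝ}

/-- Expanding the square in `worm_poincare` for a centred `f`, the cross term vanishes and the part
carrying `f²` on the even side is nonnegative. What remains is the variance times `oddSum G x ∅`,
which cancels. -/
lemma wormChain_poincare (h3 : G.maxDegree ≤ 3) (hd : ∀ v, 0 < G.degree v)
    (hx : ∀ e ∈ G.edgeFinset, 0 < B.edgeWeight e ^ β ∧ B.edgeWeight e ^ β ≤ 1)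
    (f : Finset (Sym2 V) → ℝ)
    (hf : ∑ F, (B.wormChain h3 hd β fun e he => (hx e he).1).wt F * f F = 0) :
    ∑ F, (B.wormChain h3 hd β fun e he => (hx e he).1).wt F * f F ^ 2 ≤
      4 * G.maxDegree * G.edgeFinset.card * Fintype.card V ^ 2 *
        (B.wormChain h3 hd β fun e he => (hx e he).1).dirichlet f := by
  set x : Sym2 V → ℝ := fun e => B.edgeWeight e ^ β with hxdef
  have hx0 : ∀ e ∈ G.edgeFinset, 0 < x e := fun e he => (hx e he).1
  have hZ := oddSum_empty_pos x hx
  have h1 := worm_poincare x hx f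
  have hf' : ∑ F ∈ worms G, ends F * edgeProd x F * f F = 0 := by
    rw [← sum_wormWeight]
    exact hf
  have hgoal : ∑ F, (B.wormChain h3 hd β fun e he => (hx e he).1).wt F * f F ^ 2 =
      ∑ F ∈ worms G, ends F * edgeProd x F * f F ^ 2 := sum_wormWeight x fun F => f F ^ 2
  rw [hgoal]
  have hexp : ∑ I ∈ worms G, ∑ F ∈ withOdd G ∅,
      ends I * edgeProd x I * edgeProd x F * (f I - f F) ^ 2 =
      (∑ F ∈ worms G, ends F * edgeProd x F * f F ^ 2) * oddSum G x ∅ -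
      2 * (∑ F ∈ worms G, ends F * edgeProd x F * f F) * (∑ F ∈ withOdd G ∅, edgeProd x F * f F) +
      (∑ F ∈ worms G, ends F * edgeProd x F) * ∑ F ∈ withOdd G ∅, edgeProd x F * f F ^ 2 := by
    rw [mul_assoc 2, oddSum, sum_mul_sum, sum_mul_sum, sum_mul_sum, mul_sum, ← sum_sub_distrib,
      ← sum_add_distrib]
    refine sum_congr rfl fun I _ => ?_
    rw [mul_sum, ← sum_sub_distrib, ← sum_add_distrib]
    exact sum_congr rfl fun F _ => by ring
  rw [hexp, hf'] at h1
  have hpos : 0 ≤ (∑ F ∈ worms G, ends F * edgeProd x F) *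
      ∑ F ∈ withOdd G ∅, edgeProd x F * f F ^ 2 := by
    refine mul_nonneg (sum_nonneg fun F hF => ?_) (sum_nonneg fun F hF => ?_)
    · exact (mul_pos (ends_pos F) (edgeProd_pos_of_subset hx0 (mem_worms.1 hF).1)).le
    · exact mul_nonneg (edgeProd_pos_of_subset hx0 (mem_withOdd.1 hF).1).le (sq_nonneg _)
  have h2 : ∑ F ∈ worms G, ends F * edgeProd x F * f F ^ 2 ≤
      G.edgeFinset.card * (Fintype.card V : ℝ) ^ 2 * wormEnergy G x f := by
    refine le_of_mul_le_mul_right ?_ hZ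
    linarith
  have hD : 0 < (G.maxDegree : ℝ) := by
    obtain ⟨v⟩ := ‹Nonempty V›
    exact_mod_cast (hd v).trans_le (G.degree_le_maxDegree v)
  -- `wormFlow_lower` costs `2Δ`, ordered pairs count every edge twice, and the averaged rates and
  -- the Dirichlet form contribute one half each: in total `4Δ`.
  have h4 : wormEnergy G x f ≤ 4 * G.maxDegree *
      (B.wormChain h3 hd β fun e he => (hx e he).1).dirichlet f := by
    have hflow : (B.wormChain h3 hd β fun e he => (hx e he).1).dirichlet f =
        (∑ p ∈ adjPairs G, ∑ F ∈ worms G, (wormFlow G x F p.1 p.2 + wormFlow G x F p.2 p.1) / 2 *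
          (f (F ∆ {s(p.1, p.2)}) - f F) ^ 2) / 2 := by
      rw [sum_comm, FlipChain.dirichlet]
      congr 1
      simp only [mul_assoc, ← mul_sum]
      refine (sum_wormWeight x _).trans (sum_congr rfl fun F _ => ?_)
      rw [mul_sum]
      refine sum_congr rfl fun p _ => ?_
      simp only [wormFlow, wormChain]
      ring
    rw [hflow]
    have h5 : 2 * wormEnergy G x f ≤ ∑ p ∈ adjPairs G, ∑ F ∈ worms G,
        2 * G.maxDegree * ((wormFlow G x F p.1 p.2 + wormFlow G x F p.2 p.1) *
          (f (F ∆ {s(p.1, p.2)}) - f F) ^ 2) := by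
      rw [wormEnergy, ← sum_adjPairs_edge fun e =>
        ∑ A ∈ (worms G).filter (fun A => A ∆ {e} ∈ worms G),
          min (edgeProd x A) (edgeProd x (A ∆ {e})) * (f A - f (A ∆ {e})) ^ 2]
      refine sum_le_sum fun p hp => ?_
      have huv : G.Adj p.1 p.2 := (mem_filter.1 hp).2
      rw [sum_filter]
      refine sum_le_sum fun F hF => ?_
      split_ifs with hF'
      · have h6 := wormFlow_lower hx0 hd huv hF hF'
        rw [inv_mul_le_iff₀ hD] at h6
        have h7 := mul_le_mul_of_nonneg_right h6 (sq_nonneg (f (F ∆ {s(p.1, p.2)}) - f F))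
        have h8 : (f F - f (F ∆ {s(p.1, p.2)})) ^ 2 = (f (F ∆ {s(p.1, p.2)}) - f F) ^ 2 := by ring
        rw [h8]
        linarith
      · have := wormFlow_eq_zero_of_not_worm (x := x) huv hF hF'
        rw [this.1, this.2]
        simp
    simp only [← mul_sum] at h5
    have h9 : ∑ p ∈ adjPairs G, ∑ F ∈ worms G,
        (wormFlow G x F p.1 p.2 + wormFlow G x F p.2 p.1) / 2 *
          (f (F ∆ {s(p.1, p.2)}) - f F) ^ 2 =
        (∑ p ∈ adjPairs G, ∑ F ∈ worms G,
        (wormFlow G x F p.1 p.2 + wormFlow G x F p.2 p.1) *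
          (f (F ∆ {s(p.1, p.2)}) - f F) ^ 2) / 2 := by
      simp only [sum_div]
      exact sum_congr rfl fun p _ => sum_congr rfl fun F _ => by ring
    rw [h9]
    linarith
  calc _ ≤ _ := h2
    _ ≤ G.edgeFinset.card * (Fintype.card V : ℝ) ^ 2 * (4 * G.maxDegree *
      (B.wormChain h3 hd β fun e he => (hx e he).1).dirichlet f) :=
        mul_le_mul_of_nonneg_left h4 (by positivity)
    _ = _ := by ring

/-- The average of `g` in equilibrium of the worm chain. -/
def wormMean (B : BPModel G) (β : ℝ) (g : Finset (Sym2 V) → ℝ) : ℝ :=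
  (∑ F ∈ worms G, ends F * edgeProd (fun e => B.edgeWeight e ^ β) F * g F) /
    ∑ F ∈ worms G, ends F * edgeProd (fun e => B.edgeWeight e ^ β) F

lemma sum_worms_le (hx : ∀ e ∈ G.edgeFinset, 0 < B.edgeWeight e ^ β ∧ B.edgeWeight e ^ β ≤ 1) :
    ∑ F ∈ worms G, ends F * edgeProd (fun e => B.edgeWeight e ^ β) F ≤
      (Fintype.card V : ℝ) ^ 2 * oddSum G (fun e => B.edgeWeight e ^ β) ∅ := by
  have h := sum_ends_le (fun e => B.edgeWeight e ^ β) hx (empty_subset _)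
  simpa [← Finset.bot_eq_empty] using h

lemma sum_worms_pos (hx : ∀ e ∈ G.edgeFinset, 0 < B.edgeWeight e ^ β) :
    0 < ∑ F ∈ worms G, ends F * edgeProd (fun e => B.edgeWeight e ^ β) F :=
  sum_pos (fun F hF => mul_pos (ends_pos F) (edgeProd_pos_of_subset hx (mem_worms.1 hF).1))
    ⟨∅, empty_mem_worms⟩

/-- The start `∅` has weight `n`, while the total weight is at most `n²` times the number of even
subgraphs; their quotient is the price of the worst-case start. -/
lemma sq_avg_iterate_sub_le (h3 : G.maxDegree ≤ 3) (hd : ∀ v, 0 < G.degree v)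
    (hx : ∀ e ∈ G.edgeFinset, 0 < B.edgeWeight e ^ β ∧ B.edgeWeight e ^ β ≤ 1)
    (g : Finset (Sym2 V) → ℝ) (hg : ∀ F ∈ worms G, |g F| ≤ 1) (T : ℕ) {s : ℝ}
    (hT : 4 * G.maxDegree * G.edgeFinset.card * Fintype.card V ^ 2 * s ≤ T) :
    ((Timed.iterate (B.wormStep β) T ∅).law.avg g - B.wormMean β g) ^ 2 ≤
      Real.exp (-s) * (Fintype.card V * (withOdd G ∅).card) := by
  set x : Sym2 V → ℝ := fun e => B.edgeWeight e ^ β with hxdef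
  have hx0 : ∀ e ∈ G.edgeFinset, 0 < x e := fun e he => (hx e he).1
  set C := B.wormChain h3 hd β hx0 with hC
  have hn1 : (1 : ℝ) ≤ Fintype.card V := by exact_mod_cast Fintype.card_pos
  have hD1 : (1 : ℝ) ≤ G.maxDegree := by
    obtain ⟨v⟩ := ‹Nonempty V›
    exact_mod_cast (hd v).trans_le (G.degree_le_maxDegree v)
  have hm1 : (1 : ℝ) ≤ G.edgeFinset.card := by
    obtain ⟨v⟩ := ‹Nonempty V›
    have := hd v
    rw [← G.card_incidenceFinset_eq_degree, G.incidenceFinset_eq_filter] at this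
    exact_mod_cast this.trans_le (card_filter_le _ _)
  set R : ℝ := 4 * G.maxDegree * G.edgeFinset.card * Fintype.card V ^ 2 with hR
  have hR1 : 1 ≤ R := by
    have h1 := mul_le_mul hD1 hm1 zero_le_one (by linarith)
    have h2 := mul_le_mul h1 (one_le_pow₀ hn1 (n := 2)) zero_le_one (by linarith)
    rw [hR]
    linarith
  have hR0 : 0 < R := by linarith
  have hwt1 : ∀ φ : Finset (Sym2 V) → ℝ, ∑ F, C.wt F * φ F =
      ∑ F ∈ worms G, ends F * edgeProd x F * φ F := fun φ => sum_wormWeight x φ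
  have hwt : ∑ F, C.wt F = ∑ F ∈ worms G, ends F * edgeProd x F := by
    simpa using hwt1 fun _ => 1
  have hpos := sum_worms_pos hx0
  have h0 : C.wt ∅ = Fintype.card V := by
    simp [hC, wormChain, empty_mem_worms, ends, oddVerts_empty, edgeProd]
  have main := C.sq_iterate_sub_le (γ := R⁻¹) (inv_le_one_of_one_le₀ hR1)
    (fun f hf => by
      rw [inv_mul_le_iff₀ hR0]
      exact wormChain_poincare h3 hd hx f hf) g T ∅ (by rw [hwt]; exact hpos)
  rw [h0, hwt1, hwt1, hwt] at main
  rw [Timed.avg_iterate]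
  change ((C.step)^[T] g ∅ - _) ^ 2 ≤ _
  have hsq : ∑ F ∈ worms G, ends F * edgeProd x F * g F ^ 2 ≤
      (Fintype.card V : ℝ) ^ 2 * (withOdd G ∅).card := by
    calc _ ≤ ∑ F ∈ worms G, ends F * edgeProd x F := by
          refine sum_le_sum fun F hF => mul_le_of_le_one_right ?_ ?_
          · exact (mul_pos (ends_pos F) (edgeProd_pos_of_subset hx0 (mem_worms.1 hF).1)).le
          · rw [sq_le_one_iff_abs_le_one]
            exact hg F hF
      _ ≤ _ := sum_worms_le hx
      _ ≤ _ := by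
          gcongr
          rw [oddSum, ← nsmul_one, ← sum_const]
          refine sum_le_sum fun F hF => prod_le_one (fun e he => ?_) fun e he => ?_
          · exact (hx0 e ((mem_withOdd.1 hF).1 he)).le
          · exact (hx e ((mem_withOdd.1 hF).1 he)).2
  have hexp : (1 - R⁻¹) ^ T ≤ Real.exp (-s) := by
    have h1 : 1 - R⁻¹ ≤ Real.exp (-R⁻¹) := by linarith [Real.add_one_le_exp (-R⁻¹)]
    calc _ ≤ Real.exp (-R⁻¹) ^ T :=
          pow_le_pow_left₀ (by linarith [inv_le_one_of_one_le₀ hR1]) h1 T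
      _ = Real.exp (-(R⁻¹ * T)) := by
          rw [← Real.exp_nat_mul]
          congr 1
          ring
      _ ≤ _ := by
          rw [Real.exp_le_exp, neg_le_neg_iff, le_inv_mul_iff₀ hR0]
          exact hT
  have hn0 : (0 : ℝ) < Fintype.card V := by linarith
  refine le_of_mul_le_mul_left (main.trans ?_) hn0
  calc _ ≤ Real.exp (-s) * ((Fintype.card V : ℝ) ^ 2 * (withOdd G ∅).card) := by
        refine mul_le_mul hexp hsq (sum_nonneg fun F hF => ?_) (Real.exp_pos _).le
        exact mul_nonneg (mul_pos (ends_pos F)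
          (edgeProd_pos_of_subset hx0 (mem_worms.1 hF).1)).le (sq_nonneg _)
    _ = _ := by ring

/-- Since `2m ≤ 3n`, the dimension `m - n + 1` is at most `n/2 + 1 ≤ n`. -/
lemma card_loops_le (hG : G.Connected) (h3 : G.maxDegree ≤ 3) (hn : 2 ≤ Fintype.card V) :
    ((withOdd G ∅).card : ℝ) ≤ 2 ^ Fintype.card V := by
  rw [card_withOdd_empty hG, ← zpow_natCast]
  refine zpow_le_zpow_right₀ one_le_two ?_
  have h1 := G.sum_degrees_eq_twice_card_edges
  have h2 : ∑ v, G.degree v ≤ ∑ _v : V, 3 :=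
    sum_le_sum fun v _ => (G.degree_le_maxDegree v).trans h3
  rw [sum_const, card_univ, smul_eq_mul] at h2
  omega

/-- With `y = exp (-X) ≤ 1/48`, the power `y^(n²)` absorbs the starting penalty `n * 2^n` and the
factor `n²`, and still leaves `(y/8)²`. -/
lemma card_bound (n : ℕ) (hn : 2 ≤ n) {X : ℝ} (hX : Real.log 48 ≤ X) :
    Real.exp (-(n ^ 2 * X)) * (n * 2 ^ n) * n ^ 2 ≤ (Real.exp (-X) / 8) ^ 2 := by
  obtain ⟨k, rfl⟩ := Nat.exists_eq_add_of_le hn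
  set y := Real.exp (-X) with hy
  have hy0 : 0 < y := Real.exp_pos _
  have hy1 : y ≤ 1 / 48 := by
    rw [hy, Real.exp_neg, one_div]
    refine inv_anti₀ (by norm_num) ?_
    rw [← Real.log_le_iff_le_exp (by norm_num)]
    exact hX
  have hexp : Real.exp (-(((2 + k : ℕ) : ℝ) ^ 2 * X)) = y ^ (2 + k) ^ 2 := by
    rw [hy, ← Real.exp_nat_mul]
    congr 1
    push_cast
    ring
  -- Dropping `k²` from `(2 + k)²` leaves four powers of `y` for each factor `16` that must be
  -- compensated.
  have hle : y ^ (2 + k) ^ 2 ≤ y ^ (4 + 4 * k) := by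
    refine pow_le_pow_of_le_one hy0.le (hy1.trans (by norm_num)) ?_
    nlinarith [Nat.zero_le (k * k)]
  have hk : ((2 + k : ℕ) : ℝ) ≤ 2 * 2 ^ k := by
    have : 2 + k ≤ 2 * 2 ^ k := by
      have := Nat.lt_two_pow_self (n := k)
      omega
    exact_mod_cast this
  have h16 : (16 * y ^ 4) ^ k ≤ 1 := by
    refine pow_le_one₀ (by positivity) ?_
    have : y ^ 4 ≤ (1 / 48) ^ 4 := by gcongr
    nlinarith
  have hy2 : y ^ 2 ≤ (1 / 48) ^ 2 := by gcongr
  calc _ ≤ y ^ (4 + 4 * k) * ((2 * 2 ^ k) * 2 ^ (2 + k)) * (2 * 2 ^ k) ^ 2 := by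
        rw [hexp]
        gcongr
    _ = 32 * y ^ 4 * (16 * y ^ 4) ^ k := by
        have h1 : (2 : ℝ) ^ (2 + k) = 4 * 2 ^ k := by rw [pow_add]; norm_num
        have h2 : (16 : ℝ) ^ k = (2 ^ k) ^ 4 := by
          rw [← pow_mul, mul_comm k, pow_mul]
          norm_num
        rw [mul_pow 16, h1, h2, pow_add, pow_mul]
        ring
    _ ≤ 32 * y ^ 4 := mul_le_of_le_one_right (by positivity) h16
    _ ≤ (y / 8) ^ 2 := by
        have : 32 * y ^ 4 = 32 * y ^ 2 * y ^ 2 := by ring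
        rw [this, div_pow]
        nlinarith [sq_nonneg y]

/-- The error is multiplied by `n` because conditioning on an even final state divides by a
probability of order `1/n`. The fourth power of `n` in `hT` is `n²` from the Poincaré constant times
`n²` from `card_bound`. -/
lemma card_mul_abs_avg_sub_le (hG : G.Connected) (h3 : G.maxDegree ≤ 3)
    (hn : 2 ≤ Fintype.card V) (hd : ∀ v, 0 < G.degree v)
    (hx : ∀ e ∈ G.edgeFinset, 0 < B.edgeWeight e ^ β ∧ B.edgeWeight e ^ β ≤ 1)
    (g : Finset (Sym2 V) → ℝ) (hg : ∀ F ∈ worms G, |g F| ≤ 1) (T : ℕ) {X : ℝ}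
    (hX : Real.log 48 ≤ X)
    (hT : 4 * G.maxDegree * G.edgeFinset.card * Fintype.card V ^ 4 * X ≤ T) :
    Fintype.card V * |(Timed.iterate (B.wormStep β) T ∅).law.avg g - B.wormMean β g| ≤
      Real.exp (-X) / 8 := by
  have h := sq_avg_iterate_sub_le h3 hd hx g hg T (s := Fintype.card V ^ 2 * X)
    (le_trans (le_of_eq (by ring)) hT)
  refine abs_le_of_sq_le_sq' ?_ (by positivity) |>.2
  rw [mul_pow, sq_abs, mul_comm]
  calc _ ≤ Real.exp (-(Fintype.card V ^ 2 * X)) *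
        (Fintype.card V * (withOdd G ∅).card) * (Fintype.card V : ℝ) ^ 2 := by gcongr
    _ ≤ Real.exp (-(Fintype.card V ^ 2 * X)) *
        (Fintype.card V * 2 ^ Fintype.card V) * (Fintype.card V : ℝ) ^ 2 := by
        have := card_loops_le hG h3 hn
        gcongr
    _ ≤ _ := card_bound _ hn hX

/-! ### The rejection sampler -/

/-- The average of `g` over the 2-regular loops with the weights `∏ w(e) ^ β`. -/
def loopMean (B : BPModel G) (β : ℝ) (g : Finset (Sym2 V) → ℝ) : ℝ :=
  (∑ F ∈ twoLoops G, edgeProd (fun e => B.edgeWeight e ^ β) F * g F) /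
    ∑ F ∈ twoLoops G, edgeProd (fun e => B.edgeWeight e ^ β) F

lemma avg_sampleLoop_succ (T N : ℕ) (g : Finset (Sym2 V) → ℝ) :
    (B.sampleLoop β T (N + 1)).law.avg g = (Timed.iterate (B.wormStep β) T ∅).law.avg fun F =>
      if IsTwoRegular F then g F else (B.sampleLoop β T N).law.avg g := by
  rw [sampleLoop, Timed.law_bind, PMF.avg_bind]
  congr 1
  funext F
  rw [Timed.law_bind, testTwoRegular, Timed.law_charge, PMF.pure_bind]
  by_cases h : IsTwoRegular F <;> simp [h, Timed.law_ret, PMF.avg_pure]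

/-- The chain started at `∅` stays among the worms. This is the `L²` estimate with rate `γ = 0`,
which needs no Poincaré inequality and has right-hand side zero here. -/
lemma avg_iterate_eq_zero (h3 : G.maxDegree ≤ 3) (hd : ∀ v, 0 < G.degree v)
    (hx : ∀ e ∈ G.edgeFinset, 0 < B.edgeWeight e ^ β ∧ B.edgeWeight e ^ β ≤ 1)
    (g : Finset (Sym2 V) → ℝ) (hg : ∀ F ∈ worms G, g F = 0) (T : ℕ) :
    (Timed.iterate (B.wormStep β) T ∅).law.avg g = 0 := by
  set C := B.wormChain h3 hd β fun e he => (hx e he).1 with hC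
  have h0 : C.wt ∅ = Fintype.card V := by
    simp [hC, wormChain, empty_mem_worms, ends, oddVerts_empty, edgeProd]
  have hn0 : (0 : ℝ) < Fintype.card V := by exact_mod_cast Fintype.card_pos
  have hwt1 : ∀ φ : Finset (Sym2 V) → ℝ, ∑ F, C.wt F * φ F =
      ∑ F ∈ worms G, ends F * edgeProd (fun e => B.edgeWeight e ^ β) F * φ F :=
    fun φ => sum_wormWeight _ φ
  have hd0 : ∀ f, 0 ≤ C.dirichlet f := by
    intro f
    refine div_nonneg (sum_nonneg fun F _ => sum_nonneg fun p hp => ?_) zero_le_two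
    by_cases hF : C.wt F = 0
    · simp [hF]
    · exact mul_nonneg (mul_nonneg (C.wt_nonneg F) (C.rate_nonneg F hF p hp)) (sq_nonneg _)
  have main := C.sq_iterate_sub_le (γ := 0) zero_le_one (fun f _ => by simpa using hd0 f) g T ∅ (by
      have := hwt1 fun _ => 1
      simp only [mul_one] at this
      rw [this]
      exact sum_worms_pos fun e he => (hx e he).1)
  have hz (k : ℕ) (hk : k ≠ 0) : ∑ F ∈ worms G,
      ends F * edgeProd (fun e => B.edgeWeight e ^ β) F * g F ^ k = 0 :=
    sum_eq_zero fun F hF => by rw [hg F hF, zero_pow hk, mul_zero]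
  have hz1 := hz 1 one_ne_zero
  simp only [pow_one] at hz1
  rw [h0, hwt1, hwt1, hz1, hz 2 two_ne_zero, zero_div, sub_zero, mul_zero] at main
  rw [Timed.avg_iterate]
  exact pow_eq_zero_iff two_ne_zero |>.1
    (le_antisymm (nonpos_of_mul_nonpos_right main hn0) (sq_nonneg _))

lemma avg_sampleLoop_notMem (h3 : G.maxDegree ≤ 3) (hd : ∀ v, 0 < G.degree v)
    (hx : ∀ e ∈ G.edgeFinset, 0 < B.edgeWeight e ^ β ∧ B.edgeWeight e ^ β ≤ 1) (T N : ℕ) :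
    (B.sampleLoop β T N).law.avg (fun F => if F ∈ twoLoops G then (0 : ℝ) else 1) = 0 := by
  induction N with
  | zero =>
    have : ∅ ∈ twoLoops G := by
      rw [twoLoops_eq h3, mem_withOdd]
      exact ⟨empty_subset _, oddVerts_empty⟩
    rw [sampleLoop, Timed.law_ret, PMF.avg_pure, if_pos this]
  | succ N ih =>
    rw [avg_sampleLoop_succ]
    refine avg_iterate_eq_zero h3 hd hx _ (fun H hH => ?_) T
    split_ifs with h1 h2
    · rfl
    · exact absurd (mem_filter.2 ⟨mem_powerset.2 (mem_worms.1 hH).1, h1⟩) h2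
    · exact ih

/-- Chernoff's bound needs sample values in `[0, 1]`, which is known only for the weights of loops.
-/
lemma mem_twoLoops_of_law_sampleLoop (h3 : G.maxDegree ≤ 3) (hd : ∀ v, 0 < G.degree v)
    (hx : ∀ e ∈ G.edgeFinset, 0 < B.edgeWeight e ^ β ∧ B.edgeWeight e ^ β ≤ 1) (T N : ℕ)
    {F : Finset (Sym2 V)} (hF : (B.sampleLoop β T N).law F ≠ 0) : F ∈ twoLoops G :=
  by_contra fun hnot => hF (PMF.apply_eq_zero_of_avg _ (fun a => by split_ifs <;> norm_num)
    (avg_sampleLoop_notMem h3 hd hx T N) (by simp [hnot]))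

/-- Let `q` be the probability that a trial ends in a loop and `c` the mean of `g - μ` on that
event. The bias obeys `err (N+1) = c + (1 - q) * err N`, hence `|err N| ≤ |c|/q + (1 - q)^N`. Mixing
makes `n * |c|` small and `n * q` nearly at least one. -/
lemma avg_sampleLoop (hG : G.Connected) (h3 : G.maxDegree ≤ 3)
    (hn : 2 ≤ Fintype.card V) (hd : ∀ v, 0 < G.degree v)
    (hx : ∀ e ∈ G.edgeFinset, 0 < B.edgeWeight e ^ β ∧ B.edgeWeight e ^ β ≤ 1)
    (g : Finset (Sym2 V) → ℝ) (hg : ∀ F ∈ twoLoops G, 0 ≤ g F ∧ g F ≤ 1) (T N : ℕ) {X : ℝ}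
    (hX : Real.log 48 ≤ X)
    (hT : 4 * G.maxDegree * G.edgeFinset.card * Fintype.card V ^ 4 * X ≤ T)
    (hN : 1.2 * Fintype.card V * (X + Real.log 3) ≤ N) :
    |(B.sampleLoop β T N).law.avg g - B.loopMean β g| ≤ Real.exp (-X) / 2 := by
  set x : Sym2 V → ℝ := fun e => B.edgeWeight e ^ β with hxdef
  have hx0 : ∀ e ∈ G.edgeFinset, 0 < x e := fun e he => (hx e he).1
  have hZ : 0 < oddSum G x ∅ := oddSum_empty_pos x hx
  have hn0 : (0 : ℝ) < Fintype.card V := by exact_mod_cast Fintype.card_pos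
  have hsum : ∑ F ∈ twoLoops G, edgeProd x F = oddSum G x ∅ := by rw [twoLoops_eq h3, oddSum]
  set μ := B.loopMean β g with hμ
  have hμeq : ∑ F ∈ twoLoops G, edgeProd x F * g F = μ * oddSum G x ∅ := by
    rw [hμ, loopMean, hsum, div_mul_cancel₀ _ hZ.ne']
  have hep : ∀ F ∈ twoLoops G, 0 ≤ edgeProd x F := fun F hF =>
    (edgeProd_pos_of_subset hx0 (mem_powerset.1 (mem_filter.1 hF).1)).le
  have hμ0 : 0 ≤ μ := by
    refine nonneg_of_mul_nonneg_left (hμeq ▸ sum_nonneg fun F hF => ?_) hZ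
    exact mul_nonneg (hep F hF) (hg F hF).1
  have hμ1 : μ ≤ 1 := by
    refine le_of_mul_le_mul_right ?_ hZ
    rw [← hμeq, one_mul, ← hsum]
    exact sum_le_sum fun F hF => mul_le_of_le_one_right (hep F hF) (hg F hF).2
  set p := (Timed.iterate (B.wormStep β) T ∅).law with hp
  have hreg : ∀ F ∈ worms G, IsTwoRegular F → F ∈ twoLoops G := fun F hF h =>
    mem_filter.2 ⟨mem_powerset.2 (mem_worms.1 hF).1, h⟩
  have hsub : twoLoops G ⊆ worms G := by
    intro F hF
    rw [twoLoops_eq h3, mem_withOdd] at hF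
    exact mem_worms.2 ⟨hF.1, Or.inl (by rw [hF.2]; rfl)⟩
  have hrestrict : ∀ φ : Finset (Sym2 V) → ℝ,
      ∑ F ∈ worms G, ends F * edgeProd x F * (if IsTwoRegular F then φ F else 0) =
        Fintype.card V * ∑ F ∈ twoLoops G, edgeProd x F * φ F := by
    intro φ
    rw [← sum_subset hsub, mul_sum]
    · refine sum_congr rfl fun F hF => ?_
      rw [if_pos (mem_filter.1 hF).2, ends, if_pos]
      · ring
      · rw [twoLoops_eq h3, mem_withOdd] at hF
        exact hF.2
    · intro F hF hF'
      rw [if_neg (fun h => hF' (hreg F hF h)), mul_zero]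
  set y := Real.exp (-X) with hy
  have hy0 : 0 < y := Real.exp_pos _
  have hy1 : y ≤ 1 / 48 := by
    rw [hy, Real.exp_neg, one_div]
    refine inv_anti₀ (by norm_num) ?_
    rw [← Real.log_le_iff_le_exp (by norm_num)]
    exact hX
  set q := p.avg fun F => if IsTwoRegular F then (1 : ℝ) else 0 with hq
  have hq1 : q ≤ 1 := by
    rw [← PMF.avg_const p 1]
    exact PMF.avg_mono p fun F _ => by split_ifs <;> norm_num
  have hqn : 1 - y / 8 ≤ Fintype.card V * q := by
    have h1 := card_mul_abs_avg_sub_le hG h3 hn hd hx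
      (fun F => if IsTwoRegular F then (1 : ℝ) else 0)
      (fun F _ => by split_ifs <;> norm_num) T hX hT
    -- In equilibrium the loops have weight `n * oddSum G x ∅` out of at most `n² * oddSum G x ∅`.
    have h2 : 1 ≤ Fintype.card V *
        B.wormMean β (fun F => if IsTwoRegular F then (1 : ℝ) else 0) := by
      rw [wormMean, hrestrict fun _ => 1]
      simp only [mul_one]
      rw [hsum, ← mul_div_assoc, le_div_iff₀ (sum_worms_pos hx0), one_mul]
      refine (sum_worms_le hx).trans (le_of_eq (by ring))
    have h3 := (abs_le.1 ((abs_mul _ _).trans_le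
      ((mul_le_mul_of_nonneg_right (abs_of_pos hn0).le (abs_nonneg _)).trans h1))).1
    rw [← hp, ← hq, mul_sub] at h3
    linarith
  have hq0 : 0 < q := by
    refine pos_of_mul_pos_right (a := (Fintype.card V : ℝ)) ?_ hn0.le
    linarith
  set c := p.avg fun F => if IsTwoRegular F then g F - μ else 0 with hc
  have hcn : Fintype.card V * |c| ≤ y / 8 := by
    have h1 := card_mul_abs_avg_sub_le hG h3 hn hd hx
      (fun F => if IsTwoRegular F then g F - μ else 0) (fun F hF => by
        split_ifs with h
        · have := hg F (hreg F hF h)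
          rw [abs_le]
          constructor <;> linarith
        · simp) T hX hT
    -- `ends` is constant on loops, so equilibrium restricted to them is proportional to the loop
    -- weights, and `μ` is its mean.
    have h2 : B.wormMean β (fun F => if IsTwoRegular F then g F - μ else 0) = 0 := by
      rw [wormMean, hrestrict fun F => g F - μ]
      simp only [mul_sub, sum_sub_distrib, ← sum_mul]
      rw [hμeq, hsum]
      ring
    rwa [h2, sub_zero, ← hp, ← hc] at h1
  have hrec : ∀ N, (B.sampleLoop β T (N + 1)).law.avg g - μ =
      c + (1 - q) * ((B.sampleLoop β T N).law.avg g - μ) := by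
    intro N
    rw [avg_sampleLoop_succ, ← hp]
    set a := (B.sampleLoop β T N).law.avg g with ha
    have h1 : ∀ F : Finset (Sym2 V), (if IsTwoRegular F then g F else a) =
        (if IsTwoRegular F then g F - μ else 0) +
          (a - (a - μ) * if IsTwoRegular F then 1 else 0) := by
      intro F
      split_ifs <;> ring
    simp only [h1]
    rw [PMF.avg_add, PMF.avg_sub, PMF.avg_const, PMF.avg_mul_left, ← hc, ← hq]
    ring
  have hind : ∀ N, |(B.sampleLoop β T N).law.avg g - μ| ≤ |c| / q + (1 - q) ^ N := by
    intro N
    induction N with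
    | zero =>
      have h0 : ∅ ∈ twoLoops G := by
        rw [twoLoops_eq h3, mem_withOdd]
        exact ⟨empty_subset _, oddVerts_empty⟩
      rw [sampleLoop, Timed.law_ret, PMF.avg_pure, pow_zero]
      have h1 := hg ∅ h0
      have h2 : |g ∅ - μ| ≤ 1 := by
        rw [abs_le]
        constructor <;> linarith
      have h3 : 0 ≤ |c| / q := by positivity
      linarith
    | succ N ih =>
      rw [hrec]
      calc _ ≤ |c| + |(1 - q) * ((B.sampleLoop β T N).law.avg g - μ)| := abs_add_le _ _
        _ ≤ |c| + (1 - q) * (|c| / q + (1 - q) ^ N) := by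
            rw [abs_mul, abs_of_nonneg (by linarith : 0 ≤ 1 - q)]
            have : 0 ≤ 1 - q := by linarith
            gcongr
        _ = _ := by
            field_simp
            ring
  refine (hind N).trans ?_
  have hA : |c| / q ≤ y * (1 / 7) := by
    rw [div_le_iff₀ hq0]
    refine le_of_mul_le_mul_left (hcn.trans ?_) hn0
    nlinarith
  -- The factor `1.2` outweighs the loss `1 - y/8`, and `log 3` provides the third; together `1/7 +
  -- 1/3 ≤ 1/2`.
  have hB : (1 - q) ^ N ≤ y / 3 := by
    have hqN : X + Real.log 3 ≤ q * N := by
      have hlog : 0 ≤ X + Real.log 3 := by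
        have := Real.log_nonneg (by norm_num : (1 : ℝ) ≤ 48)
        have := Real.log_nonneg (by norm_num : (1 : ℝ) ≤ 3)
        linarith
      calc X + Real.log 3 ≤ 1.2 * (1 - y / 8) * (X + Real.log 3) :=
            le_mul_of_one_le_left hlog (by norm_num; linarith)
        _ ≤ 1.2 * (Fintype.card V * q) * (X + Real.log 3) := by gcongr
        _ = q * (1.2 * Fintype.card V * (X + Real.log 3)) := by ring
        _ ≤ q * N := by gcongr
    calc (1 - q) ^ N ≤ Real.exp (-q) ^ N := by
          refine pow_le_pow_left₀ (by linarith) ?_ N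
          linarith [Real.add_one_le_exp (-q)]
      _ = Real.exp (-(q * N)) := by
          rw [← Real.exp_nat_mul]
          congr 1
          ring
      _ ≤ Real.exp (-(X + Real.log 3)) := by gcongr
      _ = y / 3 := by
          rw [neg_add, Real.exp_add, Real.exp_neg (Real.log 3), Real.exp_log (by norm_num)]
          rfl
  linarith

end BPModel

/-! ## Beliefs, edge weights and loop weights -/

namespace BPModel

variable {V : Type*} [Fintype V] [DecidableEq V] {G : SimpleGraph V} [DecidableRel G.Adj]
  (B : BPModel G)

lemma belE_nonneg (u v : V) (x y : Bool) : 0 ≤ B.belE u v x y :=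
  mul_nonneg (B.psiE_nonneg u v x y) (mul_nonneg
    (mul_nonneg (B.psiV_nonneg u x) (prod_nonneg fun w _ => B.msg_nonneg w u x))
    (mul_nonneg (B.psiV_nonneg v y) (prod_nonneg fun w _ => B.msg_nonneg w v y)))

lemma tauE_nonneg (u v : V) (x y : Bool) : 0 ≤ B.tauE u v x y :=
  div_nonneg (B.belE_nonneg u v x y)
    (sum_nonneg fun x' _ => sum_nonneg fun y' _ => B.belE_nonneg u v x' y')

/-- The edge belief omits the message from `u` to `v`, and summing out the state of `u` restores it
by the fixed-point equation. Normalizing then removes `c`, so the pair marginals are consistent with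
the vertex marginals. -/
lemma sum_belE {u v : V} (h : G.Adj u v) :
    ∃ c > 0, ∀ y, c * ∑ x, B.belE u v x y = B.belV v y := by
  obtain ⟨c, hc, hfix⟩ := B.fixed_point u v h
  refine ⟨c, hc, fun y => ?_⟩
  have hu : u ∈ G.neighborFinset v := by simpa using h.symm
  rw [belV, ← mul_prod_erase _ _ hu, hfix y]
  simp only [belE, mul_sum, sum_mul]
  exact sum_congr rfl fun x _ => by ring

lemma sum_tauE {u v : V} (h : G.Adj u v) (y : Bool) : ∑ x, B.tauE u v x y = B.tauV v y := by
  obtain ⟨c, hc, hsum⟩ := B.sum_belE h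
  simp only [tauE, tauV, ← sum_div]
  rw [sum_comm, ← hsum y]
  simp only [← hsum, ← mul_sum]
  rw [mul_div_mul_left _ _ hc.ne']

lemma sum_tauV {v : V} (h : 0 < B.tauV v true) : ∑ x, B.tauV v x = 1 := by
  simp only [tauV, ← sum_div]
  refine div_self fun h0 => ?_
  rw [tauV, h0, div_zero] at h
  exact lt_irrefl _ h

lemma edgeWeight_mk (u v : V) : B.edgeWeight s(u, v) =
    |(B.tauE u v true true - B.tauV u true * B.tauV v true) /
      √(B.tauV u true * B.tauV v true * (1 - B.tauV u true) * (1 - B.tauV v true))| := rfl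

/-- `τ_{u,v}` is a coupling of two Bernoulli laws, so its covariance satisfies the Fréchet bounds
`max 0 (p + q - 1) ≤ a ≤ min p q`. For either sign, multiplying two bounds for `|a - p * q|` gives
the product of the variances. -/
lemma edgeWeight_le_one (hτ : ∀ v, 0 < B.tauV v true ∧ B.tauV v true < 1) {e : Sym2 V}
    (he : e ∈ G.edgeFinset) : B.edgeWeight e ≤ 1 := by
  induction e using Sym2.ind with
  | _ u v =>
    have huv : G.Adj u v := by simpa using he
    obtain ⟨hp0, hp1⟩ := hτ u
    obtain ⟨hq0, hq1⟩ := hτ v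
    have h1 := B.sum_tauE huv true
    have h2 := B.sum_tauE huv.symm true
    have h3 := B.sum_tauE huv false
    have h4 := B.sum_tauV hq0
    simp only [Fintype.sum_bool, B.tauE_symm v u] at h1 h2 h3 h4
    have n1 := B.tauE_nonneg u v true true
    have n2 := B.tauE_nonneg u v true false
    have n3 := B.tauE_nonneg u v false true
    have n4 := B.tauE_nonneg u v false false
    rw [edgeWeight_mk]
    set p := B.tauV u true
    set q := B.tauV v true
    set a := B.tauE u v true true
    have hD : 0 < p * q * (1 - p) * (1 - q) :=
      mul_pos (mul_pos (mul_pos hp0 hq0) (sub_pos.2 hp1)) (sub_pos.2 hq1)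
    rw [abs_div, abs_of_pos (Real.sqrt_pos.2 hD), div_le_one (Real.sqrt_pos.2 hD)]
    refine Real.abs_le_sqrt ?_
    have hap : a ≤ p := by linarith
    have haq : a ≤ q := by linarith
    have hpq : p + q - 1 ≤ a := by linarith
    rcases le_total (p * q) a with h | h
    · have e1 : a - p * q ≤ p * (1 - q) := by linarith
      have e2 : a - p * q ≤ q * (1 - p) := by linarith
      have := mul_le_mul e1 e2 (by linarith) (mul_nonneg hp0.le (by linarith))
      linarith
    · have e1 : p * q - a ≤ p * q := by linarith
      have e2 : p * q - a ≤ (1 - p) * (1 - q) := by linarith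
      have := mul_le_mul e1 e2 (by linarith) (mul_nonneg hp0.le hq0.le)
      linarith

lemma wmin_le {e : Sym2 V} (he : e ∈ G.edgeFinset) : B.wmin ≤ B.edgeWeight e :=
  ciInf_le (f := fun e : G.edgeSet => B.edgeWeight e) (Set.finite_range _).bddBelow
    ⟨e, by simpa using he⟩

/-- A real infimum over the empty type is `0`. Thus `0 < wmin` already forces an edge, and with it
`n ≥ 2`. -/
lemma edgeFinset_nonempty_of_wmin (h : 0 < B.wmin) : G.edgeFinset.Nonempty := by
  by_contra hne
  have : IsEmpty G.edgeSet := by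
    rw [not_nonempty_iff_eq_empty] at hne
    refine ⟨fun e => ?_⟩
    have : (e : Sym2 V) ∈ G.edgeFinset := by simp
    rw [hne] at this
    simp at this
  rw [wmin, Real.iInf_of_isEmpty] at h
  exact lt_irrefl _ h

lemma loopWeight_empty : B.loopWeight ∅ = 1 := by
  simp [loopWeight, degIn]

lemma prod_endpoint (f : V → ℝ) {F : Finset (Sym2 V)} (hF : F ⊆ G.edgeFinset) :
    ∏ v, f v ^ degIn F v =
      ∏ e ∈ F, Sym2.lift ⟨fun u v => f u * f v, fun _ _ => mul_comm _ _⟩ e := by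
  have h1 : ∀ v, f v ^ degIn F v = ∏ e ∈ F, if v ∈ e then f v else 1 := by
    intro v
    rw [← prod_filter, prod_const, degIn]
  simp only [h1]
  rw [prod_comm]
  refine prod_congr rfl fun e he => ?_
  induction e using Sym2.ind with
  | _ a b =>
    have hab : a ≠ b := ne_of_mem_edgeFinset (hF he)
    rw [← prod_filter, Sym2.lift_mk]
    have : univ.filter (fun v => v ∈ s(a, b)) = {a, b} := by
      ext v
      simp
    rw [this, prod_pair hab]

/-- At degree two the vertex factor equals `τ/(1-τ)`, the inverse square of `f v`. `prod_endpoint`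
distributes it over the two incident edges, where it turns `τ_{u,v}/(τ_u τ_v) - 1` into the
correlation coefficient. -/
lemma abs_loopWeight (hτ : ∀ v, 0 < B.tauV v true ∧ B.tauV v true < 1) {F : Finset (Sym2 V)}
    (hF : F ∈ twoLoops G) : |B.loopWeight F| = edgeProd B.edgeWeight F := by
  obtain ⟨hFE, hreg⟩ := mem_filter.1 hF
  rw [mem_powerset] at hFE
  set f : V → ℝ := fun v => √(B.tauV v true * (1 - B.tauV v true)) / B.tauV v true with hf
  have hvert : ∏ v ∈ univ.filter (fun v => 0 < degIn F v), B.vertexFactor (degIn F v) v =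
      ∏ v, (f v)⁻¹ ^ degIn F v := by
    rw [prod_filter]
    refine prod_congr rfl fun v _ => ?_
    obtain ⟨h0, h1⟩ := hτ v
    rcases hreg v with h | h
    · rw [h]
      simp
    · have h2 : 1 - B.tauV v true ≠ 0 := by linarith
      have hfv : f v ^ 2 = (1 - B.tauV v true) / B.tauV v true := by
        simp only [hf, div_pow]
        rw [Real.sq_sqrt (mul_nonneg h0.le (by linarith))]
        field_simp
      rw [h, if_pos two_pos, vertexFactor, inv_pow, hfv, inv_div, eq_div_iff h2, neg_one_sq, one_mul,
        show 2 - 1 = 1 from rfl, pow_one]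
      linear_combination B.tauV v true * div_mul_cancel₀ (B.tauV v true) h2
  rw [loopWeight, hvert, prod_endpoint _ hFE, ← prod_mul_distrib, abs_prod, edgeProd]
  refine prod_congr rfl fun e _ => ?_
  induction e using Sym2.ind with
  | _ u v =>
    obtain ⟨hp0, hp1⟩ := hτ u
    obtain ⟨hq0, hq1⟩ := hτ v
    rw [edgeWeight_mk, Sym2.lift_mk]
    change |(B.tauE u v true true / (B.tauV u true * B.tauV v true) - 1) *
      ((f u)⁻¹ * (f v)⁻¹)| = _
    congr 1
    simp only [hf]
    set p := B.tauV u true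
    set q := B.tauV v true
    have hs : √(p * q * (1 - p) * (1 - q)) = √(p * (1 - p)) * √(q * (1 - q)) := by
      rw [← Real.sqrt_mul (mul_nonneg hp0.le (by linarith))]
      congr 1
      ring
    have h1 : √(p * (1 - p)) ≠ 0 := (Real.sqrt_pos.2 (mul_pos hp0 (by linarith))).ne'
    have h2 : √(q * (1 - q)) ≠ 0 := (Real.sqrt_pos.2 (mul_pos hq0 (by linarith))).ne'
    rw [hs]
    field_simp

lemma empty_mem_twoLoops : ∅ ∈ twoLoops G := by
  simp [twoLoops, IsTwoRegular, degIn]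

lemma Zabs_pos : 0 < B.Zabs :=
  sum_pos' (fun _ _ => abs_nonneg _) ⟨∅, empty_mem_twoLoops, by rw [loopWeight_empty]; norm_num⟩

lemma zeta_nonneg : 0 ≤ B.zeta :=
  sum_nonneg fun _ _ => div_nonneg (abs_nonneg _) B.Zabs_pos.le

/-- Termwise: a signed weight is its absolute value, minus twice that value when it is negative. -/
lemma Z_eq : B.Z = (1 - 2 * B.zeta) * B.Zabs := by
  have hz : B.zeta * B.Zabs = ∑ F ∈ twoLoops G, if B.loopWeight F < 0 then |B.loopWeight F| else 0 := by
    rw [zeta, sum_mul, sum_filter]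
    refine sum_congr rfl fun F _ => ?_
    split_ifs
    · exact div_mul_cancel₀ _ B.Zabs_pos.ne'
    · rfl
  have : (1 - 2 * B.zeta) * B.Zabs = B.Zabs - 2 * (B.zeta * B.Zabs) := by ring
  rw [this, hz, Z, Zabs, mul_sum, ← sum_sub_distrib]
  refine sum_congr rfl fun F _ => ?_
  split_ifs with h
  · rw [abs_of_neg h]
    ring
  · rw [abs_of_nonneg (not_lt.1 h)]
    ring

/-- Double counting of incidences: `2|F|` is a sum of `n` degrees, each at most two. -/
lemma card_le_of_mem_twoLoops {F : Finset (Sym2 V)} (hF : F ∈ twoLoops G) :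
    F.card ≤ Fintype.card V := by
  obtain ⟨hFE, hreg⟩ := mem_filter.1 hF
  rw [mem_powerset] at hFE
  have h := sum_card_bipartiteAbove_eq_sum_card_bipartiteBelow (s := (univ : Finset V)) (t := F)
    (fun v e => v ∈ e)
  have h1 : ∑ v : V, (F.filter fun e => v ∈ e).card ≤ ∑ _v : V, 2 := by
    refine sum_le_sum fun v _ => ?_
    rcases hreg v with h | h <;> (unfold degIn at h; omega)
  have h2 : ∑ e ∈ F, (univ.filter fun v : V => v ∈ e).card = ∑ _e ∈ F, 2 := by
    refine sum_congr rfl fun e he => ?_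
    induction e using Sym2.ind with
    | _ a b =>
      have : univ.filter (fun v => v ∈ s(a, b)) = {a, b} := by
        ext v
        simp
      rw [this, card_pair (ne_of_mem_edgeFinset (hFE he))]
  simp only [bipartiteAbove, bipartiteBelow] at h
  rw [h, h2] at h1
  simp only [sum_const, card_univ, smul_eq_mul] at h1
  omega

end BPModel

/-! ## Accuracy of the estimator -/

namespace PMF

lemma one_sub_le_toOuterMeasure {α : Type*} (p : PMF α) (S : Set α) {ν : ℝ} (hν : 0 ≤ ν)
    (h : p.toOuterMeasure Sᶜ ≤ ENNReal.ofReal ν) : 1 - ν ≤ (p.toOuterMeasure S).toReal := by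
  have h1 : 1 ≤ p.toOuterMeasure S + p.toOuterMeasure Sᶜ := by
    rw [toOuterMeasure_eq_mean, toOuterMeasure_eq_mean, ← mean_add, ← mean_const p 1]
    refine mean_mono p fun a _ => ?_
    by_cases ha : a ∈ S <;> simp [ha]
  have hfin : p.toOuterMeasure S ≠ ∞ := by
    refine ne_top_of_le_ne_top ENNReal.one_ne_top ?_
    refine (toOuterMeasure_le_mean p S (fun _ => 1) fun _ _ => le_rfl).trans ?_
    rw [mean_const]
  have h2 : 1 ≤ p.toOuterMeasure S + ENNReal.ofReal ν := h1.trans (by gcongr)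
  have h3 := ENNReal.toReal_mono (ENNReal.add_ne_top.2 ⟨hfin, ENNReal.ofReal_ne_top⟩) h2
  rw [ENNReal.toReal_add hfin ENNReal.ofReal_ne_top, ENNReal.toReal_ofReal hν,
    ENNReal.toReal_one] at h3
  linarith

end PMF

namespace BPModel

variable {V : Type*} [Fintype V] [DecidableEq V] {G : SimpleGraph V} [DecidableRel G.Adj]
  [Nonempty V] (B : BPModel G)

lemma two_le_card (hw : 0 < B.wmin) : 2 ≤ Fintype.card V := by
  obtain ⟨e, he⟩ := B.edgeFinset_nonempty_of_wmin hw
  induction e using Sym2.ind with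
  | _ u v =>
    exact Fintype.one_lt_card_iff.2 ⟨u, v, ne_of_mem_edgeFinset he⟩

lemma degree_pos (hG : G.Connected) (hw : 0 < B.wmin) (v : V) : 0 < G.degree v := by
  have : Nontrivial V := Fintype.one_lt_card_iff_nontrivial.1 (B.two_le_card hw)
  exact hG.preconnected.degree_pos_of_nontrivial v

lemma wmin_le_one (hτ : ∀ v, 0 < B.tauV v true ∧ B.tauV v true < 1) (hw : 0 < B.wmin) :
    B.wmin ≤ 1 := by
  obtain ⟨e, he⟩ := B.edgeFinset_nonempty_of_wmin hw
  exact (B.wmin_le he).trans (B.edgeWeight_le_one hτ he)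

lemma edgeWeight_rpow (hτ : ∀ v, 0 < B.tauV v true ∧ B.tauV v true < 1) (hw : 0 < B.wmin)
    {β : ℝ} (hβ : 0 ≤ β) :
    ∀ e ∈ G.edgeFinset, 0 < B.edgeWeight e ^ β ∧ B.edgeWeight e ^ β ≤ 1 := fun e he => by
  have h := hw.trans_le (B.wmin_le he)
  exact ⟨Real.rpow_pos_of_pos h β, Real.rpow_le_one h.le (B.edgeWeight_le_one hτ he) hβ⟩

lemma edgeProd_rpow (hτ : ∀ v, 0 < B.tauV v true ∧ B.tauV v true < 1)
    (β : ℝ) {F : Finset (Sym2 V)} (hF : F ∈ twoLoops G) :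
    edgeProd (fun e => B.edgeWeight e ^ β) F = |B.loopWeight F| ^ β := by
  rw [B.abs_loopWeight hτ hF, edgeProd, edgeProd]
  refine Real.finsetProd_rpow _ _ (fun e _ => ?_) β
  induction e using Sym2.ind with
  | _ u v => exact abs_nonneg _

lemma abs_loopWeight_pos (hτ : ∀ v, 0 < B.tauV v true ∧ B.tauV v true < 1) (hw : 0 < B.wmin)
    {F : Finset (Sym2 V)} (hF : F ∈ twoLoops G) : 0 < |B.loopWeight F| := by
  rw [B.abs_loopWeight hτ hF]
  exact edgeProd_pos_of_subset (fun e he => hw.trans_le (B.wmin_le he))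
    (mem_powerset.1 (mem_filter.1 hF).1)

lemma abs_loopWeight_le_one (hτ : ∀ v, 0 < B.tauV v true ∧ B.tauV v true < 1) (hw : 0 < B.wmin)
    {F : Finset (Sym2 V)} (hF : F ∈ twoLoops G) : |B.loopWeight F| ≤ 1 := by
  have hFE := mem_powerset.1 (mem_filter.1 hF).1
  rw [B.abs_loopWeight hτ hF]
  exact prod_le_one (fun e he => (hw.trans_le (B.wmin_le (hFE he))).le)
    fun e he => B.edgeWeight_le_one hτ (hFE he)

/-- A loop has at most `n` edges, so cooling in steps of `1/n` keeps every sample value at least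
`wmin`. -/
lemma wmin_le_rpow (hτ : ∀ v, 0 < B.tauV v true ∧ B.tauV v true < 1) (hw : 0 < B.wmin)
    {F : Finset (Sym2 V)} (hF : F ∈ twoLoops G) :
    B.wmin ≤ |B.loopWeight F| ^ ((Fintype.card V : ℝ)⁻¹) := by
  have hFE := mem_powerset.1 (mem_filter.1 hF).1
  have h1 : B.wmin ^ Fintype.card V ≤ |B.loopWeight F| := by
    rw [B.abs_loopWeight hτ hF]
    calc _ ≤ B.wmin ^ F.card :=
          pow_le_pow_of_le_one hw.le (B.wmin_le_one hτ hw) (card_le_of_mem_twoLoops hF)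
      _ = ∏ _e ∈ F, B.wmin := by rw [prod_const]
      _ ≤ _ := prod_le_prod (fun _ _ => hw.le) fun e he => B.wmin_le (hFE he)
  calc B.wmin = (B.wmin ^ Fintype.card V) ^ ((Fintype.card V : ℝ)⁻¹) :=
        (Real.pow_rpow_inv_natCast hw.le Fintype.card_ne_zero).symm
    _ ≤ _ := Real.rpow_le_rpow (pow_nonneg hw.le _) h1 (by positivity)

/-! ### Annealing: partition functions, stage estimates and their combination -/

/-- The annealed partition function of the 2-regular loops. -/
def Zbeta (β : ℝ) : ℝ := ∑ F ∈ twoLoops G, |B.loopWeight F| ^ β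

lemma Zbeta_pos (β : ℝ) : 0 < B.Zbeta β :=
  sum_pos' (fun _ _ => Real.rpow_nonneg (abs_nonneg _) _)
    ⟨∅, empty_mem_twoLoops, by rw [loopWeight_empty]; norm_num⟩

lemma loopMean_eq (hτ : ∀ v, 0 < B.tauV v true ∧ B.tauV v true < 1) (β : ℝ)
    (g : Finset (Sym2 V) → ℝ) :
    B.loopMean β g = (∑ F ∈ twoLoops G, |B.loopWeight F| ^ β * g F) / B.Zbeta β := by
  rw [loopMean, Zbeta]
  congr 1
  · exact sum_congr rfl fun F hF => by rw [B.edgeProd_rpow hτ β hF]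
  · exact sum_congr rfl fun F hF => B.edgeProd_rpow hτ β hF

lemma loopMean_rpow (hτ : ∀ v, 0 < B.tauV v true ∧ B.tauV v true < 1) (hw : 0 < B.wmin)
    (β β' : ℝ) :
    B.loopMean β (fun F => |B.loopWeight F| ^ (β' - β)) = B.Zbeta β' / B.Zbeta β := by
  rw [B.loopMean_eq hτ]
  congr 1
  refine sum_congr rfl fun F hF => ?_
  rw [← Real.rpow_add (B.abs_loopWeight_pos hτ hw hF), add_sub_cancel]

lemma loopMean_neg (hτ : ∀ v, 0 < B.tauV v true ∧ B.tauV v true < 1) :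
    B.loopMean 1 (fun F => if B.loopWeight F < 0 then 1 else 0) = B.zeta := by
  rw [B.loopMean_eq hτ, zeta, sum_filter, sum_div]
  refine sum_congr rfl fun F _ => ?_
  have : B.Zbeta 1 = B.Zabs := by simp [Zbeta, Zabs]
  rw [this]
  split_ifs <;> simp [piLoop]

lemma law_evalWeight (F : Finset (Sym2 V)) :
    (B.evalWeight F).law = PMF.pure (B.loopWeight F) := by
  simp only [evalWeight, Timed.law_bind, Timed.law_prod, Timed.law_filter, Timed.law_charge,
    PMF.pure_bind]
  rfl

lemma edges_add_one_ge (hG : G.Connected) :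
    (Fintype.card V : ℝ) ≤ G.edgeFinset.card + 1 := by
  have h := hG.card_vert_le_card_edgeSet_add_one
  rw [Nat.card_eq_fintype_card, Nat.card_eq_fintype_card, ← G.edgeFinset_card] at h
  exact_mod_cast h

lemma exp_neg_ceil_log_le {a c : ℝ} (ha : 0 < a) (hc : (⌈Real.log a⌉ : ℝ) ≤ c) :
    Real.exp (-c) ≤ a⁻¹ := by
  rw [Real.exp_neg]
  refine inv_anti₀ ha ?_
  rw [← Real.log_le_iff_le_exp ha]
  exact (Int.le_ceil _).trans hc

/-- Statistical error relative to the biased mean, which is at most `193/192 * r`, plus the bias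
itself. -/
lemma relative_error_add {ε n r : ℝ} (hε : 0 < ε) (hn : 0 < n) (hr : 0 < r) :
    ε / (12 * n) * (193 / 192 * r) + ε * r / (96 * n) ≤ ε / (6 * n) * r := by
  have h4 : 0 ≤ ε * r / n := by positivity
  have h5 : ε / (12 * n) * (193 / 192 * r) = 193 / 2304 * (ε * r / n) := by ring
  have h6 : ε * r / (96 * n) = 1 / 96 * (ε * r / n) := by ring
  have h7 : ε / (6 * n) * r = 1 / 6 * (ε * r / n) := by ring
  rw [h5, h6, h7]
  linarith

/-- A relative deviation `ε/(12n)` needs about `n²/(ε² μ)` samples, and `μ ≥ w/2`. The constant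
`18144` leaves a spare factor `63/4`. -/
lemma chernoff_exponent_ge {ε n w μ L s : ℝ} (hε : 0 < ε) (hn : 0 < n) (hw : 0 < w)
    (hμ : w / 2 ≤ μ) (hL : 0 ≤ L) (hs : 18144 * n ^ 2 * (ε ^ 2)⁻¹ * w⁻¹ * L ≤ s) :
    L ≤ s * (ε / (12 * n) * μ) ^ 2 / (4 * μ) := by
  have hμ0 : 0 < μ := by linarith
  have h1 : s * (ε / (12 * n) * μ) ^ 2 / (4 * μ) = s * (ε ^ 2 * μ / (576 * n ^ 2)) := by
    field_simp
    ring
  have hs0 : 0 ≤ s := le_trans (by positivity) hs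
  rw [h1]
  calc L ≤ 18144 * n ^ 2 * (ε ^ 2)⁻¹ * w⁻¹ * L * (ε ^ 2 * (w / 2) / (576 * n ^ 2)) := by
        have h2 : 18144 * n ^ 2 * (ε ^ 2)⁻¹ * w⁻¹ * L * (ε ^ 2 * (w / 2) / (576 * n ^ 2)) =
            63 / 4 * L := by
          field_simp
          ring
        rw [h2]
        linarith
    _ ≤ s * (ε ^ 2 * μ / (576 * n ^ 2)) := by gcongr

lemma abs_mul_sub_one_le {ε a c : ℝ} (hε : 0 < ε) (hε1 : ε ≤ 1) (hc1 : 1 - ε / 3 ≤ c)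
    (hc2 : c ≤ 1 + ε / 3) (ha1 : 1 - ε / 6 ≤ a) (ha2 : a ≤ 1 + ε / 5) : |c * a - 1| ≤ ε := by
  have h1 := mul_le_mul hc1 ha1 (by linarith) (by linarith)
  have h2 := mul_le_mul hc2 ha2 (by linarith) (by linarith)
  have h3 : ε * ε ≤ ε * 1 := by gcongr
  rw [abs_le]
  constructor <;> linarith [mul_pos hε hε]

set_option maxHeartbeats 800000 in
-- Two errors are added: the sampler's bias and the deviation of the empirical mean from the biased
-- mean `μ`. The bias is controlled absolutely by `ε * w / (96 * n)`, and `w ≤ r` turns this into a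
-- relative error.
lemma stage_accuracy (hG : G.Connected) (h3 : G.maxDegree ≤ 3)
    (hτ : ∀ v, 0 < B.tauV v true ∧ B.tauV v true < 1) (hw : 0 < B.wmin) {ε ν : ℝ} (hε : 0 < ε)
    (hε1 : ε ≤ 1) (hν : 0 < ν) (hν1 : ν < 1) {s N T : ℕ}
    (hs : s1Bound (Fintype.card V) ε ν B.wmin ≤ s) (hN : N1Bound (Fintype.card V) ε B.wmin ≤ N)
    (hT : T1Bound (Fintype.card V) G.edgeFinset.card G.maxDegree ε B.wmin ≤ T)
    {β β' : ℝ} (hβ : 0 ≤ β) (hββ : β' - β = (Fintype.card V : ℝ)⁻¹) :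
    (B.stage β β' s N T).law.toOuterMeasure
      {z | ε / (6 * Fintype.card V) * (B.Zbeta β' / B.Zbeta β) <
        |z - B.Zbeta β' / B.Zbeta β|} ≤ ENNReal.ofReal (ν / (3 * Fintype.card V)) := by
  have hn := B.two_le_card hw
  have hd := B.degree_pos hG hw
  have hx := B.edgeWeight_rpow hτ hw hβ
  have hw1 := B.wmin_le_one hτ hw
  set n : ℝ := (Fintype.card V : ℝ) with hndef
  have hn2 : (2 : ℝ) ≤ n := by rw [hndef]; exact_mod_cast hn
  set w := B.wmin with hwdef
  set g : Finset (Sym2 V) → ℝ := fun F => |B.loopWeight F| ^ (β' - β) with hg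
  set r := B.Zbeta β' / B.Zbeta β with hr
  have hg01 : ∀ F ∈ twoLoops G, 0 ≤ g F ∧ g F ≤ 1 := fun F hF =>
    ⟨Real.rpow_nonneg (abs_nonneg _) _, Real.rpow_le_one (abs_nonneg _)
      (B.abs_loopWeight_le_one hτ hw hF) (by rw [hββ]; positivity)⟩
  have hrw : w ≤ r := by
    rw [hr, le_div_iff₀ (B.Zbeta_pos β), Zbeta, Zbeta, mul_sum]
    refine sum_le_sum fun F hF => ?_
    have h1 := B.wmin_le_rpow hτ hw hF
    rw [← hndef, ← hββ] at h1
    have h2 : |B.loopWeight F| ^ β' = |B.loopWeight F| ^ (β' - β) * |B.loopWeight F| ^ β := by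
      rw [← Real.rpow_add (B.abs_loopWeight_pos hτ hw hF), sub_add_cancel]
    rw [h2]
    exact mul_le_mul_of_nonneg_right h1 (Real.rpow_nonneg (abs_nonneg _) _)
  set A := 48 * n * ε⁻¹ * w⁻¹ with hA
  have hε' : 1 ≤ ε⁻¹ := (one_le_inv₀ hε).2 hε1
  have hw' : 1 ≤ w⁻¹ := (one_le_inv₀ hw).2 hw1
  have hA48 : 48 ≤ A := by
    rw [hA]
    have h1 : 48 ≤ 48 * n := by linarith
    have h2 : 48 * n ≤ 48 * n * ε⁻¹ := le_mul_of_one_le_right (by linarith) hε'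
    have h3 : 48 * n * ε⁻¹ ≤ 48 * n * ε⁻¹ * w⁻¹ := le_mul_of_one_le_right (by linarith) hw'
    linarith
  have hA0 : 0 < A := by linarith
  have hXlog : Real.log 48 ≤ Real.log A := Real.log_le_log (by norm_num) hA48
  have hexp : Real.exp (-Real.log A) = ε * w / (48 * n) := by
    rw [Real.exp_neg, Real.exp_log hA0, hA]
    field_simp
  -- The term with `log 2` in the step count is not needed; it is nonnegative because a connected
  -- graph has `m ≥ n - 1`.
  have hT' : 4 * G.maxDegree * G.edgeFinset.card * n ^ 4 * Real.log A ≤ T := by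
    refine le_trans ?_ hT
    rw [T1Bound, ← hndef, ← hA]
    have h1 := edges_add_one_ge hG
    have h2 := Real.log_nonneg (one_le_two (α := ℝ))
    have h3 : 0 ≤ ((G.edgeFinset.card : ℝ) - n + 1) * Real.log 2 :=
      mul_nonneg (by linarith) h2
    linarith
  -- `144 = 3 * 48`: the extra `log 3` is the one consumed by the rejection step.
  have hN' : 1.2 * n * (Real.log A + Real.log 3) ≤ N := by
    refine le_trans (le_of_eq ?_) hN
    rw [N1Bound, ← hndef, ← Real.log_mul hA0.ne' (by norm_num), hA]
    congr 2
    ring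
  have hsamp := avg_sampleLoop hG h3 hn hd hx g hg01 T N hXlog hT' hN'
  rw [B.loopMean_rpow hτ hw, ← hr, hexp] at hsamp
  set p := (B.sampleLoop β T N).law with hp
  set μ := p.avg g with hμ
  have hdiff : |μ - r| ≤ ε * r / (96 * n) := by
    refine hsamp.trans ?_
    rw [div_div, show 48 * n * 2 = 96 * n by ring]
    gcongr
  have hr0 : 0 < r := hw.trans_le hrw
  have hsmall : ε * r / (96 * n) ≤ r / 192 := by
    rw [div_le_div_iff₀ (by positivity) (by norm_num)]
    have : ε * r ≤ 1 * r := by gcongr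
    nlinarith
  obtain ⟨hd1, hd2⟩ := abs_le.1 hdiff
  have hμ0 : 0 < μ := by linarith
  have hμw : w / 2 ≤ μ := by linarith
  have hX : (((B.sampleLoop β T N).bind fun F => (B.evalWeight F).bind fun x =>
      Timed.charge 3 (|x| ^ (β' - β))) : Timed ℝ).law = p.bind fun F => PMF.pure (g F) := by
    simp only [Timed.law_bind, law_evalWeight, PMF.pure_bind, Timed.law_charge]
    rfl
  have hch := Timed.chernoff p _ g hX (fun F hF => hg01 F
    (mem_twoLoops_of_law_sampleLoop h3 hd hx T N hF)) s μ (ε / (12 * n) * μ) le_rfl hμ0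
    (by positivity) (by
      have : ε / (12 * n) ≤ 1 := by
        rw [div_le_one (by positivity)]
        linarith
      nlinarith)
  refine (MeasureTheory.measure_mono ?_).trans (hch.trans (ENNReal.ofReal_le_ofReal ?_))
  · intro z hz
    rw [Set.mem_ofPred] at hz ⊢
    by_contra hcon
    push Not at hcon
    have h1 : |z - r| ≤ |z - μ| + |μ - r| := abs_sub_le z μ r
    have h2 : ε / (12 * n) * μ ≤ ε / (12 * n) * (193 / 192 * r) := by
      gcongr
      linarith
    have h3 := relative_error_add hε (by linarith : 0 < n) hr0
    linarith
  · have ha : 0 < 6 * n * ν⁻¹ := by positivity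
    have hL0 : 0 ≤ (⌈Real.log (6 * n * ν⁻¹)⌉ : ℝ) := by
      have h1 : 1 ≤ ν⁻¹ := (one_le_inv₀ hν).2 hν1.le
      have h2 : 0 ≤ Real.log (6 * n * ν⁻¹) := Real.log_nonneg (by nlinarith)
      exact_mod_cast Int.ceil_nonneg h2
    have hc : (⌈Real.log (6 * n * ν⁻¹)⌉ : ℝ) ≤ s * (ε / (12 * n) * μ) ^ 2 / (4 * μ) := by
      rw [s1Bound, ← hndef] at hs
      set L : ℝ := (⌈Real.log (6 * n * ν⁻¹)⌉ : ℝ)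
      exact chernoff_exponent_ge hε (by linarith) hw hμw hL0 hs
    calc _ ≤ 2 * (6 * n * ν⁻¹)⁻¹ := by
          gcongr
          exact exp_neg_ceil_log_le ha hc
      _ = ν / (3 * n) := by
          field_simp
          norm_num

/-- Since `ζ` may be tiny or zero, only an absolute error `a = ε(1-2ζ)/6` is sought. Chernoff is
applied with the upper bound `2 * max ζ a` in place of the mean; this is the origin of the maximum
in the sample size. -/
lemma negFraction_accuracy (hG : G.Connected) (h3 : G.maxDegree ≤ 3)
    (hτ : ∀ v, 0 < B.tauV v true ∧ B.tauV v true < 1) (hw : 0 < B.wmin)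
    (hζ : B.zeta < 1 / 2) {ε ν : ℝ} (hε : 0 < ε)
    (hε1 : ε ≤ 1) (hν : 0 < ν) (hν1 : ν < 1) {s N T : ℕ}
    (hs : s2Bound ε ν B.zeta ≤ s) (hN : N2Bound (Fintype.card V) ε B.zeta ≤ N)
    (hT : T2Bound (Fintype.card V) G.edgeFinset.card G.maxDegree ε B.zeta ≤ T) :
    (B.negFraction s N T).law.toOuterMeasure
      {κ | ε * (1 - 2 * B.zeta) / 6 < |κ - B.zeta|} ≤ ENNReal.ofReal (2 * ν / 3) := by
  have hn := B.two_le_card hw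
  have hd := B.degree_pos hG hw
  have hx := B.edgeWeight_rpow hτ hw zero_le_one
  have hζ0 := B.zeta_nonneg
  set n : ℝ := (Fintype.card V : ℝ) with hndef
  have hn2 : (2 : ℝ) ≤ n := by rw [hndef]; exact_mod_cast hn
  set ζ := B.zeta with hζdef
  set b := 1 - 2 * ζ with hb
  have hb0 : 0 < b := by linarith
  have hb1 : b ≤ 1 := by linarith
  set g : Finset (Sym2 V) → ℝ := fun F => if B.loopWeight F < 0 then 1 else 0 with hg
  have hg01 : ∀ F, 0 ≤ g F ∧ g F ≤ 1 := fun F => by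
    rw [hg]
    dsimp only
    split_ifs <;> norm_num
  set A := 48 * ε⁻¹ * b⁻¹ with hA
  have hε' : 1 ≤ ε⁻¹ := (one_le_inv₀ hε).2 hε1
  have hb' : 1 ≤ b⁻¹ := (one_le_inv₀ hb0).2 hb1
  have hA48 : 48 ≤ A := by
    rw [hA]
    have h2 : 48 ≤ 48 * ε⁻¹ := le_mul_of_one_le_right (by norm_num) hε'
    have h3 : 48 * ε⁻¹ ≤ 48 * ε⁻¹ * b⁻¹ := le_mul_of_one_le_right (by linarith) hb'
    linarith
  have hA0 : 0 < A := by linarith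
  have hXlog : Real.log 48 ≤ Real.log A := Real.log_le_log (by norm_num) hA48
  have hexp : Real.exp (-Real.log A) = ε * b / 48 := by
    rw [Real.exp_neg, Real.exp_log hA0, hA]
    field_simp
  have hT' : 4 * G.maxDegree * G.edgeFinset.card * n ^ 4 * Real.log A ≤ T := by
    refine le_trans ?_ hT
    rw [T2Bound, ← hndef, ← hb, ← hA]
    have h1 := edges_add_one_ge hG
    have h2 := Real.log_nonneg (one_le_two (α := ℝ))
    have h3 : 0 ≤ ((G.edgeFinset.card : ℝ) - n + 1) * Real.log 2 :=
      mul_nonneg (by linarith) h2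
    linarith
  have hN' : 1.2 * n * (Real.log A + Real.log 3) ≤ N := by
    refine le_trans (le_of_eq ?_) hN
    rw [N2Bound, ← hndef, ← hb, ← Real.log_mul hA0.ne' (by norm_num), hA]
    congr 2
    ring
  have hsamp := avg_sampleLoop hG h3 hn hd hx g (fun F _ => hg01 F) T N hXlog hT' hN'
  rw [hg, B.loopMean_neg hτ, ← hg, ← hζdef, hexp] at hsamp
  set p := (B.sampleLoop 1 T N).law with hp
  set μ := p.avg g with hμ
  set a := ε * b / 6 with ha
  have ha0 : 0 < a := by positivity
  have hdiff : |μ - ζ| ≤ a / 16 := hsamp.trans (le_of_eq (by rw [ha]; ring))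
  obtain ⟨hd1, hd2⟩ := abs_le.1 hdiff
  have hX : (((B.sampleLoop 1 T N).bind fun F => (B.evalWeight F).bind fun x =>
      Timed.charge 1 (if x < 0 then 1 else 0)) : Timed ℝ).law =
      p.bind fun F => PMF.pure (g F) := by
    simp only [Timed.law_bind, law_evalWeight, PMF.pure_bind, Timed.law_charge]
    rfl
  have hM1 := le_max_left ζ a
  have hM2 := le_max_right ζ a
  have hch := Timed.chernoff p _ g hX (fun F _ => hg01 F) s (2 * max ζ a) (a / 2) (by linarith)
    (by linarith) (by linarith) (by linarith)
  refine (MeasureTheory.measure_mono ?_).trans (hch.trans (ENNReal.ofReal_le_ofReal ?_))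
  · intro z hz
    rw [Set.mem_ofPred] at hz ⊢
    have h1 : |z - ζ| ≤ |z - μ| + |μ - ζ| := abs_sub_le z μ ζ
    linarith
  · have ha3 : 0 < 3 * ν⁻¹ := by positivity
    have hL0 : 0 ≤ (⌈Real.log (3 * ν⁻¹)⌉ : ℝ) := by
      have h1 : 1 ≤ ν⁻¹ := (one_le_inv₀ hν).2 hν1.le
      have h2 : 0 ≤ Real.log (3 * ν⁻¹) := Real.log_nonneg (by linarith)
      exact_mod_cast Int.ceil_nonneg h2
    have hc : (⌈Real.log (3 * ν⁻¹)⌉ : ℝ) ≤ s * (a / 2) ^ 2 / (4 * (2 * max ζ a)) := by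
      rw [s2Bound, ← hb, ← ha] at hs
      set L : ℝ := (⌈Real.log (3 * ν⁻¹)⌉ : ℝ)
      set M := max ζ a
      have hM0 : 0 < M := by linarith
      calc L ≤ 18144 * M * (b ^ 2)⁻¹ * (ε ^ 2)⁻¹ * L * (a / 2) ^ 2 / (4 * (2 * M)) := by
            have h2 : 18144 * M * (b ^ 2)⁻¹ * (ε ^ 2)⁻¹ * L * (a / 2) ^ 2 / (4 * (2 * M)) =
                63 / 4 * L := by
              rw [ha]
              field_simp
              ring
            rw [h2]
            linarith
        _ ≤ s * (a / 2) ^ 2 / (4 * (2 * M)) := by gcongr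
    calc _ ≤ 2 * (3 * ν⁻¹)⁻¹ := by
          gcongr
          exact exp_neg_ceil_log_le ha3 hc
      _ = 2 * ν / 3 := by
          field_simp

/-- Induction over the stages: the ratios telescope, relative errors multiply because all quantities
are nonnegative, and failure probabilities add. -/
lemma anneal_accuracy (hG : G.Connected) (h3 : G.maxDegree ≤ 3)
    (hτ : ∀ v, 0 < B.tauV v true ∧ B.tauV v true < 1) (hw : 0 < B.wmin) {ε ν : ℝ} (hε : 0 < ε)
    (hε1 : ε ≤ 1) (hν : 0 < ν) (hν1 : ν < 1) {s N T : ℕ}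
    (hs : s1Bound (Fintype.card V) ε ν B.wmin ≤ s) (hN : N1Bound (Fintype.card V) ε B.wmin ≤ N)
    (hT : T1Bound (Fintype.card V) G.edgeFinset.card G.maxDegree ε B.wmin ≤ T) (k : ℕ) :
    (B.anneal (fun i => (i : ℝ) / Fintype.card V) s N T k).law.toOuterMeasure
      {P | (1 - ε / (6 * Fintype.card V)) ^ k *
          (B.Zbeta ((k : ℝ) / Fintype.card V) / B.Zbeta 0) ≤ P ∧
        P ≤ (1 + ε / (6 * Fintype.card V)) ^ k *
          (B.Zbeta ((k : ℝ) / Fintype.card V) / B.Zbeta 0)}ᶜ ≤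
      ENNReal.ofReal (k * (ν / (3 * Fintype.card V))) := by
  have hn := B.two_le_card hw
  set n : ℝ := (Fintype.card V : ℝ) with hndef
  have hn2 : (2 : ℝ) ≤ n := by rw [hndef]; exact_mod_cast hn
  set η := ε / (6 * n) with hη
  have hη0 : 0 ≤ η := by positivity
  have hη1 : η ≤ 1 := by
    rw [hη, div_le_one (by positivity)]
    linarith
  induction k with
  | zero =>
    rw [anneal, Timed.law_ret, PMF.toOuterMeasure_pure_apply, if_neg]
    · exact zero_le
    · have : B.Zbeta 0 / B.Zbeta 0 = 1 := div_self (B.Zbeta_pos 0).ne'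
      simp [this]
  | succ k ih =>
    have hst := B.stage_accuracy hG h3 hτ hw hε hε1 hν hν1 hs hN hT
      (β := (k : ℝ) / n) (β' := ((k + 1 : ℕ) : ℝ) / n) (by positivity)
      (by push_cast; rw [← hndef]; field_simp; ring)
    rw [← hndef, ← hη] at hst
    have hsplit : ENNReal.ofReal (((k + 1 : ℕ) : ℝ) * (ν / (3 * n))) =
        ENNReal.ofReal (k * (ν / (3 * n))) + ENNReal.ofReal (ν / (3 * n)) := by
      rw [← ENNReal.ofReal_add (by positivity) (by positivity)]
      congr 1
      push_cast
      ring
    rw [hsplit, anneal, Timed.law_bind]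
    refine PMF.toOuterMeasure_bind_le _ _ _ _ _ _ ih fun P hP => ?_
    rw [Set.mem_compl_iff, not_not] at hP
    obtain ⟨hP1, hP2⟩ := hP
    rw [Timed.law_bind, ← add_zero (ENNReal.ofReal (ν / (3 * n)))]
    refine PMF.toOuterMeasure_bind_le _ _ _ _ _ _ hst fun H hH => ?_
    rw [Set.mem_ofPred, not_lt] at hH
    rw [Timed.law_charge, PMF.toOuterMeasure_pure_apply, if_neg]
    rw [Set.mem_compl_iff, not_not]
    set r := B.Zbeta (((k + 1 : ℕ) : ℝ) / n) / B.Zbeta ((k : ℝ) / n) with hr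
    set R := B.Zbeta ((k : ℝ) / n) / B.Zbeta 0 with hR
    have hr0 : 0 < r := div_pos (B.Zbeta_pos _) (B.Zbeta_pos _)
    have hR0 : 0 < R := div_pos (B.Zbeta_pos _) (B.Zbeta_pos _)
    have hRr : B.Zbeta (((k + 1 : ℕ) : ℝ) / n) / B.Zbeta 0 = R * r := by
      rw [hr, hR]
      have := (B.Zbeta_pos ((k : ℝ) / n)).ne'
      field_simp
    obtain ⟨h1, h2⟩ := abs_le.1 hH
    have hl : 0 ≤ (1 - η) ^ k * R := mul_nonneg (pow_nonneg (by linarith) k) hR0.le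
    have hH1 : (1 - η) * r ≤ H := by linarith
    have hH2 : H ≤ (1 + η) * r := by linarith
    have hH0 : 0 ≤ H := le_trans (mul_nonneg (by linarith) hr0.le) hH1
    rw [Set.mem_ofPred, hRr]
    constructor
    · calc (1 - η) ^ (k + 1) * (R * r) = ((1 - η) ^ k * R) * ((1 - η) * r) := by ring
        _ ≤ P * H := mul_le_mul hP1 hH1 (mul_nonneg (by linarith) hr0.le) (hl.trans hP1)
    · calc P * H ≤ ((1 + η) ^ k * R) * ((1 + η) * r) :=
            mul_le_mul hP2 hH2 hH0 ((hl.trans hP1).trans hP2)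
        _ = (1 + η) ^ (k + 1) * (R * r) := by ring

set_option maxHeartbeats 800000 in
lemma estimate_accuracy (hG : G.Connected) (h3 : G.maxDegree ≤ 3)
    (hτ : ∀ v, 0 < B.tauV v true ∧ B.tauV v true < 1) (hw : 0 < B.wmin)
    (hζ : B.zeta < 1 / 2) {ε ν : ℝ} (hε : 0 < ε) (hε1 : ε ≤ 1) (hν : 0 < ν)
    {s₁ N₁ T₁ s₂ N₂ T₂ : ℕ}
    (hs₁ : s1Bound (Fintype.card V) ε ν B.wmin ≤ s₁)
    (hN₁ : N1Bound (Fintype.card V) ε B.wmin ≤ N₁)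
    (hT₁ : T1Bound (Fintype.card V) G.edgeFinset.card G.maxDegree ε B.wmin ≤ T₁)
    (hs₂ : s2Bound ε ν B.zeta ≤ s₂) (hN₂ : N2Bound (Fintype.card V) ε B.zeta ≤ N₂)
    (hT₂ : T2Bound (Fintype.card V) G.edgeFinset.card G.maxDegree ε B.zeta ≤ T₂) :
    1 - ν ≤ (B.estimate (fun i => (i : ℝ) / Fintype.card V) s₁ N₁ T₁ s₂ N₂ T₂).prob
      {z | |z - B.Z| / B.Z ≤ ε} := by
  -- For `ν ≥ 1` the claim is void; otherwise the logarithms in the sample sizes are nonnegative.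
  rcases le_or_gt 1 ν with hν1 | hν1
  · exact le_trans (by linarith) ENNReal.toReal_nonneg
  have hn := B.two_le_card hw
  have ha := B.anneal_accuracy hG h3 hτ hw hε hε1 hν hν1 hs₁ hN₁ hT₁ (Fintype.card V)
  have hk := B.negFraction_accuracy hG h3 hτ hw hζ hε hε1 hν hν1 hs₂ hN₂ hT₂
  set n : ℝ := (Fintype.card V : ℝ) with hndef
  have hn2 : (2 : ℝ) ≤ n := by rw [hndef]; exact_mod_cast hn
  have hZ1 : B.Zbeta (n / n) = B.Zabs := by
    rw [div_self (by linarith)]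
    simp [Zbeta, Zabs]
  -- At `β = 0` every loop counts one, which explains the explicit prefactor of the estimator.
  have hZ0 : B.Zbeta 0 = 2 ^ ((G.edgeFinset.card : ℤ) - Fintype.card V + 1) := by
    rw [← card_withOdd_empty hG, ← twoLoops_eq h3]
    simp [Zbeta]
  rw [Timed.prob_eq]
  refine PMF.one_sub_le_toOuterMeasure _ _ hν.le ?_
  -- The `n` stages use one third of the failure probability, the sign estimate two thirds.
  have hsplit : ENNReal.ofReal ν =
      ENNReal.ofReal (n * (ν / (3 * n))) + ENNReal.ofReal (2 * ν / 3) := by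
    rw [← ENNReal.ofReal_add (by positivity) (by positivity)]
    congr 1
    field_simp
    ring
  rw [hsplit, estimate, Timed.law_bind]
  refine PMF.toOuterMeasure_bind_le _ _ _ _ _ _ ha fun H hH => ?_
  rw [Set.mem_compl_iff, not_not] at hH
  obtain ⟨hH1, hH2⟩ := hH
  rw [hZ1] at hH1 hH2
  rw [Timed.law_bind, ← add_zero (ENNReal.ofReal (2 * ν / 3))]
  refine PMF.toOuterMeasure_bind_le _ _ _ _ _ _ hk fun κ hκ => ?_
  rw [Set.mem_ofPred, not_lt] at hκ
  rw [Timed.law_charge, PMF.toOuterMeasure_pure_apply, if_neg]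
  rw [Set.mem_compl_iff, not_not, Set.mem_ofPred, ← hZ0]
  set b := 1 - 2 * B.zeta with hb
  have hb0 : 0 < b := by linarith
  have hZa := B.Zabs_pos
  have hK := B.Zbeta_pos 0
  have hZ : B.Z = b * B.Zabs := B.Z_eq
  have hZpos : 0 < B.Z := by rw [hZ]; positivity
  set η := ε / (6 * n) with hη
  have hη0 : 0 ≤ η := by positivity
  have hη1 : η ≤ 1 := by
    rw [hη, div_le_one (by positivity)]
    linarith
  have hnη : n * η = ε / 6 := by rw [hη]; field_simp
  -- Via `exp (ε/6) ≤ 1 + ε/6 + ε²/36`; the lower counterpart below is Bernoulli's inequality.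
  have hup : (1 + η) ^ Fintype.card V ≤ 1 + ε / 5 := by
    calc _ ≤ Real.exp η ^ Fintype.card V :=
          pow_le_pow_left₀ (by linarith) (by linarith [Real.add_one_le_exp η]) _
      _ = Real.exp (ε / 6) := by rw [← Real.exp_nat_mul, ← hndef, hnη]
      _ ≤ 1 + ε / 5 := by
          have h1 : |ε / 6| ≤ 1 := by
            rw [abs_of_pos (by positivity)]
            linarith
          have h2 := (abs_le.1 (Real.abs_exp_sub_one_sub_id_le h1)).2
          nlinarith
  have hlow : 1 - ε / 6 ≤ (1 - η) ^ Fintype.card V := by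
    have h1 := one_add_mul_le_pow (a := -η) (by linarith) (Fintype.card V)
    rw [← hndef, mul_neg, hnη] at h1
    simpa [sub_eq_add_neg] using h1
  set a := H * B.Zbeta 0 / B.Zabs with hadef
  have haH : H = a * (B.Zabs / B.Zbeta 0) := by
    rw [hadef]
    field_simp
  have hq : 0 < B.Zabs / B.Zbeta 0 := div_pos hZa hK
  have ha1 : 1 - ε / 6 ≤ a := by
    rw [haH] at hH1
    exact hlow.trans (le_of_mul_le_mul_right hH1 hq)
  have ha2 : a ≤ 1 + ε / 5 := by
    rw [haH] at hH2
    exact (le_of_mul_le_mul_right hH2 hq).trans hup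
  set c := (1 - 2 * κ) / b with hc
  have hcκ : 1 - 2 * κ = c * b := by
    rw [hc]
    field_simp
  obtain ⟨hκ1, hκ2⟩ := abs_le.1 hκ
  have hc1 : 1 - ε / 3 ≤ c := by
    rw [hc, le_div_iff₀ hb0]
    linarith
  have hc2 : c ≤ 1 + ε / 3 := by
    rw [hc, div_le_iff₀ hb0]
    linarith
  have hval : (1 - 2 * κ) * B.Zbeta 0 * H - B.Z = (c * a - 1) * B.Z := by
    rw [hcκ, haH, hZ]
    field_simp
  rw [hval, abs_mul, abs_of_pos hZpos, mul_div_assoc, div_self hZpos.ne', mul_one, abs_le]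
  exact abs_le.1 (abs_mul_sub_one_le hε hε1 hc1 hc2 ha1 ha2)

end BPModel

/-! ## The cost of the estimator -/

namespace BPModel

variable {V : Type*} [Fintype V] [DecidableEq V] {G : SimpleGraph V} [DecidableRel G.Adj]
  [Nonempty V] (B : BPModel G)

lemma one_le_card : (1 : ℝ) ≤ Fintype.card V := by exact_mod_cast Fintype.card_pos

/-- Stated for arbitrary sets of unordered pairs, because `CostLE.bind` asks for a bound at every
conceivable intermediate state, not only at subgraphs of `G`. -/
lemma card_edges_le (F : Finset (Sym2 V)) : (F.card : ℝ) ≤ (Fintype.card V : ℝ) ^ 2 := by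
  have h : F.card ≤ Fintype.card V ^ 2 := by
    refine (card_le_univ F).trans ?_
    rw [Sym2.card, Nat.choose_two_right, Nat.add_sub_cancel]
    have : 0 < Fintype.card V := Fintype.card_pos
    refine Nat.div_le_of_le_mul ?_
    nlinarith
  exact_mod_cast h

lemma costLE_testTwoRegular (F : Finset (Sym2 V)) :
    (testTwoRegular F).CostLE (2 * (Fintype.card V : ℝ) ^ 3) := by
  refine (Timed.costLE_charge _ _).mono ?_
  have h1 := one_le_card (V := V)
  have h2 := card_edges_le F
  push_cast
  nlinarith [one_le_pow₀ h1 (n := 2)]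

lemma costLE_wormStep (β : ℝ) (F : Finset (Sym2 V)) :
    (B.wormStep β F).CostLE (27 * (Fintype.card V : ℝ) ^ 3) := by
  set n : ℝ := (Fintype.card V : ℝ) with hn
  have h1 : 1 ≤ n := one_le_card
  have hF : ∀ F : Finset (Sym2 V), (F.card : ℝ) ≤ n ^ 2 := card_edges_le
  have hn2 : n ≤ n ^ 2 := le_self_pow₀ h1 two_ne_zero
  have hn3 : n ^ 2 ≤ n ^ 3 := pow_le_pow_right₀ h1 (by norm_num)
  have hfil : ∀ (c : ℕ) (q : V → Prop) [DecidablePred q],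
      (Timed.filter c univ q).CostLE (c * n) := fun c q _ =>
    (Timed.costLE_charge _ _).mono (by rw [card_univ]; push_cast; rfl)
  have hprod : ∀ (F : Finset (Sym2 V)) (f : Sym2 V → ℝ),
      (Timed.prod 2 F f).CostLE (2 * n ^ 2) := fun F f =>
    (Timed.costLE_charge _ _).mono (by push_cast; linarith [hF F])
  have hF1 : (((F.card + 1 : ℕ) : ℝ)) ≤ 2 * n ^ 2 := by
    push_cast
    linarith [hF F]
  have hF2 : (((F.card + 1 : ℕ) : ℝ)) * n ≤ 2 * n ^ 3 := by
    calc _ ≤ 2 * n ^ 2 * n := by gcongr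
      _ = _ := by ring
  refine Timed.CostLE.mono ((costLE_testTwoRegular F).bind fun even =>
    ((hfil _ _).mono hF2).bind fun odd => (Timed.costLE_choose _).bind fun v =>
    (hfil 1 _).bind fun Nv => (Timed.costLE_choose _).bind fun u =>
    (hfil 1 _).bind fun Nu => ((Timed.costLE_charge _ _).mono hF1).bind fun F' =>
    (costLE_testTwoRegular F').bind fun even' => (hprod F _).bind fun wF =>
    (hprod F' _).bind fun wF' => (Timed.costLE_coin _).bind fun accept =>
    Timed.costLE_charge 10 _) ?_
  rw [← hn]
  push_cast
  linarith

lemma costLE_sampleLoop (β : ℝ) (T N : ℕ) :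
    (B.sampleLoop β T N).CostLE (N * ((T + 1) * (27 * (Fintype.card V : ℝ) ^ 3))) := by
  have h1 := one_le_card (V := V)
  induction N with
  | zero => exact (Timed.costLE_ret _).mono (by simp)
  | succ N ih =>
    refine Timed.CostLE.mono ((Timed.costLE_iterate (B.costLE_wormStep β) T ∅).bind fun F =>
      (costLE_testTwoRegular F).bind (l := N * ((T + 1) * (27 * (Fintype.card V : ℝ) ^ 3)))
      fun even => ?_) ?_
    · cases even
      · exact ih
      · exact (Timed.costLE_ret _).mono (by positivity)
    · have : 0 ≤ (Fintype.card V : ℝ) ^ 3 := by positivity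
      push_cast
      linarith

lemma costLE_evalWeight (F : Finset (Sym2 V)) :
    (B.evalWeight F).CostLE (19 * (Fintype.card V : ℝ) ^ 3) := by
  set n : ℝ := (Fintype.card V : ℝ) with hn
  have h1 : 1 ≤ n := one_le_card
  have hF : (F.card : ℝ) ≤ n ^ 2 := card_edges_le F
  have hn2 : n ≤ n ^ 2 := le_self_pow₀ h1 two_ne_zero
  have hn3 : n ^ 2 ≤ n ^ 3 := pow_le_pow_right₀ h1 (by norm_num)
  have e1 : (Timed.prod 5 F B.edgeFactor).CostLE (5 * n ^ 2) :=
    (Timed.costLE_charge _ _).mono (by push_cast; linarith)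
  have e2 : (Timed.filter (F.card + 1) univ (fun v : V => 0 < degIn F v)).CostLE (2 * n ^ 3) := by
    refine (Timed.costLE_charge _ _).mono ?_
    rw [card_univ]
    push_cast
    calc ((F.card : ℝ) + 1) * Fintype.card V ≤ (2 * n ^ 2) * n := by
          rw [← hn]
          gcongr
          linarith
      _ = _ := by ring
  have e3 : ∀ (S : Finset V) (f : V → ℝ),
      (Timed.prod (F.card + 10) S f).CostLE (11 * n ^ 3) := by
    intro S f
    refine (Timed.costLE_charge _ _).mono ?_
    have hS : (S.card : ℝ) ≤ n := by
      rw [hn]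
      exact_mod_cast card_le_univ S
    push_cast
    calc ((F.card : ℝ) + 10) * S.card ≤ (11 * n ^ 2) * n := by
          gcongr
          linarith
      _ = _ := by ring
  refine Timed.CostLE.mono (e1.bind fun x => e2.bind fun VF => (e3 VF _).bind fun y =>
    Timed.costLE_charge 1 _) ?_
  push_cast
  linarith

/-- A bound for the cost of `s` evaluations of samples. -/
def meanCost {R : Type*} [CommSemiring R] (n s N T : R) : R :=
  s * (N * ((T + 1) * (27 * n ^ 3)) + 23 * n ^ 3) + 1

lemma costLE_meanRuns_sample (β : ℝ) (s N T : ℕ) (k : ℕ) (hk : k ≤ 3) (f : ℝ → ℝ) :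
    (Timed.meanRuns ((B.sampleLoop β T N).bind fun F => (B.evalWeight F).bind fun x =>
      Timed.charge k (f x)) s).CostLE (meanCost (Fintype.card V : ℝ) s N T) := by
  have h1 := one_le_pow₀ (one_le_card (V := V)) (n := 3)
  have hk' : (k : ℝ) ≤ 3 := by exact_mod_cast hk
  refine (Timed.costLE_meanRuns ((B.costLE_sampleLoop β T N).bind fun F =>
    (B.costLE_evalWeight F).bind fun x => Timed.costLE_charge k _) s).mono ?_
  rw [meanCost]
  -- `23 = 19 + 3 + 1`: weight evaluation, final charge and accumulation, using `n ^ 3 ≥ 1`.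
  refine add_le_add_left (mul_le_mul_of_nonneg_left ?_ (Nat.cast_nonneg s)) 1
  linarith

lemma costLE_anneal (β : ℕ → ℝ) (s N T k : ℕ) :
    (B.anneal β s N T k).CostLE (k * (meanCost (Fintype.card V : ℝ) s N T + 1)) := by
  induction k with
  | zero => exact (Timed.costLE_ret _).mono (by simp)
  | succ k ih =>
    refine Timed.CostLE.mono (ih.bind fun P =>
      (B.costLE_meanRuns_sample (β k) s N T 3 le_rfl _).bind fun H => Timed.costLE_charge 1 _) ?_
    push_cast
    linarith

/-- A bound for the cost of the estimator. -/
def totalCost {R : Type*} [CommSemiring R] (n s₁ N₁ T₁ s₂ N₂ T₂ : R) : R :=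
  n * (meanCost n s₁ N₁ T₁ + 1) + (meanCost n s₂ N₂ T₂ + (n ^ 2 + 5))

lemma costLE_estimate (β : ℕ → ℝ) (s₁ N₁ T₁ s₂ N₂ T₂ : ℕ) :
    (B.estimate β s₁ N₁ T₁ s₂ N₂ T₂).CostLE
      (totalCost (Fintype.card V : ℝ) s₁ N₁ T₁ s₂ N₂ T₂) := by
  refine (B.costLE_anneal β s₁ N₁ T₁ _).bind fun H =>
    (B.costLE_meanRuns_sample 1 s₂ N₂ T₂ 1 (by norm_num) _).bind fun κ =>
    (Timed.costLE_charge _ _).mono ?_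
  push_cast
  linarith [card_edges_le G.edgeFinset]

/-! ### The polynomial bound for the smallest admissible parameters -/

/-- The cost bound for the smallest admissible parameters, in terms of `n`, `1 / ε`, `log (1 / ν)`,
`1 / wmin` and `1 / (1 - 2 ζ)`. -/
def costBound {R : Type*} [CommSemiring R] (n e l w z : R) : R :=
  totalCost n
    (18144 * n ^ 2 * e ^ 2 * w * (6 * n + l + 1) + 1)
    (2 * n * (144 * n * e * w) + 1)
    (n ^ 2 + 12 * n ^ 6 * (48 * n * e * w) + 1)
    (18144 * z ^ 2 * e ^ 2 * (3 + l + 1) + 1)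
    (2 * n * (144 * e * z) + 1)
    (n ^ 2 + 12 * n ^ 6 * (48 * e * z) + 1)

/-- The polynomial bounding the cost of the estimator. -/
def costPoly : MvPolynomial (Fin 5) ℕ :=
  costBound (MvPolynomial.X 0) (MvPolynomial.X 1) (MvPolynomial.X 2) (MvPolynomial.X 3)
    (MvPolynomial.X 4)

/-- The cost formulas are written over an arbitrary commutative semiring, so the polynomial and its
real values come from one expression. -/
lemma aeval_costPoly (n e l w z : ℝ) :
    MvPolynomial.aeval ![n, e, l, w, z] costPoly = costBound n e l w z := by
  simp [costPoly, costBound, totalCost, meanCost]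

lemma ceil_le_add_one {x y : ℝ} (h : x ≤ y) (hy : 0 ≤ y) : (⌈x⌉₊ : ℝ) ≤ y + 1 :=
  (Nat.cast_le.2 (Nat.ceil_mono h)).trans (Nat.ceil_lt_add_one hy).le

lemma ceil_log_le {c ν : ℝ} (hc : 0 < c) (hν : 0 < ν) :
    (⌈Real.log (c * ν⁻¹)⌉ : ℝ) ≤ c + Real.log ν⁻¹ + 1 := by
  have h1 := (Int.ceil_lt_add_one (Real.log (c * ν⁻¹))).le
  rw [Real.log_mul hc.ne' (inv_ne_zero hν.ne')] at h1 ⊢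
  linarith [Real.log_le_self hc.le]

/-- Crude estimates suffice for polynomiality: `log 2 ≤ 1`, `log A ≤ A`, `m ≤ n²` and `Δ ≤ 3`. -/
lemma steps_le {n Δ A : ℝ} (m : ℝ) (hn : 1 ≤ n) (hm0 : 0 ≤ m) (hm : m ≤ n ^ 2) (hΔ : Δ ≤ 3)
    (hA : 1 ≤ A) :
    (m - n + 1) * Real.log 2 + 4 * Δ * m * n ^ 4 * Real.log A ≤ n ^ 2 + 12 * n ^ 6 * A := by
  have h2 : Real.log 2 ≤ 1 := by linarith [Real.log_two_lt_d9]
  have h20 := Real.log_nonneg (one_le_two (α := ℝ))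
  have hlA := Real.log_nonneg hA
  have e1 : (m - n + 1) * Real.log 2 ≤ n ^ 2 := by
    calc _ ≤ m * Real.log 2 := by gcongr; linarith
      _ ≤ m * 1 := by gcongr
      _ ≤ _ := by linarith
  have e2 : 4 * Δ * m * n ^ 4 * Real.log A ≤ 12 * n ^ 6 * A := by
    calc _ ≤ 4 * 3 * n ^ 2 * n ^ 4 * A := by
          gcongr
          exact Real.log_le_self (by linarith)
      _ = _ := by ring
  linarith

lemma costLE_estimate_minimal (h3 : G.maxDegree ≤ 3) (hwpos : 0 < B.wmin) (hw1 : B.wmin ≤ 1)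
    (hζ : B.zeta < 1 / 2) {ε ν : ℝ} (hε : 0 < ε) (hε1 : ε ≤ 1) (hν : 0 < ν) (hν1 : ν ≤ 1)
    (β : ℕ → ℝ) :
    (B.estimate β ⌈s1Bound (Fintype.card V) ε ν B.wmin⌉₊ ⌈N1Bound (Fintype.card V) ε B.wmin⌉₊
      ⌈T1Bound (Fintype.card V) G.edgeFinset.card G.maxDegree ε B.wmin⌉₊
      ⌈s2Bound ε ν B.zeta⌉₊ ⌈N2Bound (Fintype.card V) ε B.zeta⌉₊
      ⌈T2Bound (Fintype.card V) G.edgeFinset.card G.maxDegree ε B.zeta⌉₊).CostLE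
      (costBound (Fintype.card V : ℝ) ε⁻¹ (Real.log ν⁻¹) B.wmin⁻¹ (1 - 2 * B.zeta)⁻¹) := by
  refine (B.costLE_estimate β _ _ _ _ _ _).mono ?_
  have h1 := one_le_card (V := V)
  have hm := card_edges_le G.edgeFinset
  have hm0 : (0 : ℝ) ≤ G.edgeFinset.card := Nat.cast_nonneg _
  have hΔ : (G.maxDegree : ℝ) ≤ 3 := by exact_mod_cast h3
  have hζ0 := B.zeta_nonneg
  have he : 1 ≤ ε⁻¹ := (one_le_inv₀ hε).2 hε1
  have hw : 1 ≤ B.wmin⁻¹ := (one_le_inv₀ hwpos).2 hw1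
  have hz : 1 ≤ (1 - 2 * B.zeta)⁻¹ := (one_le_inv₀ (by linarith)).2 (by linarith)
  have hl : 0 ≤ Real.log ν⁻¹ := Real.log_nonneg ((one_le_inv₀ hν).2 hν1)
  have hmax : max B.zeta (ε * (1 - 2 * B.zeta) / 6) ≤ 1 := by
    refine max_le (by linarith) ?_
    have : ε * (1 - 2 * B.zeta) ≤ 1 * 1 := by
      gcongr
      · linarith
      · linarith
    linarith
  have hmax0 : 0 ≤ max B.zeta (ε * (1 - 2 * B.zeta) / 6) := le_max_of_le_left hζ0
  have hL2 : (0 : ℝ) ≤ ⌈Real.log (3 * ν⁻¹)⌉ := by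
    have h2 : 0 ≤ Real.log (3 * ν⁻¹) :=
      Real.log_nonneg (by linarith [(one_le_inv₀ hν).2 hν1])
    exact_mod_cast Int.ceil_nonneg h2
  have hlog : ∀ {x : ℝ}, 0 ≤ x → 1.2 * (Fintype.card V : ℝ) * Real.log x ≤
      2 * Fintype.card V * x := fun {x} hx => by
    calc _ ≤ 1.2 * (Fintype.card V : ℝ) * x := by
          gcongr
          exact Real.log_le_self hx
      _ ≤ _ := by gcongr; norm_num
  unfold costBound totalCost meanCost
  generalize hnn : (Fintype.card V : ℝ) = n at *
  generalize hee : ε⁻¹ = e at *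
  generalize hww : B.wmin⁻¹ = w at *
  generalize hzz : (1 - 2 * B.zeta)⁻¹ = z at *
  have a1 : 1 ≤ n * e := one_le_mul_of_one_le_of_one_le h1 he
  have a2 : 1 ≤ n * e * w := one_le_mul_of_one_le_of_one_le a1 hw
  have a3 : 1 ≤ e * z := one_le_mul_of_one_le_of_one_le he hz
  have b1 : (⌈s1Bound (Fintype.card V) ε ν B.wmin⌉₊ : ℝ) ≤
      18144 * n ^ 2 * e ^ 2 * w * (6 * n + Real.log ν⁻¹ + 1) + 1 := by
    refine ceil_le_add_one ?_ (by positivity)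
    rw [s1Bound, hnn, ← inv_pow, hee, hww]
    gcongr
    exact ceil_log_le (by positivity) hν
  have b2 : (⌈N1Bound (Fintype.card V) ε B.wmin⌉₊ : ℝ) ≤ 2 * n * (144 * n * e * w) + 1 := by
    refine ceil_le_add_one ?_ (by positivity)
    rw [N1Bound, hnn, hee, hww]
    exact hlog (by positivity)
  have b3 : (⌈T1Bound (Fintype.card V) G.edgeFinset.card G.maxDegree ε B.wmin⌉₊ : ℝ) ≤
      n ^ 2 + 12 * n ^ 6 * (48 * n * e * w) + 1 := by
    refine ceil_le_add_one ?_ (by positivity)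
    rw [T1Bound, hnn, hee, hww]
    exact steps_le _ h1 hm0 hm hΔ (by linarith)
  have b4 : (⌈s2Bound ε ν B.zeta⌉₊ : ℝ) ≤
      18144 * z ^ 2 * e ^ 2 * (3 + Real.log ν⁻¹ + 1) + 1 := by
    refine ceil_le_add_one ?_ (by positivity)
    rw [s2Bound, ← inv_pow, ← inv_pow, hee, hzz]
    calc _ ≤ 18144 * 1 * z ^ 2 * e ^ 2 * (3 + Real.log ν⁻¹ + 1) := by
          gcongr
          exact ceil_log_le (by norm_num) hν
      _ = _ := by ring
  have b5 : (⌈N2Bound (Fintype.card V) ε B.zeta⌉₊ : ℝ) ≤ 2 * n * (144 * e * z) + 1 := by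
    refine ceil_le_add_one ?_ (by positivity)
    rw [N2Bound, hnn, hee, hzz]
    exact hlog (by positivity)
  have b6 : (⌈T2Bound (Fintype.card V) G.edgeFinset.card G.maxDegree ε B.zeta⌉₊ : ℝ) ≤
      n ^ 2 + 12 * n ^ 6 * (48 * e * z) + 1 := by
    refine ceil_le_add_one ?_ (by positivity)
    rw [T2Bound, hnn, hee, hzz]
    exact steps_le _ h1 hm0 hm hΔ (by linarith)
  -- The cost is monotone in the six parameters, so their bounds can be substituted.
  gcongr

end BPModel

end

theorem theorem2 :
    ∃ P : MvPolynomial (Fin 5) ℕ,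
    ∀ (V : Type*) [Fintype V] [DecidableEq V] [Nonempty V]
      (G : SimpleGraph V) [DecidableRel G.Adj] (B : BPModel G) (n m Δ : ℕ) (ε ν : ℝ),
      n = Fintype.card V → m = G.edgeFinset.card → Δ = G.maxDegree →
      G.Connected → Δ ≤ 3 →
      (∀ v, 0 < B.tauV v true ∧ B.tauV v true < 1) →
      0 < B.wmin → B.zeta < 1 / 2 →
      0 < ε → ε ≤ 1 → 0 < ν →
      0 < B.Z ∧
      (∀ s₁ N₁ T₁ s₂ N₂ T₂ : ℕ,
        s1Bound n ε ν B.wmin ≤ s₁ → N1Bound n ε B.wmin ≤ N₁ → T1Bound n m Δ ε B.wmin ≤ T₁ →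
        s2Bound ε ν B.zeta ≤ s₂ → N2Bound n ε B.zeta ≤ N₂ → T2Bound n m Δ ε B.zeta ≤ T₂ →
        1 - ν ≤ (B.estimate (fun i => (i : ℝ) / n) s₁ N₁ T₁ s₂ N₂ T₂).prob
          {z | |z - B.Z| / B.Z ≤ ε}) ∧
      (ν ≤ 1 →
        (B.estimate (fun i => (i : ℝ) / n)
          ⌈s1Bound n ε ν B.wmin⌉₊ ⌈N1Bound n ε B.wmin⌉₊ ⌈T1Bound n m Δ ε B.wmin⌉₊
          ⌈s2Bound ε ν B.zeta⌉₊ ⌈N2Bound n ε B.zeta⌉₊ ⌈T2Bound n m Δ ε B.zeta⌉₊).CostLE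
          (MvPolynomial.aeval
            ![(n : ℝ), ε⁻¹, Real.log ν⁻¹, B.wmin⁻¹, (1 - 2 * B.zeta)⁻¹] P)) := by
  refine ⟨BPModel.costPoly, ?_⟩
  intro V _ _ _ G _ B n m Δ ε ν hn hm hΔ hG h3 hτ hw hζ hε hε1 hν
  subst hn hm hΔ
  refine ⟨?_, ?_, ?_⟩
  · rw [B.Z_eq]
    exact mul_pos (by linarith) B.Zabs_pos
  · intro s₁ N₁ T₁ s₂ N₂ T₂ hs₁ hN₁ hT₁ hs₂ hN₂ hT₂
    exact B.estimate_accuracy hG h3 hτ hw hζ hε hε1 hν hs₁ hN₁ hT₁ hs₂ hN₂ hT₂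
  · intro hν1
    rw [BPModel.aeval_costPoly]
    exact B.costLE_estimate_minimal h3 hw (B.wmin_le_one hτ hw) hζ hε hε1 hν hν1 _
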